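/- **Setting.** Let $T\ge 1$, $\overline s=(s_1,\dots,s_r)$, $\overline d=(d_1,\dots,d_r)$, $\overline\mu=(\mu_1,\dots,\mu_r)$ be vectors of positive integers and put $$\chi^{(d)}_{\overline\mu,\overline s}(\eta(m))=\sum_{l_1=0}^{d_1}\cdots\sum_{l_r=0}^{d_r}(-1)^{l_1+\dots+l_r}\binom{d_1}{l_1}\cdots\binom{d_r}{l_r}\,\eta(m-\mu_1s_1l_1-\dots-\mu_rs_rl_r)$$ (the same formula is used for steps $\overline\mu$ with all components negative), $$\chi^{(d)}_{\overline\mu}(e^{-i\lambda})=\prod_{j=1}^r(1-e^{-i\lambda\mu_js_j})^{d_j},\qquad \beta^{(d)}(i\lambda)=\prod_{j=1}^r\prod_{k=-[s_j/2]}^{[s_j/2]}(i\lambda-2\pi i k/s_j)^{d_j}.$$ Let $\zeta(m)$, $m\in\mathbb Z$, be a complex stochastic sequence with periodically stationary generalized multiple (GM) increments of period $T$: for all steps $\overline\mu,\overline\mu_1,\overline\mu_2$ (all components positive or all negative) the increments $\chi^{(d)}_{\overline\mu,T\overline s}(\zeta(m))$ have finite second moments, and $\mathsf E\chi^{(d)}_{\overline\mu,T\overline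 s}(\zeta(m))$ and $\mathsf E\chi^{(d)}_{\overline\mu_1,T\overline s}(\zeta(m))\overline{\chi^{(d)}_{\overline\mu_2,T\overline s}(\zeta(k))}$ do not change when $m$, resp. $(m,k)$, is shifted by $T$. Let $\vec\xi(m)=(\xi_1(m),\dots,\xi_T(m))^\top$, $\xi_p(m)=\zeta(mT+p-1)$. Assume that the increments have the spectral density matrix $f(\lambda)=\{f_{pq}(\lambda)\}_{p,q=1}^T$ (positive semidefinite, integrable on $[-\pi,\pi)$), i.e. for all steps $\overline\mu_1,\overline\mu_2$ and all $m,k\in\mathbb Z$ $$\mathsf E\,\chi^{(d)}_{\overline\mu_1,\overline s}(\xi_p(k+m))\overline{\chi^{(d)}_{\overline\mu_2,\overline s}(\xi_q(k))}=\frac1{2\pi}\int_{-\pi}^{\pi}e^{i\lambda m}\chi^{(d)}_{\overline\mu_1}(e^{-i\lambda})\chi^{(d)}_{\overline\mu_2}(e^{i\lambda})\frac{f_{pq}(\lambda)}{|\beta^{(d)}(i\lambda)|^2}\,d\lambda .$$ Fix a step $\overline\mu$ with positive components, assume $\mathsf E\chi^{(d)}_{\overline\mu,\overline s}(\vec\xi(m))=0$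 and the minimality condition: $f(\lambda)$ is invertible for almost all $\lambda$ and $$\int_{-\pi}^{\pi}\mathrm{Tr}\left[\frac{|\beta^{(d)}(i\lambda)|^2}{|\chi^{(d)}_{\overline\mu}(e^{-i\lambda})|^2}f^{-1}(\lambda)\right]d\lambda<\infty .$$ A *spectral process* of the increments is a process $\vec Z(\lambda)=\{Z_p(\lambda)\}_{p=1}^T$, $-\pi\le\lambda<\pi$, with zero-mean uncorrelated increments, $\mathsf E(Z_p(\lambda_2)-Z_p(\lambda_1))\overline{(Z_q(\lambda_2)-Z_q(\lambda_1))}=\frac1{2\pi}\int_{\lambda_1}^{\lambda_2}f_{pq}(\lambda)\,d\lambda$, such that for all steps $\chi^{(d)}_{\overline\mu,\overline s}(\xi_p(m))=\int_{-\pi}^{\pi}e^{im\lambda}\chi^{(d)}_{\overline\mu}(e^{-i\lambda})\beta^{(d)}(i\lambda)^{-1}dZ_p(\lambda)$; stochastic integrals are mean square limits of integrals of step functions converging in $L_2(f)$, where $\langle g_1,g_2\rangle=\int_{-\pi}^{\pi}g_1^\top f\,\overline{g_2}\,d\lambda$. Let $a^{(\zeta)}(k)\in\mathbb C$, $M\ge0$,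 $N=[M/T]$, $A_M\zeta=\sum_{k=0}^Ma^{(\zeta)}(k)\zeta(k)$, and let $\vec a(m)$ have the components $a_p(m)=a^{(\zeta)}(mT+p-1)$ if $mT+p-1\le M$ and $a_p(m)=0$ otherwise. An *elementary estimate* of $A_M\zeta$ is a finite linear combination of $\zeta(m)$, $m\le-1$, whose difference with $A_M\zeta$ is, formally, a finite linear combination of increments $\chi^{(d)}_{\overline\mu,T\overline s}(\zeta(j))$, $j\in\mathbb Z$. A *linear estimate* is a mean square limit of elementary estimates; it is *optimal* if $\Delta=\mathsf E|A_M\zeta-\widehat A_M\zeta|^2$ is least among all linear estimates. Define $d_{\overline\mu}(k)$, $e_\gamma(k)$ by $\sum_{k\ge0}d_{\overline\mu}(k)x^k=\prod_i(\sum_{j\ge0}x^{\mu_is_ij})^{d_i}$, $\sum_k e_\gamma(k)x^k=\prod_i(1-x^{\mu_is_i})^{d_i}$, put $n(\gamma)=\sum_i\mu_is_id_i$ and $$\vec b_N(k)=(D_N^{\overline\mu}\mathbf a_N)_k=\sum_{m=k}^Nd_{\overline\mu}(m-k)\vec a(m)\ \ (0\le k\le N),\quad \vec b_N(k)=0\ \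 (k>N),$$ $$\vec v_N(k)=\sum_{l=0}^{N\wedge(k+n(\gamma))}e_\gamma(l-k)\vec b_N(l)\ \ (-n(\gamma)\le k\le-1),\qquad \vec B_{\overline\mu,N}(e^{i\lambda})=\sum_{k=0}^N\vec b_N(k)e^{i\lambda k}.$$ Let $\mathbf F_{\overline\mu}$ be the (in general unbounded) block Toeplitz operator in $\ell_2$ with entries $$\mathbf F_{\overline\mu}(j,k)=\frac1{2\pi}\int_{-\pi}^{\pi}e^{i\lambda(k-j)}\frac{|\beta^{(d)}(i\lambda)|^2}{|\chi^{(d)}_{\overline\mu}(e^{-i\lambda})|^2}(f^{-1}(\lambda))^{\top}d\lambda,\quad j,k\ge0,$$ i.e. $(\mathbf F_{\overline\mu}\mathbf c)_j$ is the $j$-th Fourier coefficient ($j\ge0$) of $\frac{|\beta^{(d)}(i\lambda)|^2}{|\chi^{(d)}_{\overline\mu}(e^{-i\lambda})|^2}(f^{-1}(\lambda))^{\top}\vec C(\lambda)$, $\vec C(\lambda)=\sum_{k\ge0}\vec c(k)e^{i\lambda k}$, defined for those $\mathbf c\in\ell_2$ for which this function is integrable. **Theorem.** $A_M\zeta=A_N\vec\xi:=\sum_{m=0}^N\vec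 a(m)^\top\vec\xi(m)$. A spectral process exists, the equation $\mathbf F_{\overline\mu}\mathbf c=D_N^{\overline\mu}\mathbf a_N$ has exactly one solution $\mathbf c=\mathbf F_{\overline\mu}^{-1}D_N^{\overline\mu}\mathbf a_N$, and an optimal linear estimate $\widehat A_M\zeta$ exists. For every spectral process $\vec Z$ the optimal linear estimate is, uniquely up to null events, $$\widehat A_M\zeta=\int_{-\pi}^{\pi}(\vec h_{\overline\mu,N}(\lambda))^\top d\vec Z(\lambda)-\sum_{k=-n(\gamma)}^{-1}(\vec v_N(k))^\top\vec\xi(k),$$ with the spectral characteristic $$(\vec h_{\overline\mu,N}(\lambda))^\top=(\vec B_{\overline\mu,N}(e^{i\lambda}))^\top\frac{\chi^{(d)}_{\overline\mu}(e^{-i\lambda})}{\beta^{(d)}(i\lambda)}-\frac{\overline{\beta^{(d)}(i\lambda)}}{\chi^{(d)}_{\overline\mu}(e^{i\lambda})}\,(\vec C(\lambda))^\top f^{-1}(\lambda),\qquad \vec C(\lambda)=\sum_{k=0}^\infty(\mathbf F_{\overline\mu}^{-1}D_N^{\overline\mu}\mathbf a_N)_ke^{i\lambda k};$$ $\vec h_{\overline\mu,N}$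 is the orthogonal projection of $\vec B_{\overline\mu,N}(e^{i\lambda})\chi^{(d)}_{\overline\mu}(e^{-i\lambda})/\beta^{(d)}(i\lambda)$ onto the closed span in $L_2(f)$ of the functions $e^{i\lambda k}\chi^{(d)}_{\overline\mu}(e^{-i\lambda})\beta^{(d)}(i\lambda)^{-1}\boldsymbol\delta_l$, $k\le-1$, $1\le l\le T$, where $\boldsymbol\delta_l$ is the $l$-th unit vector. The mean square error is $$\Delta=\frac1{2\pi}\int_{-\pi}^{\pi}\frac{\overline{\beta^{(d)}(i\lambda)}}{\chi^{(d)}_{\overline\mu}(e^{i\lambda})}(\vec C(\lambda))^\top f^{-1}(\lambda)\overline{\vec C(\lambda)}\frac{\beta^{(d)}(i\lambda)}{\chi^{(d)}_{\overline\mu}(e^{-i\lambda})}d\lambda=\langle D_N^{\overline\mu}\mathbf a_N,\mathbf F_{\overline\mu}^{-1}D_N^{\overline\mu}\mathbf a_N\rangle .$$ *Canonical factorization.* Suppose that $\chi^{(d)}_{\overline\mu,\overline s}(\vec\xi(m))=\sum_{k\ge0}\varphi_{\overline\mu}(k)\vec\varepsilon(m-k)$ with $T\times q$ matrices $\varphi_{\overline\mu}(k)$,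 $\sum_k\|\varphi_{\overline\mu}(k)\|^2<\infty$, and innovations $\vec\varepsilon$ (orthonormal variables $\varepsilon_j(u)$, $1\le j\le q$, $u\in\mathbb Z$, such that for each $t$ the variables with $u\le t$ and the increments at times $\le t$ have the same closed linear span), and that $\frac{|\chi^{(d)}_{\overline\mu}(e^{-i\lambda})|^2}{|\beta^{(d)}(i\lambda)|^2}f(\lambda)=\Phi_{\overline\mu}(e^{-i\lambda})\Phi_{\overline\mu}^*(e^{-i\lambda})$ with $\Phi_{\overline\mu}(e^{-i\lambda})=\sum_{k\ge0}\varphi_{\overline\mu}(k)e^{-i\lambda k}$. Then there is $\Psi_{\overline\mu}$ with $\Psi_{\overline\mu}(e^{-i\lambda})\Phi_{\overline\mu}(e^{-i\lambda})=E_q$ (the $q\times q$ identity matrix) almost everywhere, and for each such $\Psi_{\overline\mu}$, almost everywhere, $$\vec h_{\overline\mu,N}(\lambda)=\frac{\chi^{(d)}_{\overline\mu}(e^{-i\lambda})}{\beta^{(d)}(i\lambda)}\left(\vec B_{\overline\mu,N}(e^{i\lambda})-(\Psi_{\overline\mu}(e^{-i\lambda}))^\top\vec r_{\overline\mu,N}(e^{i\lambda})\right),\qquad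 \Delta=\frac1{2\pi}\int_{-\pi}^{\pi}\|\vec r_{\overline\mu,N}(e^{i\lambda})\|^2d\lambda=\sum_{k=0}^N\|\vec r(k)\|^2,$$ where $\vec r_{\overline\mu,N}(e^{i\lambda})=\sum_{k=0}^N\vec r(k)e^{i\lambda k}$ and $\vec r(k)=\sum_{m=0}^N\sum_{l=k}^N(\varphi_{\overline\mu}(m))^\top\vec a(m+l)\,d_{\overline\mu}(l-k)$. -/

import Mathlib

open MeasureTheory Filter Topology

noncomputable section

namespace GMForecast

/-! ### Generalized multiple increments -/

/-- `χ_{μ,s}^{(d)}(η(m)) = ∑_l (-1)^{l₁+⋯+l_r} C(d₁,l₁)⋯C(d_r,l_r) η(m - ∑ᵢ μᵢ sᵢ lᵢ)`. -/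
def gmIncrement {r : ℕ} (s d : Fin r → ℕ) (μ : Fin r → ℤ) (η : ℤ → ℂ) (m : ℤ) : ℂ :=
  ∑ l ∈ Fintype.piFinset (fun i => Finset.range (d i + 1)),
    (∏ i, (-1 : ℂ) ^ l i * ((d i).choose (l i) : ℂ)) * η (m - ∑ i, μ i * (s i : ℤ) * (l i : ℤ))

/-- Admissible steps: all components positive, or all components negative. -/
def IsStep {r : ℕ} (μ : Fin r → ℤ) : Prop := (∀ i, 0 < μ i) ∨ (∀ i, μ i < 0)

/-- A positive step vector, seen as an integer one. -/
def zstep {r : ℕ} (μ : Fin r → ℕ) : Fin r → ℤ := fun i => (μ i : ℤ)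

/-- The blocks `ξ_p(m) = ζ(mT + p - 1)`, `p = 1, …, T` (here `p` is counted from `0`). -/
def blocks {Ω : Type*} (T : ℕ) (ζ : ℤ → Ω → ℂ) (m : ℤ) (p : Fin T) (ω : Ω) : ℂ :=
  ζ (m * (T : ℤ) + (p : ℤ)) ω

/-- The vector sequence of increments `χ_{μ,s}^{(d)}(ξ_p(m))`. -/
def vecIncrement {Ω : Type*} {r T : ℕ} (s d : Fin r → ℕ) (μ : Fin r → ℤ)
    (ξ : ℤ → Fin T → Ω → ℂ) (m : ℤ) (p : Fin T) (ω : Ω) : ℂ :=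
  gmIncrement s d μ (fun j => ξ j p ω) m

/-- `ζ` has periodically stationary GM increments with period `T`: the increments with seasons
`T s` have finite second moments, and their first and second moments are `T`-periodic. -/
structure IsPeriodicallyStationary {Ω : Type*} [MeasurableSpace Ω] (P : Measure Ω) {r : ℕ}
    (T : ℕ) (s d : Fin r → ℕ) (ζ : ℤ → Ω → ℂ) : Prop where
  measurable : ∀ m, AEStronglyMeasurable (ζ m) P
  memLp : ∀ μ, IsStep μ → ∀ m,
    MemLp (fun ω => gmIncrement (fun i => T * s i) d μ (fun j => ζ j ω) m) 2 P
  mean : ∀ μ, IsStep μ → ∀ m : ℤ,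
    ∫ ω, gmIncrement (fun i => T * s i) d μ (fun j => ζ j ω) (m + T) ∂P =
      ∫ ω, gmIncrement (fun i => T * s i) d μ (fun j => ζ j ω) m ∂P
  covariance : ∀ μ₁ μ₂, IsStep μ₁ → IsStep μ₂ → ∀ m k : ℤ,
    ∫ ω, gmIncrement (fun i => T * s i) d μ₁ (fun j => ζ j ω) (m + T) *
        star (gmIncrement (fun i => T * s i) d μ₂ (fun j => ζ j ω) (k + T)) ∂P =
      ∫ ω, gmIncrement (fun i => T * s i) d μ₁ (fun j => ζ j ω) m *
        star (gmIncrement (fun i => T * s i) d μ₂ (fun j => ζ j ω) k) ∂P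

/-! ### The spectral domain -/

/-- Lebesgue measure on `[-π, π)`. -/
abbrev circ : Measure ℝ := volume.restrict (Set.Ico (-Real.pi) Real.pi)

/-- `e^{i n θ}`. -/
def ex (n : ℤ) (θ : ℝ) : ℂ := Complex.exp (Complex.I * (n : ℂ) * (θ : ℂ))

/-- `χ_μ^{(d)}(e^{-iθ}) = ∏ⱼ (1 - e^{-iθ μⱼ sⱼ})^{dⱼ}`; so `χ_μ^{(d)}(e^{iθ})` is
`chi s d μ (-θ)`. -/
def chi {r : ℕ} (s d : Fin r → ℕ) (μ : Fin r → ℤ) (θ : ℝ) : ℂ :=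
  ∏ j, (1 - ex (-(μ j * (s j : ℤ))) θ) ^ d j

/-- `β^{(d)}(iθ) = ∏ⱼ ∏_{|k| ≤ [sⱼ/2]} (iθ - 2πik/sⱼ)^{dⱼ}`. -/
def beta {r : ℕ} (s d : Fin r → ℕ) (θ : ℝ) : ℂ :=
  ∏ j, ∏ k ∈ Finset.Icc (-((s j / 2 : ℕ) : ℤ)) ((s j / 2 : ℕ) : ℤ),
    (Complex.I * (θ : ℂ) - 2 * (Real.pi : ℂ) * Complex.I * (k : ℂ) / (s j : ℂ)) ^ d j

open scoped ComplexOrder in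
/-- `f` is the spectral density matrix of the increments of `ξ`, with respect to `dθ/2π`. -/
structure IsSpectralDensity {Ω : Type*} [MeasurableSpace Ω] (P : Measure Ω) {r T : ℕ}
    (s d : Fin r → ℕ) (ξ : ℤ → Fin T → Ω → ℂ) (f : ℝ → Matrix (Fin T) (Fin T) ℂ) : Prop where
  integrable : ∀ p q, Integrable (fun θ => f θ p q) circ
  posSemidef : ∀ᵐ θ ∂circ, (f θ).PosSemidef
  structural : ∀ μ₁ μ₂, IsStep μ₁ → IsStep μ₂ → ∀ (p q : Fin T) (m k : ℤ),
    ∫ ω, vecIncrement s d μ₁ ξ (k + m) p ω * star (vecIncrement s d μ₂ ξ k q ω) ∂P =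
      1 / (2 * (Real.pi : ℂ)) * ∫ θ, ex m θ * (chi s d μ₁ θ * chi s d μ₂ (-θ) /
        ((‖beta s d θ‖ ^ 2 : ℝ) : ℂ)) * f θ p q ∂circ

/-- The matrix function `|β^{(d)}(iθ)|² / |χ_μ^{(d)}(e^{-iθ})|² f(θ)⁻¹`. -/
def invDensity {r T : ℕ} (s d μ : Fin r → ℕ) (f : ℝ → Matrix (Fin T) (Fin T) ℂ) (θ : ℝ) :
    Matrix (Fin T) (Fin T) ℂ :=
  ((‖beta s d θ‖ ^ 2 / ‖chi s d (zstep μ) θ‖ ^ 2 : ℝ) : ℂ) • (f θ)⁻¹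

/-- The minimality condition: `f` is invertible almost everywhere and
`∫ Tr[|β|²/|χ_μ|² f⁻¹] dθ < ∞`. -/
def IsMinimal {r T : ℕ} (s d μ : Fin r → ℕ) (f : ℝ → Matrix (Fin T) (Fin T) ℂ) : Prop :=
  (∀ᵐ θ ∂circ, IsUnit (f θ)) ∧ Integrable (fun θ => (invDensity s d μ f θ).trace) circ

/-- `‖g‖²` in `L₂(f)`: `∫ gᵀ f ḡ dθ`. -/
def sqNorm {T : ℕ} (f : ℝ → Matrix (Fin T) (Fin T) ℂ) (g : ℝ → Fin T → ℂ) : ENNReal :=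
  ∫⁻ θ, ENNReal.ofReal (g θ ⬝ᵥ (f θ).mulVec (star (g θ))).re ∂circ

/-- `g` is a square integrable function on `[-π, π)` with Fourier series `∑ₙ c(n) e^{inθ}`. -/
def HasFourierSeries (g : ℝ → ℂ) (c : ℤ → ℂ) : Prop :=
  MemLp g 2 circ ∧ ∀ n : ℤ, 1 / (2 * (Real.pi : ℂ)) * ∫ θ, ex (-n) θ * g θ ∂circ = c n

/-- `C(θ) = ∑_{k ≥ 0} c(k) e^{ikθ}`, in mean square. -/
def IsSymbol {T : ℕ} (c : ℕ → Fin T → ℂ) (C : ℝ → Fin T → ℂ) : Prop :=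
  ∀ p, HasFourierSeries (fun θ => C θ p) (fun n => if 0 ≤ n then c n.toNat p else 0)

/-! ### Spectral process and stochastic integral -/

/-- Vector step functions `∑ᵢ wᵢ 1_{[aᵢ, bᵢ)}` on `[-π, π)`. -/
structure StepFunction (T : ℕ) where
  n : ℕ
  a : Fin n → ℝ
  b : Fin n → ℝ
  w : Fin n → Fin T → ℂ
  left_le : ∀ i, -Real.pi ≤ a i
  lt : ∀ i, a i < b i
  lt_right : ∀ i, b i < Real.pi

/-- The values of a step function. -/
def StepFunction.eval {T : ℕ} (S : StepFunction T) (θ : ℝ) (p : Fin T) : ℂ :=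
  ∑ i, Set.indicator (Set.Ico (S.a i) (S.b i)) (fun _ => S.w i p) θ

/-- The integral `∫ Sᵀ dZ = ∑ᵢ wᵢᵀ (Z(bᵢ) - Z(aᵢ))` of a step function. -/
def StepFunction.integral {T : ℕ} {Ω : Type*} (S : StepFunction T) (Z : ℝ → Fin T → Ω → ℂ)
    (ω : Ω) : ℂ :=
  ∑ i, ∑ p, S.w i p * (Z (S.b i) p ω - Z (S.a i) p ω)

/-- `Y = ∫_{-π}^{π} gᵀ dZ`: mean square limit of integrals of step functions that converge to `g`
in `L₂(f)`. -/
def HasSpectralIntegral {Ω : Type*} [MeasurableSpace Ω] (P : Measure Ω) {T : ℕ}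
    (f : ℝ → Matrix (Fin T) (Fin T) ℂ) (Z : ℝ → Fin T → Ω → ℂ) (g : ℝ → Fin T → ℂ)
    (Y : Ω → ℂ) : Prop :=
  (∀ p, AEStronglyMeasurable (fun θ => g θ p) circ) ∧ AEStronglyMeasurable Y P ∧
  ∃ S : ℕ → StepFunction T,
    Tendsto (fun n => sqNorm f (fun θ p => (S n).eval θ p - g θ p)) atTop (𝓝 0) ∧
    Tendsto (fun n => eLpNorm (fun ω => (S n).integral Z ω - Y ω) 2 P) atTop (𝓝 0)

/-- `Z` is the spectral process of the increments of `ξ`: it has uncorrelated increments with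
structure function `∫ f dθ/2π`, and
`χ_{μ,s}^{(d)}(ξ_p(m)) = ∫ e^{imθ} χ_μ^{(d)}(e^{-iθ}) / β^{(d)}(iθ) dZ_p(θ)`. -/
structure IsSpectralProcess {Ω : Type*} [MeasurableSpace Ω] (P : Measure Ω) {r T : ℕ}
    (s d : Fin r → ℕ) (ξ : ℤ → Fin T → Ω → ℂ) (f : ℝ → Matrix (Fin T) (Fin T) ℂ)
    (Z : ℝ → Fin T → Ω → ℂ) : Prop where
  memLp : ∀ a b : ℝ, -Real.pi ≤ a → a < b → b < Real.pi → ∀ p,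
    MemLp (fun ω => Z b p ω - Z a p ω) 2 P
  mean : ∀ a b : ℝ, -Real.pi ≤ a → a < b → b < Real.pi → ∀ p,
    ∫ ω, (Z b p ω - Z a p ω) ∂P = 0
  structural : ∀ a b : ℝ, -Real.pi ≤ a → a < b → b < Real.pi → ∀ p q,
    ∫ ω, (Z b p ω - Z a p ω) * star (Z b q ω - Z a q ω) ∂P =
      1 / (2 * (Real.pi : ℂ)) * ∫ θ in Set.Ico a b, f θ p q
  uncorrelated : ∀ a b a' b' : ℝ, -Real.pi ≤ a → a < b → b ≤ a' → a' < b' → b' < Real.pi →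
    ∀ p q, ∫ ω, (Z b p ω - Z a p ω) * star (Z b' q ω - Z a' q ω) ∂P = 0
  representation : ∀ μ, IsStep μ → ∀ (m : ℤ) (p : Fin T),
    HasSpectralIntegral P f Z
      (fun θ => Pi.single p (ex m θ * (chi s d μ θ / beta s d θ))) (vecIncrement s d μ ξ m p)

/-! ### The functional and its linear estimates -/

/-- `A_M ζ = ∑_{k=0}^M a(k) ζ(k)`. -/
def functional {Ω : Type*} (a : ℕ → ℂ) (M : ℕ) (ζ : ℤ → Ω → ℂ) (ω : Ω) : ℂ :=
  ∑ k ∈ Finset.range (M + 1), a k * ζ (k : ℤ) ω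

/-- `u` is the coefficient sequence of a finite linear combination `∑_{k ≤ -1} u(k) ζ(k)` of
observations such that `A_M ζ - ∑ u(k) ζ(k)` is formally (that is, for every numerical sequence
`η` in place of `ζ`) a finite linear combination of GM increments. -/
def IsElementaryEstimate {r : ℕ} (T : ℕ) (s d μ : Fin r → ℕ) (a : ℕ → ℂ) (M : ℕ)
    (u : ℤ →₀ ℂ) : Prop :=
  (∀ k ∈ u.support, k ≤ -1) ∧
  ∃ b : ℤ →₀ ℂ, ∀ η : ℤ → ℂ,
    ∑ k ∈ Finset.range (M + 1), a k * η (k : ℤ) - u.sum (fun k x => x * η k) =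
      b.sum (fun j y => y * gmIncrement (fun i => T * s i) d (zstep μ) η j)

/-- A linear estimate of `A_M ζ` based on `ζ(m)`, `m ≤ -1`: a mean square limit of elementary
estimates. -/
def IsLinearEstimate {Ω : Type*} [MeasurableSpace Ω] (P : Measure Ω) {r : ℕ} (T : ℕ)
    (s d μ : Fin r → ℕ) (ζ : ℤ → Ω → ℂ) (a : ℕ → ℂ) (M : ℕ) (Y : Ω → ℂ) : Prop :=
  AEStronglyMeasurable Y P ∧
  ∃ u : ℕ → (ℤ →₀ ℂ), (∀ n, IsElementaryEstimate T s d μ a M (u n)) ∧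
    Tendsto (fun n => eLpNorm (fun ω => (u n).sum (fun k x => x * ζ k ω) - Y ω) 2 P)
      atTop (𝓝 0)

/-- The mean square error `E|A_M ζ - Y|²`. -/
def mse {Ω : Type*} [MeasurableSpace Ω] (P : Measure Ω) (ζ : ℤ → Ω → ℂ) (a : ℕ → ℂ) (M : ℕ)
    (Y : Ω → ℂ) : ℝ :=
  ∫ ω, ‖functional a M ζ ω - Y ω‖ ^ 2 ∂P

/-- `Y` is a linear estimate of `A_M ζ` with the least mean square error. -/
def IsOptimalEstimate {Ω : Type*} [MeasurableSpace Ω] (P : Measure Ω) {r : ℕ} (T : ℕ)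
    (s d μ : Fin r → ℕ) (ζ : ℤ → Ω → ℂ) (a : ℕ → ℂ) (M : ℕ) (Y : Ω → ℂ) : Prop :=
  IsLinearEstimate P T s d μ ζ a M Y ∧
  MemLp (fun ω => functional a M ζ ω - Y ω) 2 P ∧
  ∀ Y', IsLinearEstimate P T s d μ ζ a M Y' → mse P ζ a M Y ≤ mse P ζ a M Y'

/-- `a_p(m) = a(mT + p - 1)` if `mT + p - 1 ≤ M`, and `0` otherwise. -/
def vecCoeff (T : ℕ) (a : ℕ → ℂ) (M : ℕ) (m : ℕ) (p : Fin T) : ℂ :=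
  if m * T + (p : ℕ) ≤ M then a (m * T + (p : ℕ)) else 0

/-- `d_μ(k)`: coefficient of `x^k` in `∏ᵢ (∑ⱼ x^{μᵢ sᵢ j})^{dᵢ}`. -/
def dCoeff {r : ℕ} (s d μ : Fin r → ℕ) (k : ℕ) : ℂ :=
  PowerSeries.coeff k
    (∏ i, (PowerSeries.mk (fun n => if μ i * s i ∣ n then (1 : ℂ) else 0)) ^ d i)

/-- `e_γ(k)`: coefficient of `x^k` in `∏ᵢ (1 - x^{μᵢ sᵢ})^{dᵢ}`. -/
def eCoeff {r : ℕ} (s d μ : Fin r → ℕ) (k : ℕ) : ℂ :=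
  (∏ i, (1 - (Polynomial.X : Polynomial ℂ) ^ (μ i * s i)) ^ d i).coeff k

/-- `n(γ) = ∑ᵢ μᵢ sᵢ dᵢ`. -/
def nGamma {r : ℕ} (s d μ : Fin r → ℕ) : ℕ := ∑ i, μ i * s i * d i

/-- `b_N(k) = (D_N^μ a_N)_k = ∑_{m=k}^N d_μ(m-k) a(m)`, which is `0` for `k > N`; `N = [M/T]`. -/
def bCoeff {r : ℕ} (T : ℕ) (s d μ : Fin r → ℕ) (a : ℕ → ℂ) (M : ℕ) (k : ℕ) (p : Fin T) : ℂ :=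
  ∑ m ∈ Finset.Icc k (M / T), dCoeff s d μ (m - k) * vecCoeff T a M m p

/-- `v_N(k) = ∑_{l=0}^{min(N, k + n(γ))} e_γ(l-k) b_N(l)`, for `-n(γ) ≤ k ≤ -1`. -/
def vCoeff {r : ℕ} (T : ℕ) (s d μ : Fin r → ℕ) (a : ℕ → ℂ) (M : ℕ) (k : ℤ) (p : Fin T) : ℂ :=
  ∑ l ∈ Finset.range (min (M / T) (k + (nGamma s d μ : ℤ)).toNat + 1),
    eCoeff s d μ ((l : ℤ) - k).toNat * bCoeff T s d μ a M l p

/-- `V_N ξ = ∑_{k=-n(γ)}^{-1} v_N(k)ᵀ ξ(k)`. -/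
def initialPart {Ω : Type*} {r : ℕ} (T : ℕ) (s d μ : Fin r → ℕ) (ζ : ℤ → Ω → ℂ) (a : ℕ → ℂ)
    (M : ℕ) (ω : Ω) : ℂ :=
  ∑ k ∈ Finset.Icc (-(nGamma s d μ : ℤ)) (-1), ∑ p : Fin T,
    vCoeff T s d μ a M k p * blocks T ζ k p ω

/-- `B_{μ,N}(e^{iθ}) = ∑_{k=0}^N b_N(k) e^{ikθ}`. -/
def BFun {r : ℕ} (T : ℕ) (s d μ : Fin r → ℕ) (a : ℕ → ℂ) (M : ℕ) (θ : ℝ) (p : Fin T) : ℂ :=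
  ∑ k ∈ Finset.range (M / T + 1), bCoeff T s d μ a M k p * ex (k : ℤ) θ

/-! ### The operator `F_μ` and the spectral characteristic -/

/-- The matrix entries of `F_μ`: the Fourier coefficients
`F_μ(j,k) = (1/2π) ∫ e^{iθ(k-j)} |β|²/|χ_μ|² (f(θ)⁻¹)ᵀ dθ`. -/
def FEntry {r T : ℕ} (s d μ : Fin r → ℕ) (f : ℝ → Matrix (Fin T) (Fin T) ℂ) (j k : ℕ) :
    Matrix (Fin T) (Fin T) ℂ :=
  Matrix.of fun p q => 1 / (2 * (Real.pi : ℂ)) *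
    ∫ θ, ex ((k : ℤ) - (j : ℤ)) θ * invDensity s d μ f θ q p ∂circ

/-- `F_μ c = b` for the (in general unbounded) block Toeplitz operator `F_μ` in `ℓ₂` with entries
`FEntry`: `b(j)` is, for `j ≥ 0`, the `j`-th Fourier coefficient of
`|β|²/|χ_μ|² (f⁻¹)ᵀ ∑ₖ c(k) e^{ikθ}`, where `c` is in the domain if this function is
integrable. -/
def FApply {r T : ℕ} (s d μ : Fin r → ℕ) (f : ℝ → Matrix (Fin T) (Fin T) ℂ)
    (c b : ℕ → Fin T → ℂ) : Prop :=
  ∃ C : ℝ → Fin T → ℂ, IsSymbol c C ∧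
    ∀ p, Integrable (fun θ => (invDensity s d μ f θ).transpose.mulVec (C θ) p) circ ∧
      ∀ j : ℕ, 1 / (2 * (Real.pi : ℂ)) *
        ∫ θ, ex (-(j : ℤ)) θ * (invDensity s d μ f θ).transpose.mulVec (C θ) p ∂circ = b j p

theorem ex_add (m n : ℤ) (θ : ℝ) : ex m θ * ex n θ = ex (m + n) θ := by
  simp only [ex, ← Complex.exp_add]
  congr 1
  push_cast
  ring

theorem continuous_ex (m : ℤ) : Continuous (ex m) := by
  unfold ex
  fun_prop

theorem norm_ex (m : ℤ) (θ : ℝ) : ‖ex m θ‖ = 1 := by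
  have h : Complex.I * (m : ℂ) * (θ : ℂ) = ((m * θ : ℝ) : ℂ) * Complex.I := by
    push_cast
    ring
  rw [ex, h, Complex.norm_exp_ofReal_mul_I]

theorem memLp_ex (m : ℤ) : MemLp (ex m) 2 circ :=
  MemLp.of_bound (continuous_ex m).aestronglyMeasurable 1
    (Filter.Eventually.of_forall fun θ => (norm_ex m θ).le)

theorem integral_ex (m : ℤ) :
    ∫ θ, ex m θ ∂circ = if m = 0 then 2 * (Real.pi : ℂ) else 0 := by
  rw [integral_Ico_eq_integral_Ioc, ← intervalIntegral.integral_of_le (by linarith [Real.pi_pos])]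
  split_ifs with h
  · subst h
    simp [ex]
    ring
  · have hc : Complex.I * (m : ℂ) ≠ 0 := mul_ne_zero Complex.I_ne_zero (by exact_mod_cast h)
    simp only [ex]
    rw [integral_exp_mul_complex hc, div_eq_zero_iff]
    left
    have h2 : Complex.I * (m : ℂ) * ((Real.pi : ℝ) : ℂ) =
        Complex.I * (m : ℂ) * ((-Real.pi : ℝ) : ℂ) + m * (2 * Real.pi * Complex.I) := by
      push_cast
      ring
    rw [h2, Complex.exp_periodic.int_mul m _, sub_self]

/-- On finite sequences `F_μ` acts as the matrix with entries `FEntry`. -/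
theorem FApply_of_finite {r T : ℕ} (s d μ : Fin r → ℕ) (f : ℝ → Matrix (Fin T) (Fin T) ℂ)
    (hI : ∀ p q, Integrable (fun θ => invDensity s d μ f θ p q) circ)
    (n : ℕ) (c : ℕ → Fin T → ℂ) (hc : ∀ k, n ≤ k → c k = 0) :
    FApply s d μ f c (fun j => ∑ k ∈ Finset.range n, (FEntry s d μ f j k).mulVec (c k)) := by
  have hexI : ∀ (m : ℤ) (p q : Fin T),
      Integrable (fun θ => ex m θ * invDensity s d μ f θ p q) circ := fun m p q =>
    (hI p q).bdd_mul (continuous_ex m).aestronglyMeasurable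
      (Filter.Eventually.of_forall fun θ => (norm_ex m θ).le)
  have hpi : (2 * (Real.pi : ℂ)) ≠ 0 := by
    simp [Real.pi_ne_zero]
  refine ⟨fun θ p => ∑ k ∈ Finset.range n, c k p * ex (k : ℤ) θ, ?_, ?_⟩
  · intro p
    refine ⟨memLp_finsetSum _ fun k _ => (memLp_ex _).const_mul _, fun m => ?_⟩
    have h1 : ∀ θ, ex (-m) θ * ∑ k ∈ Finset.range n, c k p * ex (k : ℤ) θ =
        ∑ k ∈ Finset.range n, c k p * ex (-m + k) θ := by
      intro θ
      rw [Finset.mul_sum]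
      refine Finset.sum_congr rfl fun k _ => ?_
      rw [← ex_add]
      ring
    simp only [h1]
    rw [integral_finsetSum _ fun k _ =>
      (((memLp_ex _).integrable (by norm_num)).const_mul _)]
    simp only [integral_const_mul, integral_ex]
    split_ifs with hm
    · obtain ⟨j, rfl⟩ := Int.eq_ofNat_of_zero_le hm
      have h2 : ∀ k : ℕ, (-(j : ℤ) + k = 0) ↔ k = j := fun k => by omega
      simp only [h2, mul_ite, mul_zero, Finset.sum_ite_eq', Finset.mem_range, Int.toNat_natCast]
      split_ifs with hj
      · field_simp
      · rw [hc j (by omega)]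
        simp
    · rw [Finset.sum_eq_zero]
      · simp
      · intro k _
        rw [if_neg (by omega), mul_zero]
  · intro p
    have h1 : ∀ θ, (invDensity s d μ f θ).transpose.mulVec
        (fun p => ∑ k ∈ Finset.range n, c k p * ex (k : ℤ) θ) p =
        ∑ k ∈ Finset.range n, ∑ q, c k q * (ex (k : ℤ) θ * invDensity s d μ f θ q p) := by
      intro θ
      simp only [Matrix.mulVec, dotProduct, Matrix.transpose_apply, Finset.mul_sum]
      rw [Finset.sum_comm]
      refine Finset.sum_congr rfl fun k _ => Finset.sum_congr rfl fun q _ => ?_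
      ring
    refine ⟨?_, fun j => ?_⟩
    · simp only [h1]
      exact integrable_finsetSum _ fun k _ => integrable_finsetSum _ fun q _ =>
        (hexI _ _ _).const_mul _
    · have h2 : ∀ θ, ex (-(j : ℤ)) θ * ∑ k ∈ Finset.range n, ∑ q,
          c k q * (ex (k : ℤ) θ * invDensity s d μ f θ q p) =
          ∑ k ∈ Finset.range n, ∑ q,
            c k q * (ex ((k : ℤ) - (j : ℤ)) θ * invDensity s d μ f θ q p) := by
        intro θ
        simp only [Finset.mul_sum]
        refine Finset.sum_congr rfl fun k _ => Finset.sum_congr rfl fun q _ => ?_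
        rw [sub_eq_add_neg, ← ex_add]
        ring
      simp only [h1, h2]
      rw [integral_finsetSum _ fun k _ => integrable_finsetSum _ fun q _ =>
        (hexI _ _ _).const_mul _]
      rw [Finset.sum_apply, Finset.mul_sum]
      refine Finset.sum_congr rfl fun k _ => ?_
      rw [integral_finsetSum _ fun q _ => (hexI _ _ _).const_mul _, Finset.mul_sum]
      simp only [Matrix.mulVec, dotProduct, FEntry, Matrix.of_apply, integral_const_mul]
      refine Finset.sum_congr rfl fun q _ => ?_
      ring

/-- `h_N(θ)ᵀ = B_N(e^{iθ})ᵀ χ_μ(e^{-iθ})/β(iθ) - conj(β(iθ))/χ_μ(e^{iθ}) C(θ)ᵀ f(θ)⁻¹`. -/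
def hFun {r : ℕ} (T : ℕ) (s d μ : Fin r → ℕ) (f : ℝ → Matrix (Fin T) (Fin T) ℂ) (a : ℕ → ℂ)
    (M : ℕ) (C : ℝ → Fin T → ℂ) (θ : ℝ) (p : Fin T) : ℂ :=
  BFun T s d μ a M θ p * (chi s d (zstep μ) θ / beta s d θ) -
    star (beta s d θ) / chi s d (zstep μ) (-θ) * Matrix.vecMul (C θ) (f θ)⁻¹ p

/-- `h` is the spectral characteristic of the estimate of `B_N χ ξ`: it lies in `L₂^{0-}(f)`, the
closed linear span in `L₂(f)` of `e^{ikθ} χ_μ(e^{-iθ})/β(iθ) δ_l`, `k ≤ -1`, and the difference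
`B_N χ_μ/β - h` is orthogonal to `L₂^{0-}(f)`. -/
structure IsSpectralCharacteristic {r : ℕ} (T : ℕ) (s d μ : Fin r → ℕ)
    (f : ℝ → Matrix (Fin T) (Fin T) ℂ) (a : ℕ → ℂ) (M : ℕ) (h : ℝ → Fin T → ℂ) : Prop where
  measurable : ∀ p, AEStronglyMeasurable (fun θ => h θ p) circ
  mem : ∃ S : ℕ → (ℤ →₀ (Fin T → ℂ)), (∀ n, ∀ k ∈ (S n).support, k ≤ -1) ∧
    Tendsto (fun n => sqNorm f (fun θ p =>
      (S n).sum (fun k w => w p * (ex k θ * (chi s d (zstep μ) θ / beta s d θ))) - h θ p))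
      atTop (𝓝 0)
  orthogonal : ∀ k : ℤ, k ≤ -1 → ∀ l : Fin T,
    ∫ θ, (fun p => BFun T s d μ a M θ p * (chi s d (zstep μ) θ / beta s d θ) - h θ p) ⬝ᵥ
      (f θ).mulVec (star (Pi.single l (ex k θ * (chi s d (zstep μ) θ / beta s d θ)))) ∂circ = 0

/-! ### Canonical factorization -/

/-- `H^q(X)`: closed linear span in `L₂(P)` of the components of `X(m)`, `m ≤ q`. -/
def past {Ω : Type*} [MeasurableSpace Ω] (P : Measure Ω) {n : ℕ} (X : ℤ → Fin n → Ω → ℂ)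
    (q : ℤ) : Submodule ℂ (Lp ℂ 2 P) :=
  (Submodule.span ℂ {g : Lp ℂ 2 P | ∃ m ≤ q, ∃ i, g =ᵐ[P] X m i}).topologicalClosure

/-- The canonical moving average representation `X(m) = ∑_{k ≥ 0} φ(k) ε(m-k)` with innovations
`ε`. -/
structure IsCanonicalMA {Ω : Type*} [MeasurableSpace Ω] (P : Measure Ω) {T q : ℕ}
    (X : ℤ → Fin T → Ω → ℂ) (φ : ℕ → Matrix (Fin T) (Fin q) ℂ) (ε : ℤ → Fin q → Ω → ℂ) :
    Prop where
  memLp : ∀ u k, MemLp (ε u k) 2 P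
  orthonormal : ∀ u v k j,
    ∫ ω, ε u k ω * star (ε v j ω) ∂P = if k = j ∧ u = v then 1 else 0
  past_eq : ∀ t, past P X t = past P ε t
  summable : Summable fun k => ∑ i, ∑ j, ‖φ k i j‖ ^ 2
  representation : ∀ m p,
    Tendsto (fun n => eLpNorm (fun ω =>
      ∑ k ∈ Finset.range n, (φ k).mulVec (fun j => ε (m - (k : ℤ)) j ω) p - X m p ω) 2 P)
      atTop (𝓝 0)

/-- The canonical factorization `|χ_μ|²/|β|² f = Φ_μ Φ_μ*`, where
`Φ_μ(e^{-iθ}) = ∑_{k ≥ 0} φ(k) e^{-ikθ}` and `φ(k)` are the coefficients of the canonical moving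
average representation of the increments. -/
structure IsCanonicalFactorization {Ω : Type*} [MeasurableSpace Ω] (P : Measure Ω) {r T q : ℕ}
    (s d μ : Fin r → ℕ) (ξ : ℤ → Fin T → Ω → ℂ) (f : ℝ → Matrix (Fin T) (Fin T) ℂ)
    (φ : ℕ → Matrix (Fin T) (Fin q) ℂ) (Φ : ℝ → Matrix (Fin T) (Fin q) ℂ) : Prop where
  movingAverage : ∃ ε : ℤ → Fin q → Ω → ℂ,
    IsCanonicalMA P (vecIncrement s d (zstep μ) ξ) φ ε
  series : ∀ i j, HasFourierSeries (fun θ => Φ θ i j)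
    (fun n => if n ≤ 0 then φ (-n).toNat i j else 0)
  factorization : ∀ᵐ θ ∂circ,
    ((‖chi s d (zstep μ) θ‖ ^ 2 / ‖beta s d θ‖ ^ 2 : ℝ) : ℂ) • f θ =
      Φ θ * (Φ θ).conjTranspose

/-- `(D̃_N A_N φ)_k = ∑_{m=0}^N ∑_{l=k}^N φ(m)ᵀ a(m+l) d_μ(l-k)`. -/
def rCoeff {r q : ℕ} (T : ℕ) (s d μ : Fin r → ℕ) (a : ℕ → ℂ) (M : ℕ)
    (φ : ℕ → Matrix (Fin T) (Fin q) ℂ) (k : ℕ) (j : Fin q) : ℂ :=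
  ∑ m ∈ Finset.range (M / T + 1), ∑ l ∈ Finset.Icc k (M / T),
    (φ m).transpose.mulVec (vecCoeff T a M (m + l)) j * dCoeff s d μ (l - k)

/-- `r_N(e^{iθ}) = ∑_{k=0}^N (D̃_N A_N φ)_k e^{ikθ}`. -/
def rFun {r q : ℕ} (T : ℕ) (s d μ : Fin r → ℕ) (a : ℕ → ℂ) (M : ℕ)
    (φ : ℕ → Matrix (Fin T) (Fin q) ℂ) (θ : ℝ) (j : Fin q) : ℂ :=
  ∑ k ∈ Finset.range (M / T + 1), rCoeff T s d μ a M φ k j * ex (k : ℤ) θ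

/-- `χ_μ(e^{-iθ})/β(iθ) (B_N(e^{iθ}) - Ψ(e^{-iθ})ᵀ r_N(e^{iθ}))`. -/
def hSimple {r q : ℕ} (T : ℕ) (s d μ : Fin r → ℕ) (a : ℕ → ℂ) (M : ℕ)
    (φ : ℕ → Matrix (Fin T) (Fin q) ℂ) (Ψ : ℝ → Matrix (Fin q) (Fin T) ℂ) (θ : ℝ)
    (p : Fin T) : ℂ :=
  chi s d (zstep μ) θ / beta s d θ *
    (BFun T s d μ a M θ p - (Ψ θ).transpose.mulVec (rFun T s d μ a M φ θ) p)

end GMForecast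

end

/-!
The increments of a sequence with spectral density `f` form a stationary sequence, and an isometry
turns the forecasting problem into a projection problem in `L₂(f)`. The spectral domain is realized
without weights: a measurable factor `A` with `AᴴA = fᵀ` (`exists_isDensityFactor`) represents a
function `g` of `L₂(f)` by `A g` in the space `VecL2` of square integrable vector functions, and the
increments with step `μ` by `e^{ikθ} A_w δ_p`, where `w = χ_μ/β` and `A_w = w A`. The minimality
condition says that both `A_w` and `A_w⁻¹` are square integrable (`IsMinimalFactor`). The map
`U : VecL2 → L₂(P)` of `exists_spectral_isometry` is an isometry up to the factor `1/2π`; the images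
of indicators under `U` form a spectral process, and `U` is the stochastic integral with respect to
every spectral process (`IsSpectralProcess.eq_isometry`, `hasSpectralIntegral_iff`).

*Reduction to a projection.* Since `∑ d_μ(k) x^k` and `∑ e_γ(k) x^k` are inverse power series,
`A_M ζ = B_N χξ - V_N ξ` (`sum_eq_sum_bCoeff_sub`). The increment operator is triangular with unit
diagonal, so the coefficients of the increments at nonnegative times in `A_M ζ` minus an elementary
estimate are forced (`isElementaryEstimate_iff`). Hence the errors of linear estimates fill the
affine space `B_N χξ + 𝓜`, `𝓜` the closed span of the past increments, and an estimate is optimal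
exactly if its error is `U R`, where `R` is the residual of the projection of the trigonometric
polynomial `A_w B_N` onto the spectral past (`isOptimalEstimate_iff`).

*The Toeplitz equation.* Orthogonality of `R` to the past means that `C = A_wᴴ R` has no
coefficients at negative frequencies; and `A_w⁻¹ R` has at nonnegative frequencies the
coefficients of `B_N`. As `C = (A_wᴴ A_w) A_w⁻¹ R`, this is the equation `F c = D_N a_N`. That `C` is
square integrable, not only integrable, comes from the boundedness of `R`: `R` is a finite sum of
elements of wandering subspaces, and those have constant norm (`norm_const_of_wandering`).

*Uniqueness.* If `C` solves the homogeneous equation, then `K = (A_wᴴ A_w)⁻¹ C` is integrable and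
has only negative frequencies, and for each residual `R` the pairing `∫ (A_wᴴR)^* K` vanishes, while
for suitable `R` it equals a Fourier coefficient of `C`. The pairing of an `L₂` function with nonnegative
frequencies and an `L₁` function with negative frequencies vanishes as soon as the product is
integrable, a vector form of Smirnov's theorem (`integral_dotProduct_eq_zero_of_coeff`); it is
reduced to `L₂` by multiplying `K` with functions that tend to `1`, have nonpositive frequencies and
decay where `K` is large; they come from residuals of the scalar prediction problem for the weight
`1 + κ`, with `κ` a multiple of `‖K‖` (`exists_damping`).

*Canonical factorization.* The innovations at time `0` are orthogonal to the past and lie in the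
span of the past and `T` further vectors, so there are at most `T` of them, and by the
factorization of the invertible density at least `T`. Therefore `Φ` is square and invertible, the
error is `U R = ∑_{k ≤ N} r(k)ᵀ ε(k)` (`map_optResidual`), and comparison of Fourier coefficients
gives `Cᵀ = rᵀ Φ^*` (`ae_symbol_eq_factor`).
-/

noncomputable section

namespace GMForecast

/-! ### Fourier coefficients of integrable functions -/

theorem circ_ae_Ioo : ∀ᵐ θ ∂circ, θ ∈ Set.Ioo (-Real.pi) Real.pi := by
  have h : circ = volume.restrict (Set.Ioo (-Real.pi) Real.pi) :=
    Measure.restrict_congr_set Ioo_ae_eq_Ico.symm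
  rw [h]
  exact ae_restrict_mem measurableSet_Ioo

theorem circ_ne_zero : circ ≠ 0 := by
  rw [circ, Ne, Measure.restrict_eq_zero, Real.volume_Ico, ENNReal.ofReal_eq_zero, not_le]
  linarith [Real.pi_pos]

theorem two_pi_ne_zero : (2 * (Real.pi : ℂ)) ≠ 0 := by simp [Real.pi_ne_zero]

theorem star_ex (n : ℤ) (θ : ℝ) : star (ex n θ) = ex (-n) θ := by
  simp only [ex, Complex.star_def, ← Complex.exp_conj, map_mul, Complex.conj_I, Complex.conj_ofReal,
    map_intCast]
  push_cast
  ring_nf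

theorem ex_zero (θ : ℝ) : ex 0 θ = 1 := by simp [ex]

theorem ex_neg (n : ℤ) (θ : ℝ) : ex n (-θ) = ex (-n) θ := by
  simp [ex]

theorem integrable_ex_mul {h : ℝ → ℂ} (hh : Integrable h circ) (n : ℤ) :
    Integrable (fun θ => ex n θ * h θ) circ :=
  hh.bdd_mul (continuous_ex n).aestronglyMeasurable
    (Eventually.of_forall fun θ => (norm_ex n θ).le)

theorem memLp_ex_mul {h : ℝ → ℂ} (hh : MemLp h 2 circ) (n : ℤ) :
    MemLp (fun θ => ex n θ * h θ) 2 circ :=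
  hh.of_le ((continuous_ex n).aestronglyMeasurable.mul hh.1)
    (Eventually.of_forall fun θ => by rw [norm_mul, norm_ex, one_mul])

theorem integral_const_circ (x : ℝ) : ∫ _ : ℝ, x ∂circ = 2 * Real.pi * x := by
  rw [integral_const, measureReal_def, Measure.restrict_apply_univ, Real.volume_Ico,
    ENNReal.toReal_ofReal (by linarith [Real.pi_pos]), smul_eq_mul]
  ring

theorem integrable_star_mul {α : Type*} [MeasurableSpace α] {ν : Measure α} {f g : α → ℂ}
    (hf : MemLp f 2 ν) (hg : MemLp g 2 ν) : Integrable (fun x => star (f x) * g x) ν :=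
  hf.star.integrable_mul hg

/-- An integrable function is determined by its Fourier coefficients. -/
theorem ae_eq_zero_of_integral_ex_eq_zero {h : ℝ → ℂ} (hh : Integrable h circ)
    (h0 : ∀ n : ℤ, ∫ θ, ex n θ * h θ ∂circ = 0) : ∀ᵐ θ ∂circ, h θ = 0 := by
  have hT : Fact (0 < 2 * Real.pi) := ⟨by positivity⟩
  -- by uniform approximation, `h` annihilates the continuous functions on the circle
  have key : ∀ G : C(AddCircle (2 * Real.pi), ℂ), ∫ θ, G (θ : ℝ) * h θ ∂circ = 0 := by
    have hint : ∀ G : C(AddCircle (2 * Real.pi), ℂ),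
        Integrable (fun θ : ℝ => G (θ : ℝ) * h θ) circ := fun G =>
      hh.bdd_mul (c := ‖G‖) (G.continuous.comp (AddCircle.continuous_mk' _)).aestronglyMeasurable
        (Eventually.of_forall fun θ => G.norm_coe_le_norm _)
    let Λ : C(AddCircle (2 * Real.pi), ℂ) →ₗ[ℂ] ℂ :=
      { toFun := fun G => ∫ θ, G (θ : ℝ) * h θ ∂circ
        map_add' := fun G G' => by
          simp only [ContinuousMap.add_apply, add_mul]
          exact integral_add (hint G) (hint G')
        map_smul' := fun c G => by
          simp only [ContinuousMap.smul_apply, smul_eq_mul, mul_assoc, RingHom.id_apply]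
          exact integral_const_mul _ _ }
    let Λ' : C(AddCircle (2 * Real.pi), ℂ) →L[ℂ] ℂ :=
      Λ.mkContinuous (∫ θ, ‖h θ‖ ∂circ) fun G => by
        refine (norm_integral_le_integral_norm _).trans ?_
        rw [mul_comm _ ‖G‖, ← integral_const_mul]
        refine integral_mono_of_nonneg (Eventually.of_forall fun θ => norm_nonneg _)
          (hh.norm.const_mul _) (Eventually.of_forall fun θ => ?_)
        simp only [norm_mul]
        gcongr
        exact G.norm_coe_le_norm _
    have hle : (Submodule.span ℂ (Set.range (@fourier (2 * Real.pi)))).topologicalClosure ≤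
        LinearMap.ker (Λ' : C(AddCircle (2 * Real.pi), ℂ) →ₗ[ℂ] ℂ) := by
      refine Submodule.topologicalClosure_minimal _ ?_ (ContinuousLinearMap.isClosed_ker Λ')
      rw [Submodule.span_le]
      rintro _ ⟨n, rfl⟩
      change ∫ θ, fourier n (θ : AddCircle (2 * Real.pi)) * h θ ∂circ = 0
      rw [← h0 n]
      refine integral_congr_ae (Eventually.of_forall fun θ => ?_)
      simp only [fourier_coe_apply, ex]
      congr 2
      have := two_pi_ne_zero
      push_cast
      field_simp
    rw [span_fourier_closure_eq_top] at hle
    intro G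
    exact hle (Submodule.mem_top : G ∈ ⊤)
  -- test functions supported in the open interval extend continuously to the circle
  have h1 : ∀ᵐ θ ∂circ, θ ∈ Set.Ioo (-Real.pi) Real.pi → h θ = 0 := by
    refine IsOpen.ae_eq_zero_of_integral_contDiff_smul_eq_zero isOpen_Ioo
      (hh.integrableOn.locallyIntegrableOn) fun g hg hc hsupp => ?_
    have hend : ∀ x, x ∉ Set.Ioo (-Real.pi) Real.pi → g x = 0 := fun x hx =>
      image_eq_zero_of_notMem_tsupport fun h' => hx (hsupp h')
    have hcont : Continuous (AddCircle.liftIco (2 * Real.pi) (-Real.pi) fun x => (g x : ℂ)) := by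
      refine AddCircle.liftIco_continuous ?_
        (Complex.continuous_ofReal.comp hg.continuous).continuousOn
      rw [hend _ (by simp), hend _ (by rw [Set.mem_Ioo]; intro hx; linarith [hx.2])]
    rw [← key ⟨_, hcont⟩]
    refine setIntegral_congr_fun measurableSet_Ico fun θ hθ => ?_
    have hθ' : θ ∈ Set.Ico (-Real.pi) (-Real.pi + 2 * Real.pi) := by
      convert hθ using 2
      ring
    simp only [ContinuousMap.coe_mk, AddCircle.liftIco_coe_apply hθ', Complex.real_smul]
  filter_upwards [h1, circ_ae_Ioo] with θ h2 h3 using h2 h3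

/-- The pairing of a square integrable function with frequencies `≥ 0` and one with frequencies
`≤ -1` vanishes. -/
theorem integral_star_mul_eq_zero_of_coeff {E F : ℝ → ℂ} (hE : MemLp E 2 circ) (hF : MemLp F 2 circ)
    (hE0 : ∀ n : ℤ, n < 0 → ∫ θ, ex (-n) θ * E θ ∂circ = 0)
    (hF0 : ∀ n : ℤ, 0 ≤ n → ∫ θ, ex (-n) θ * F θ ∂circ = 0) :
    ∫ θ, star (E θ) * F θ ∂circ = 0 := by
  let e : ℤ → Lp ℂ 2 circ := fun n => (memLp_ex n).toLp
  have he : ∀ n (G : Lp ℂ 2 circ), inner ℂ (e n) G = ∫ θ, ex (-n) θ * G θ ∂circ := by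
    intro n G
    rw [L2.inner_def]
    refine integral_congr_ae ?_
    filter_upwards [(memLp_ex n).coeFn_toLp] with θ h
    simp only [e, h, RCLike.inner_apply, ← star_ex]
    exact mul_comm _ _
  have heG : ∀ n {G : ℝ → ℂ} (hG : MemLp G 2 circ),
      inner ℂ (e n) hG.toLp = ∫ θ, ex (-n) θ * G θ ∂circ := by
    intro n G hG
    rw [he]
    refine integral_congr_ae ?_
    filter_upwards [hG.coeFn_toLp] with θ h
    rw [h]
  let K : Submodule ℂ (Lp ℂ 2 circ) := (Submodule.span ℂ (e '' {n | 0 ≤ n})).topologicalClosure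
  have hmemK : ∀ n, 0 ≤ n → e n ∈ K := fun n hn =>
    Submodule.le_topologicalClosure _ (Submodule.subset_span ⟨n, hn, rfl⟩)
  have : CompleteSpace K := (Submodule.isClosed_topologicalClosure _).completeSpace_coe
  -- anything orthogonal to the generators is orthogonal to `K`
  have horth : ∀ G : Lp ℂ 2 circ, (∀ n, 0 ≤ n → inner ℂ (e n) G = 0) → G ∈ Kᗮ := by
    intro G hG
    rw [Submodule.orthogonal_closure, Submodule.mem_orthogonal]
    intro u hu
    induction hu using Submodule.span_induction with
    | mem x h => obtain ⟨n, hn, rfl⟩ := h; exact hG n hn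
    | zero => simp
    | add x y _ _ hx hy => rw [inner_add_left, hx, hy, add_zero]
    | smul a x _ hx => rw [inner_smul_left, hx, mul_zero]
  have hee : ∀ m n : ℤ, m ≠ n → inner ℂ (e m) (e n) = 0 := by
    intro m n hmn
    rw [heG]
    simp only [ex_add, integral_ex]
    rw [if_neg (by omega)]
  -- `E` minus its projection to `K` has no Fourier coefficients at all
  have hEK : hE.toLp ∈ K := by
    set D := hE.toLp - K.starProjection hE.toLp with hD
    have hDK : D ∈ Kᗮ := Submodule.sub_starProjection_mem_orthogonal _
    have hD0 : ∀ n, inner ℂ (e n) D = 0 := by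
      intro n
      by_cases hn : 0 ≤ n
      · exact (Submodule.mem_orthogonal _ _).1 hDK _ (hmemK n hn)
      · push Not at hn
        have h1 : e n ∈ Kᗮ := horth _ fun m hm => hee m n (by omega)
        have h2 : inner ℂ (e n) (K.starProjection hE.toLp) = 0 :=
          (Submodule.mem_orthogonal' _ _).1 h1 _ (Submodule.starProjection_apply_mem _ _)
        rw [hD, inner_sub_right, h2, heG, hE0 n hn, sub_zero]
    have hDz : D = 0 := by
      rw [Lp.eq_zero_iff_ae_eq_zero]
      refine ae_eq_zero_of_integral_ex_eq_zero ((Lp.memLp D).integrable (by norm_num)) fun n => ?_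
      have := hD0 (-n)
      rwa [he, neg_neg] at this
    rw [sub_eq_zero.1 (hD.symm.trans hDz)]
    exact Submodule.starProjection_apply_mem _ _
  have hFK : hF.toLp ∈ Kᗮ := horth _ fun n hn => by rw [heG, hF0 n hn]
  have h := (Submodule.mem_orthogonal _ _).1 hFK _ hEK
  rw [L2.inner_def] at h
  rw [← h]
  refine integral_congr_ae ?_
  filter_upwards [hE.coeFn_toLp, hF.coeFn_toLp] with θ h1 h2
  rw [h1, h2, RCLike.inner_apply]
  exact mul_comm _ _

/-! ### Vector functions with a minimal matrix weight -/

/-- Square integrable vector functions on `[-π, π)`. -/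
abbrev VecL2 (T : ℕ) : Type := Lp (EuclideanSpace ℂ (Fin T)) 2 circ

/-- The element of `VecL2` given by a function with square integrable components. -/
def toVec {T : ℕ} (v : ℝ → Fin T → ℂ) (h : ∀ i, MemLp (fun θ => v θ i) 2 circ) : VecL2 T :=
  (MemLp.of_eval_piLp (f := fun θ => (WithLp.toLp 2 (v θ) : EuclideanSpace ℂ (Fin T))) h).toLp

section
variable {T : ℕ}

theorem coeFn_toVec (v : ℝ → Fin T → ℂ) (h : ∀ i, MemLp (fun θ => v θ i) 2 circ) :
    ∀ᵐ θ ∂circ, (toVec v h θ).ofLp = v θ := by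
  filter_upwards [(MemLp.of_eval_piLp
    (f := fun θ => (WithLp.toLp 2 (v θ) : EuclideanSpace ℂ (Fin T))) h).coeFn_toLp] with θ h1
  rw [toVec, h1]

theorem memLp_apply (V : VecL2 T) (i : Fin T) : MemLp (fun θ => (V θ).ofLp i) 2 circ :=
  memLp_piLp_iff.1 (Lp.memLp V) i

theorem ae_eq_of_ofLp {V W : VecL2 T} (h : ∀ᵐ θ ∂circ, (V θ).ofLp = (W θ).ofLp) : V = W := by
  refine Lp.ext ?_
  filter_upwards [h] with θ h1
  exact WithLp.ofLp_injective 2 h1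

theorem inner_eq_integral (V W : VecL2 T) :
    inner ℂ V W = ∫ θ, star (V θ).ofLp ⬝ᵥ (W θ).ofLp ∂circ := by
  rw [L2.inner_def]
  refine integral_congr_ae (Eventually.of_forall fun θ => ?_)
  simp only [PiLp.inner_apply, RCLike.inner_apply, dotProduct, Pi.star_apply]
  exact Finset.sum_congr rfl fun i _ => mul_comm _ _

theorem integrable_inner_ofLp (V W : VecL2 T) :
    Integrable (fun θ => star (V θ).ofLp ⬝ᵥ (W θ).ofLp) circ := by
  refine (L2.integrable_inner (𝕜 := ℂ) V W).congr (Eventually.of_forall fun θ => ?_)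
  simp only [PiLp.inner_apply, RCLike.inner_apply, dotProduct, Pi.star_apply]
  exact Finset.sum_congr rfl fun i _ => mul_comm _ _

theorem inner_toVec (v : ℝ → Fin T → ℂ) (h : ∀ i, MemLp (fun θ => v θ i) 2 circ) (V : VecL2 T) :
    inner ℂ (toVec v h) V = ∫ θ, star (v θ) ⬝ᵥ (V θ).ofLp ∂circ := by
  rw [inner_eq_integral]
  refine integral_congr_ae ?_
  filter_upwards [coeFn_toVec v h] with θ h1
  rw [h1]

theorem star_dotProduct_self (v : Fin T → ℂ) : star v ⬝ᵥ v = ((∑ i, ‖v i‖ ^ 2 : ℝ) : ℂ) := by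
  simp only [dotProduct, Pi.star_apply, Complex.ofReal_sum]
  refine Finset.sum_congr rfl fun i _ => ?_
  rw [Complex.star_def, mul_comm, Complex.mul_conj, Complex.normSq_eq_norm_sq]

/-- `A` is a square root of a minimal density `AᴴA`: both `A` and `A⁻¹` are square integrable.
The function `g` of the weighted space `L₂(AᴴA)` is represented by `A g` in `VecL2`. -/
structure IsMinimalFactor (A : ℝ → Matrix (Fin T) (Fin T) ℂ) : Prop where
  memLp : ∀ i j, MemLp (fun θ => A θ i j) 2 circ
  memLp_inv : ∀ i j, MemLp (fun θ => (A θ)⁻¹ i j) 2 circ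
  isUnit : ∀ᵐ θ ∂circ, IsUnit (A θ)

variable {A : ℝ → Matrix (Fin T) (Fin T) ℂ}

/-- The representative `A e^{ikθ} δ_l` of the trigonometric monomial `e^{ikθ} δ_l`. -/
def gen (hA : IsMinimalFactor A) (k : ℤ) (l : Fin T) : VecL2 T :=
  toVec (fun θ i => ex k θ * A θ i l) fun i => memLp_ex_mul (hA.memLp i l) k

/-- The vector representing the Fourier coefficient functional `V ↦ ∫ e^{-ijθ} (A⁻¹V)_p`. -/
def dualGen (hA : IsMinimalFactor A) (j : ℤ) (p : Fin T) : VecL2 T :=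
  toVec (fun θ i => ex j θ * star ((A θ)⁻¹ p i)) fun i => memLp_ex_mul (hA.memLp_inv p i).star j

/-- The closed span of `e^{ikθ} δ_l`, `k ≤ n`, in the weighted space. -/
def specPast (hA : IsMinimalFactor A) (n : ℤ) : Submodule ℂ (VecL2 T) :=
  (Submodule.span ℂ {V | ∃ k ≤ n, ∃ l, V = gen hA k l}).topologicalClosure

instance (hA : IsMinimalFactor A) (n : ℤ) : CompleteSpace (specPast hA n) :=
  (Submodule.isClosed_topologicalClosure _).completeSpace_coe

theorem inner_gen (hA : IsMinimalFactor A) (k : ℤ) (l : Fin T) (V : VecL2 T) :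
    inner ℂ (gen hA k l) V = ∫ θ, ex (-k) θ * ((A θ).conjTranspose.mulVec (V θ).ofLp) l ∂circ := by
  rw [gen, inner_toVec]
  refine integral_congr_ae (Eventually.of_forall fun θ => ?_)
  simp only [dotProduct, Matrix.mulVec, Matrix.conjTranspose_apply, Pi.star_apply, star_mul',
    star_ex, Finset.mul_sum, mul_assoc]

theorem inner_dualGen (hA : IsMinimalFactor A) (j : ℤ) (p : Fin T) (V : VecL2 T) :
    inner ℂ (dualGen hA j p) V = ∫ θ, ex (-j) θ * ((A θ)⁻¹.mulVec (V θ).ofLp) p ∂circ := by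
  rw [dualGen, inner_toVec]
  refine integral_congr_ae (Eventually.of_forall fun θ => ?_)
  simp only [dotProduct, Matrix.mulVec, Pi.star_apply, star_mul', star_star,
    star_ex, Finset.mul_sum, mul_assoc]

/-- The two families are biorthogonal. Pairing with `dualGen` is continuous, and this is how Fourier
coefficients pass to limits of trigonometric polynomials. -/
theorem inner_dualGen_gen (hA : IsMinimalFactor A) (j k : ℤ) (p l : Fin T) :
    inner ℂ (dualGen hA j p) (gen hA k l) = if k = j ∧ l = p then 2 * (Real.pi : ℂ) else 0 := by
  have h : ∀ᵐ θ ∂circ, ex (-j) θ * ((A θ)⁻¹.mulVec ((gen hA k l) θ).ofLp) p =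
      (if l = p then 1 else 0) * ex (k - j) θ := by
    filter_upwards [coeFn_toVec _ (fun i => memLp_ex_mul (hA.memLp i l) k), hA.isUnit] with θ h1 h2
    rw [gen, h1]
    have h3 : (A θ)⁻¹ * A θ = 1 :=
      Matrix.nonsing_inv_mul _ ((Matrix.isUnit_iff_isUnit_det _).1 h2)
    have h4 := congrFun (congrFun h3 p) l
    rw [Matrix.mul_apply, Matrix.one_apply] at h4
    have h5 : ((A θ)⁻¹.mulVec fun i => ex k θ * A θ i l) p = ex k θ * if p = l then 1 else 0 := by
      rw [← h4, Finset.mul_sum]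
      change ∑ i, (A θ)⁻¹ p i * (ex k θ * A θ i l) = _
      exact Finset.sum_congr rfl fun i _ => by ring
    rw [h5, ← mul_assoc, ex_add, mul_comm, show -j + k = k - j by ring]
    simp only [eq_comm]
  rw [inner_dualGen, integral_congr_ae h, integral_const_mul, integral_ex]
  by_cases h1 : l = p <;> by_cases h2 : k = j <;> simp [h1, h2, sub_eq_zero]

theorem integrable_conjTranspose_mulVec (hA : IsMinimalFactor A) (V : VecL2 T) (l : Fin T) :
    Integrable (fun θ => ((A θ).conjTranspose.mulVec (V θ).ofLp) l) circ := by
  simp only [Matrix.mulVec, dotProduct, Matrix.conjTranspose_apply]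
  exact integrable_finsetSum _ fun i _ => (hA.memLp i l).star.integrable_mul (memLp_apply V i)

theorem integrable_inv_mulVec (hA : IsMinimalFactor A) (V : VecL2 T) (l : Fin T) :
    Integrable (fun θ => ((A θ)⁻¹.mulVec (V θ).ofLp) l) circ := by
  simp only [Matrix.mulVec, dotProduct]
  exact integrable_finsetSum _ fun i _ => (hA.memLp_inv l i).integrable_mul (memLp_apply V i)

theorem gen_mem_specPast (hA : IsMinimalFactor A) {k n : ℤ} (h : k ≤ n) (l : Fin T) :
    gen hA k l ∈ specPast hA n :=
  Submodule.le_topologicalClosure _ (Submodule.subset_span ⟨k, h, l, rfl⟩)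

theorem specPast_mono (hA : IsMinimalFactor A) {m n : ℤ} (h : m ≤ n) :
    specPast hA m ≤ specPast hA n := by
  refine Submodule.topologicalClosure_mono (Submodule.span_mono ?_)
  rintro _ ⟨k, hk, l, rfl⟩
  exact ⟨k, hk.trans h, l, rfl⟩

theorem mem_orthogonal_specPast (hA : IsMinimalFactor A) {n : ℤ} {Q : VecL2 T} :
    Q ∈ (specPast hA n)ᗮ ↔ ∀ k ≤ n, ∀ l, inner ℂ (gen hA k l) Q = 0 := by
  refine ⟨fun h k hk l => (Submodule.mem_orthogonal _ _).1 h _ (gen_mem_specPast hA hk l),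
    fun h => ?_⟩
  rw [specPast, Submodule.orthogonal_closure, Submodule.mem_orthogonal]
  intro u hu
  induction hu using Submodule.span_induction with
  | mem x hx => obtain ⟨k, hk, l, rfl⟩ := hx; exact h k hk l
  | zero => simp
  | add x y _ _ hx hy => rw [inner_add_left, hx, hy, add_zero]
  | smul a x _ hx => rw [inner_smul_left, hx, mul_zero]

/-- The trigonometric monomials span a dense subspace of the weighted space. -/
theorem eq_zero_of_inner_gen (hA : IsMinimalFactor A) {V : VecL2 T}
    (h : ∀ k l, inner ℂ (gen hA k l) V = 0) : V = 0 := by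
  have h1 : ∀ l, ∀ᵐ θ ∂circ, ((A θ).conjTranspose.mulVec (V θ).ofLp) l = 0 := fun l =>
    ae_eq_zero_of_integral_ex_eq_zero (integrable_conjTranspose_mulVec hA V l) fun n => by
      rw [← h (-n) l, inner_gen, neg_neg]
  refine ae_eq_of_ofLp ?_
  filter_upwards [ae_all_iff.2 h1, hA.isUnit, Lp.coeFn_zero (EuclideanSpace ℂ (Fin T)) 2 circ]
    with θ h2 h3 h4
  rw [h4]
  have h5 : IsUnit (A θ).conjTranspose.det := by
    rw [Matrix.det_conjTranspose]
    exact ((Matrix.isUnit_iff_isUnit_det _).1 h3).star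
  exact Matrix.eq_zero_of_mulVec_eq_zero h5.ne_zero (funext h2)

/-- Multiplication by `e^{inθ}`. -/
def mulEx (n : ℤ) (V : VecL2 T) : VecL2 T :=
  toVec (fun θ i => ex n θ * (V θ).ofLp i) fun i => memLp_ex_mul (memLp_apply V i) n

theorem inner_mulEx (n : ℤ) (V W : VecL2 T) :
    inner ℂ V (mulEx n W) = ∫ θ, ex n θ * (star (V θ).ofLp ⬝ᵥ (W θ).ofLp) ∂circ := by
  rw [inner_eq_integral]
  refine integral_congr_ae ?_
  filter_upwards [coeFn_toVec _ (fun i => memLp_ex_mul (memLp_apply W i) n)] with θ h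
  rw [mulEx, h]
  simp only [dotProduct, Finset.mul_sum]
  exact Finset.sum_congr rfl fun i _ => by ring

theorem inner_gen_mulEx (hA : IsMinimalFactor A) (n k : ℤ) (l : Fin T) (V : VecL2 T) :
    inner ℂ (gen hA k l) (mulEx n V) = inner ℂ (gen hA (k - n) l) V := by
  rw [inner_mulEx, inner_gen]
  refine integral_congr_ae ?_
  filter_upwards [coeFn_toVec _ (fun i => memLp_ex_mul (hA.memLp i l) k)] with θ h
  rw [gen, h]
  have h1 : -(k - n) = n + -k := by ring
  simp only [dotProduct, Matrix.mulVec, Matrix.conjTranspose_apply, Pi.star_apply, star_mul',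
    star_ex, Finset.mul_sum, h1, ← ex_add]
  exact Finset.sum_congr rfl fun i _ => by ring

/-- An element of the wandering space `specPast k ⊖ specPast (k-1)` has constant norm: the
Fourier coefficients of its squared norm vanish, because its shifts are orthogonal to it. -/
theorem norm_const_of_wandering (hA : IsMinimalFactor A) {k : ℤ} {R : VecL2 T}
    (h1 : R ∈ specPast hA k) (h2 : R ∈ (specPast hA (k - 1))ᗮ) :
    ∀ᵐ θ ∂circ, ‖R θ‖ ^ 2 = 1 / (2 * Real.pi) * ‖R‖ ^ 2 := by
  have hpos : ∀ n : ℤ, 0 < n → inner ℂ R (mulEx n R) = 0 := by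
    intro n hn
    refine (Submodule.mem_orthogonal _ _).1 ((mem_orthogonal_specPast hA).2 fun m hm l => ?_) _ h1
    rw [inner_gen_mulEx]
    exact (mem_orthogonal_specPast hA).1 h2 _ (by omega) l
  have hq : ∀ θ, star (R θ).ofLp ⬝ᵥ (R θ).ofLp = ((‖R θ‖ ^ 2 : ℝ) : ℂ) := fun θ => by
    rw [star_dotProduct_self, EuclideanSpace.norm_sq_eq]
  have hint : Integrable (fun θ => ((‖R θ‖ ^ 2 : ℝ) : ℂ)) circ := by
    simpa only [hq] using integrable_inner_ofLp R R
  have hcoef : ∀ n : ℤ, 0 < n → ∫ θ, ex n θ * ((‖R θ‖ ^ 2 : ℝ) : ℂ) ∂circ = 0 := by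
    intro n hn
    rw [← hpos n hn, inner_mulEx]
    simp only [hq]
  have hzero : ∫ θ, ((‖R θ‖ ^ 2 : ℝ) : ℂ) ∂circ = ((‖R‖ ^ 2 : ℝ) : ℂ) := by
    have h3 := inner_self_eq_norm_sq_to_K (𝕜 := ℂ) R
    rw [inner_eq_integral] at h3
    simp only [hq] at h3
    rw [h3]
    push_cast
    rfl
  have h0 := ae_eq_zero_of_integral_ex_eq_zero
    (hint.sub (integrable_const ((1 / (2 * Real.pi) * ‖R‖ ^ 2 : ℝ) : ℂ))) fun n => by
      simp only [Pi.sub_apply, mul_sub]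
      rw [integral_sub (integrable_ex_mul hint n) (integrable_ex_mul (integrable_const _) n),
        integral_mul_const, integral_ex]
      rcases lt_trichotomy n 0 with hn | hn | hn
      · rw [if_neg (by omega), zero_mul, sub_zero, ← star_star (∫ θ, _ ∂circ), Complex.star_def,
          ← integral_conj]
        simp only [map_mul, Complex.conj_ofReal, ← Complex.star_def, star_ex]
        rw [hcoef _ (by omega), star_zero]
      · subst hn
        simp only [ex_zero, one_mul, if_true]
        rw [hzero]
        have := Real.pi_ne_zero
        push_cast
        have := two_pi_ne_zero
        field_simp
        ring
      · rw [if_neg (by omega), zero_mul, sub_zero, hcoef n hn]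
  filter_upwards [h0] with θ h3
  rw [Pi.sub_apply, sub_eq_zero] at h3
  exact_mod_cast h3

/-- A residual with finitely many innovations is bounded. -/
theorem bounded_of_mem_specPast (hA : IsMinimalFactor A) (n : ℕ) : ∀ R : VecL2 T,
    R ∈ specPast hA ((n : ℤ) - 1) → R ∈ (specPast hA (-1))ᗮ → ∃ c : ℝ, ∀ᵐ θ ∂circ, ‖R θ‖ ≤ c := by
  induction n with
  | zero =>
    intro R h1 h2
    have h3 : R = 0 := by
      have := (Submodule.mem_orthogonal _ _).1 h2 R (by simpa using h1)
      exact inner_self_eq_zero.1 this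
    refine ⟨0, ?_⟩
    filter_upwards [Lp.coeFn_zero (EuclideanSpace ℂ (Fin T)) 2 circ] with θ h4
    rw [h3, h4]
    simp
  | succ n ih =>
    intro R h1 h2
    -- split off the component in the wandering space at time `n`, which has constant norm
    set R' := (specPast hA ((n : ℤ) - 1)).starProjection R with hR'
    have hp : R' ∈ specPast hA ((n : ℤ) - 1) := Submodule.starProjection_apply_mem _ _
    have ho : R - R' ∈ (specPast hA ((n : ℤ) - 1))ᗮ := Submodule.sub_starProjection_mem_orthogonal _
    have ho' : R - R' ∈ (specPast hA (-1))ᗮ :=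
      Submodule.orthogonal_le (specPast_mono hA (by omega)) ho
    obtain ⟨c, hc⟩ := ih R' hp (by simpa using Submodule.sub_mem _ h2 ho')
    have hw := norm_const_of_wandering hA (k := n) (R := R - R')
      (Submodule.sub_mem _ (by simpa using h1) (specPast_mono hA (by omega) hp)) ho
    refine ⟨√(1 / (2 * Real.pi) * ‖R - R'‖ ^ 2) + c, ?_⟩
    filter_upwards [hc, hw, Lp.coeFn_sub R R'] with θ h3 h4 h5
    have h6 : ‖(R - R') θ‖ = √(1 / (2 * Real.pi) * ‖R - R'‖ ^ 2) := by
      rw [← h4, Real.sqrt_sq (norm_nonneg _)]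
    have h7 : R θ = (R - R') θ + R' θ := by rw [h5]; simp
    rw [h7]
    exact (norm_add_le _ _).trans (add_le_add h6.le h3)

/-- The representative of the trigonometric polynomial `∑_{k ≤ N} b(k) e^{ikθ}`. -/
def trigPoly (hA : IsMinimalFactor A) (N : ℕ) (b : ℕ → Fin T → ℂ) : VecL2 T :=
  ∑ k ∈ Finset.range (N + 1), ∑ p, b k p • gen hA (k : ℤ) p

/-- The residual of the projection of a trigonometric polynomial onto the past. -/
def residual (hA : IsMinimalFactor A) (N : ℕ) (b : ℕ → Fin T → ℂ) : VecL2 T :=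
  trigPoly hA N b - (specPast hA (-1)).starProjection (trigPoly hA N b)

theorem residual_mem_orthogonal (hA : IsMinimalFactor A) (N : ℕ) (b : ℕ → Fin T → ℂ) :
    residual hA N b ∈ (specPast hA (-1))ᗮ := Submodule.sub_starProjection_mem_orthogonal _

theorem trigPoly_mem_specPast (hA : IsMinimalFactor A) (N : ℕ) (b : ℕ → Fin T → ℂ) :
    trigPoly hA N b ∈ specPast hA N :=
  Submodule.sum_mem _ fun k hk => Submodule.sum_mem _ fun p _ => Submodule.smul_mem _ _
    (gen_mem_specPast hA (by have := Finset.mem_range.1 hk; omega) p)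

theorem residual_mem_specPast (hA : IsMinimalFactor A) (N : ℕ) (b : ℕ → Fin T → ℂ) :
    residual hA N b ∈ specPast hA N :=
  Submodule.sub_mem _ (trigPoly_mem_specPast hA N b)
    (specPast_mono hA (by omega) (Submodule.starProjection_apply_mem _ _))

theorem residual_bounded (hA : IsMinimalFactor A) (N : ℕ) (b : ℕ → Fin T → ℂ) :
    ∃ c : ℝ, ∀ᵐ θ ∂circ, ‖residual hA N b θ‖ ≤ c :=
  bounded_of_mem_specPast hA (N + 1) _ (by simpa using residual_mem_specPast hA N b)
    (residual_mem_orthogonal hA N b)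

theorem memLp_mul_apply_of_bounded {V : VecL2 T} {c : ℝ} (hc : ∀ᵐ θ ∂circ, ‖V θ‖ ≤ c)
    {g : ℝ → ℂ} (hg : MemLp g 2 circ) (i : Fin T) :
    MemLp (fun θ => g θ * (V θ).ofLp i) 2 circ := by
  refine (hg.const_mul (c : ℂ)).of_le (hg.1.mul (memLp_apply V i).1) ?_
  filter_upwards [hc] with θ h
  rw [norm_mul, norm_mul, mul_comm]
  gcongr
  rw [Complex.norm_real]
  exact ((PiLp.norm_apply_le _ i).trans h).trans (le_abs_self c)

/-- The function `AᴴR` of a residual `R` is square integrable although the density `AᴴA` is only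
integrable: `R` is bounded. -/
theorem memLp_conjTranspose_mulVec_residual (hA : IsMinimalFactor A) (N : ℕ) (b : ℕ → Fin T → ℂ)
    (l : Fin T) :
    MemLp (fun θ => ((A θ).conjTranspose.mulVec (residual hA N b θ).ofLp) l) 2 circ := by
  obtain ⟨c, hc⟩ := residual_bounded hA N b
  simp only [Matrix.mulVec, dotProduct, Matrix.conjTranspose_apply]
  exact memLp_finsetSum _ fun i _ => memLp_mul_apply_of_bounded hc (hA.memLp i l).star i

/-- As `R` is bounded and `A⁻¹` square integrable, `A⁻¹R` is square integrable. -/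
theorem memLp_inv_mulVec_residual (hA : IsMinimalFactor A) (N : ℕ) (b : ℕ → Fin T → ℂ)
    (l : Fin T) :
    MemLp (fun θ => ((A θ)⁻¹.mulVec (residual hA N b θ).ofLp) l) 2 circ := by
  obtain ⟨c, hc⟩ := residual_bounded hA N b
  simp only [Matrix.mulVec, dotProduct]
  exact memLp_finsetSum _ fun i _ => memLp_mul_apply_of_bounded hc (hA.memLp_inv l i) i

theorem integral_ex_conjTranspose_mulVec_residual (hA : IsMinimalFactor A) (N : ℕ)
    (b : ℕ → Fin T → ℂ) (l : Fin T) (k : ℤ) (hk : k < 0) :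
    ∫ θ, ex (-k) θ * ((A θ).conjTranspose.mulVec (residual hA N b θ).ofLp) l ∂circ = 0 := by
  rw [← inner_gen]
  exact (mem_orthogonal_specPast hA).1 (residual_mem_orthogonal hA N b) k (by omega) l

/-- Elements of the past have no frequencies above it. -/
theorem inner_dualGen_eq_zero (hA : IsMinimalFactor A) {n j : ℤ} (hj : n < j) (p : Fin T)
    {V : VecL2 T} (hV : V ∈ specPast hA n) : inner ℂ (dualGen hA j p) V = 0 := by
  refine (Submodule.mem_orthogonal' _ _).1 ((mem_orthogonal_specPast hA).2 fun k hk l => ?_) V hV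
  rw [← inner_conj_symm, inner_dualGen_gen, if_neg (by omega), map_zero]

/-- At nonnegative frequencies `A⁻¹R` has the coefficients of the polynomial: the projection, which
is the difference, has only negative frequencies. -/
theorem integral_ex_inv_mulVec_residual (hA : IsMinimalFactor A) (N : ℕ)
    (b : ℕ → Fin T → ℂ) (hb : ∀ k, N < k → b k = 0) (p : Fin T) (j : ℕ) :
    ∫ θ, ex (-(j : ℤ)) θ * ((A θ)⁻¹.mulVec (residual hA N b θ).ofLp) p ∂circ =
      2 * (Real.pi : ℂ) * b j p := by
  rw [← inner_dualGen hA, residual, inner_sub_right,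
    inner_dualGen_eq_zero hA (n := -1) (by omega) p (Submodule.starProjection_apply_mem _ _),
    sub_zero, trigPoly]
  simp only [inner_sum, inner_smul_right, inner_dualGen_gen, Nat.cast_inj, mul_ite, mul_zero,
    ite_and]
  have h1 : ∀ k : ℕ, (∑ l : Fin T, if k = j then if l = p then b k l * (2 * (Real.pi : ℂ)) else 0
      else 0) = if k = j then b k p * (2 * (Real.pi : ℂ)) else 0 := by
    intro k
    split_ifs with h <;> simp
  simp only [h1, Finset.sum_ite_eq', Finset.mem_range]
  split_ifs with h
  · ring
  · rw [hb j (by omega)]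
    simp

end

/-! ### Products of functions with opposite frequencies -/

/-- A bounded function `O` with frequencies `≤ 0` and mean `1` that is small where the given weight
`κ` is large: `A O` is the residual of `1` for the scalar density `A² = 1 + κ`. -/
theorem exists_damping {κ : ℝ → ℝ} (hκ : Integrable κ circ) (hκ0 : ∀ θ, 0 ≤ κ θ) :
    ∃ O : ℝ → ℂ, AEStronglyMeasurable O circ ∧
      (∀ᵐ θ ∂circ, ‖O θ‖ ^ 2 * (1 + κ θ) ≤ 1 + 1 / (2 * Real.pi) * ∫ θ, κ θ ∂circ) ∧
      (∫ θ, O θ ∂circ = 2 * (Real.pi : ℂ)) ∧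
      ∀ (K : ℝ → ℂ) (c : ℝ), Integrable K circ → (∀ θ, ‖K θ‖ ≤ c * κ θ) →
        (∀ n : ℤ, 0 ≤ n → ∫ θ, ex (-n) θ * K θ ∂circ = 0) →
        MemLp (fun θ => O θ * K θ) 2 circ ∧
          ∀ n : ℤ, 0 ≤ n → ∫ θ, ex (-n) θ * (O θ * K θ) ∂circ = 0 := by
  have hω : ∀ θ, 0 < 1 + κ θ := fun θ => by linarith [hκ0 θ]
  have hs0 : ∀ θ, (0 : ℝ) < √(1 + κ θ) := fun θ => Real.sqrt_pos.2 (hω θ)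
  have hs0' : ∀ θ, ((√(1 + κ θ) : ℝ) : ℂ) ≠ 0 := fun θ => by exact_mod_cast (hs0 θ).ne'
  have hs1 : ∀ θ, (1 : ℝ) ≤ √(1 + κ θ) := fun θ => Real.one_le_sqrt.2 (by linarith [hκ0 θ])
  have hωi : Integrable (fun θ => 1 + κ θ) circ := (integrable_const 1).add hκ
  have hsm : AEStronglyMeasurable (fun θ => ((√(1 + κ θ) : ℝ) : ℂ)) circ :=
    (Complex.continuous_ofReal.comp Real.continuous_sqrt).comp_aestronglyMeasurable hωi.1
  have hsm' : AEStronglyMeasurable (fun θ => (((√(1 + κ θ))⁻¹ : ℝ) : ℂ)) circ :=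
    (Complex.measurable_ofReal.comp_aemeasurable
      (Real.continuous_sqrt.measurable.comp_aemeasurable hωi.1.aemeasurable).inv).aestronglyMeasurable
  let A : ℝ → Matrix (Fin 1) (Fin 1) ℂ := fun θ => Matrix.of fun _ _ => ((√(1 + κ θ) : ℝ) : ℂ)
  have hAinv : ∀ θ i j, (A θ)⁻¹ i j = (((√(1 + κ θ))⁻¹ : ℝ) : ℂ) := by
    intro θ i j
    rw [Matrix.inv_subsingleton]
    simp [Subsingleton.elim i j, A]
  have hA : IsMinimalFactor A :=
    { memLp := fun i j => by
        refine (memLp_two_iff_integrable_sq_norm hsm).2 (hωi.congr (Eventually.of_forall fun θ => ?_))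
        beta_reduce
        change _ = ‖((√(1 + κ θ) : ℝ) : ℂ)‖ ^ 2
        rw [Complex.norm_real, Real.norm_of_nonneg (Real.sqrt_nonneg _), Real.sq_sqrt (hω θ).le]
      memLp_inv := fun i j => by
        simp only [hAinv]
        refine MemLp.of_bound hsm' 1 (Eventually.of_forall fun θ => ?_)
        rw [Complex.norm_real, Real.norm_of_nonneg (inv_nonneg.2 (Real.sqrt_nonneg _))]
        exact inv_le_one_of_one_le₀ (hs1 θ)
      isUnit := Eventually.of_forall fun θ => by
        rw [Matrix.isUnit_iff_isUnit_det, Matrix.det_fin_one]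
        exact (hs0' θ).isUnit }
  let b : ℕ → Fin 1 → ℂ := fun k _ => if k = 0 then 1 else 0
  set R := residual hA 0 b with hR
  have hRp : R ∈ specPast hA 0 := residual_mem_specPast hA 0 b
  have hconst := norm_const_of_wandering hA (k := 0) hRp (residual_mem_orthogonal hA 0 b)
  have hgen : trigPoly hA 0 b = gen hA 0 0 := by simp [trigPoly, b]
  have hRn : ‖R‖ ^ 2 ≤ 2 * Real.pi + ∫ θ, κ θ ∂circ := by
    have h1 : ‖R‖ ≤ ‖gen hA 0 0‖ := by
      have h2 := Submodule.norm_sq_eq_add_norm_sq_starProjection (gen hA 0 0) (specPast hA (-1))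
      rw [Submodule.starProjection_orthogonal', ← hgen] at h2
      have h3 : ‖R‖ ^ 2 ≤ ‖trigPoly hA 0 b‖ ^ 2 := by
        rw [h2, hR, residual]
        have : ∀ x, (1 - (specPast hA (-1)).starProjection) x =
          x - (specPast hA (-1)).starProjection x := fun x => rfl
        rw [this]
        nlinarith [sq_nonneg ‖(specPast hA (-1)).starProjection (trigPoly hA 0 b)‖]
      rw [← hgen]
      exact (sq_le_sq₀ (norm_nonneg _) (norm_nonneg _)).1 h3
    have h2 : ‖gen hA 0 0‖ ^ 2 = 2 * Real.pi + ∫ θ, κ θ ∂circ := by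
      have h3 := inner_self_eq_norm_sq_to_K (𝕜 := ℂ) (gen hA 0 0)
      have h4 : ∀ᵐ θ ∂circ, ex (-0) θ * ((A θ).conjTranspose.mulVec (gen hA 0 0 θ).ofLp) 0 =
          ((1 + κ θ : ℝ) : ℂ) := by
        filter_upwards [coeFn_toVec _ (fun i => memLp_ex_mul (hA.memLp i 0) 0)] with θ h
        rw [gen, h]
        simp only [A, ex_zero, neg_zero, one_mul, Matrix.mulVec, dotProduct, Fin.sum_univ_one,
          Matrix.conjTranspose_apply, Matrix.of_apply, Complex.star_def, Complex.conj_ofReal,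
          ← Complex.ofReal_mul, Real.mul_self_sqrt (hω θ).le]
      rw [inner_gen, integral_congr_ae h4, integral_complex_ofReal,
        integral_add (integrable_const 1) hκ] at h3
      rw [integral_const_circ, mul_one] at h3
      exact Complex.ofReal_injective (by rw [h3]; push_cast; rfl)
    rw [← h2]
    gcongr
  -- `O = A⁻¹R` is the damping factor; `R` has constant modulus, bounded by the weighted norm of `1`
  have hR0 : ∀ θ, ‖(R θ).ofLp 0‖ ^ 2 = ‖R θ‖ ^ 2 := fun θ => by
    rw [EuclideanSpace.norm_sq_eq, Fin.sum_univ_one]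
  have hO : ∀ θ, ((A θ)⁻¹.mulVec (R θ).ofLp) 0 = (((√(1 + κ θ))⁻¹ : ℝ) : ℂ) * (R θ).ofLp 0 := by
    intro θ
    simp only [Matrix.mulVec, dotProduct, Fin.sum_univ_one, hAinv]
  have hbd : ∀ᵐ θ ∂circ, ‖(R θ).ofLp 0‖ ^ 2 ≤ 1 + 1 / (2 * Real.pi) * ∫ θ, κ θ ∂circ := by
    filter_upwards [hconst] with θ h
    rw [hR0, h]
    have hpi := Real.pi_pos
    calc 1 / (2 * Real.pi) * ‖R‖ ^ 2 ≤ 1 / (2 * Real.pi) * (2 * Real.pi + ∫ θ, κ θ ∂circ) := by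
          gcongr
      _ = _ := by field_simp
  have hOn : ∀ θ, ‖(((√(1 + κ θ))⁻¹ : ℝ) : ℂ) * (R θ).ofLp 0‖ ^ 2 * (1 + κ θ) =
      ‖(R θ).ofLp 0‖ ^ 2 := by
    intro θ
    rw [norm_mul, mul_pow, Complex.norm_real, Real.norm_of_nonneg (inv_nonneg.2 (Real.sqrt_nonneg _)),
      inv_pow, Real.sq_sqrt (hω θ).le]
    field_simp [(hω θ).ne']
  refine ⟨fun θ => (((√(1 + κ θ))⁻¹ : ℝ) : ℂ) * (R θ).ofLp 0, hsm'.mul (memLp_apply R 0).1, ?_, ?_,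
    fun K c hK hKc hK0 => ⟨?_, fun n hn => ?_⟩⟩
  · filter_upwards [hbd] with θ h
    rwa [hOn]
  -- the mean of `O` is that of `1`, since the projection to the past has only negative frequencies
  · have h := integral_ex_inv_mulVec_residual hA 0 b (fun k hk => funext fun _ => if_neg (by omega))
      0 0
    simpa only [← hR, hO, Nat.cast_zero, neg_zero, ex_zero, one_mul, b, if_true, mul_one] using h
  -- `‖O K‖² ≤ c (κ ‖O‖²) ‖K‖`, and `κ ‖O‖²` is bounded
  · refine (memLp_two_iff_integrable_sq_norm ((hsm'.mul (memLp_apply R 0).1).mul hK.1)).2 ?_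
    refine (hK.norm.const_mul ((1 + 1 / (2 * Real.pi) * ∫ θ, κ θ ∂circ) * c)).mono'
      (((hsm'.mul (memLp_apply R 0).1).mul hK.1).norm.pow 2) ?_
    filter_upwards [hbd] with θ h
    rw [Real.norm_of_nonneg (sq_nonneg _), Pi.mul_apply, norm_mul, mul_pow]
    have h1 := hOn θ
    set o := ‖(((√(1 + κ θ))⁻¹ : ℝ) : ℂ) * (R θ).ofLp 0‖ ^ 2
    have ho : 0 ≤ o := sq_nonneg _
    have h2 : ‖K θ‖ ^ 2 ≤ c * κ θ * ‖K θ‖ := by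
      rw [sq]
      exact mul_le_mul_of_nonneg_right (hKc θ) (norm_nonneg _)
    have h3 : 0 ≤ c * κ θ := (norm_nonneg _).trans (hKc θ)
    have h4 : o * κ θ ≤ 1 + 1 / (2 * Real.pi) * ∫ θ, κ θ ∂circ := by nlinarith
    rcases lt_or_ge c 0 with hc | hc
    · have h5 : ‖K θ‖ = 0 := le_antisymm
        ((hKc θ).trans (mul_nonpos_of_nonpos_of_nonneg hc.le (hκ0 θ))) (norm_nonneg _)
      change o * ‖K θ‖ ^ 2 ≤ _
      rw [h5]
      simp
    · calc o * ‖K θ‖ ^ 2 ≤ o * (c * κ θ * ‖K θ‖) := by gcongr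
        _ = (o * κ θ) * (c * ‖K θ‖) := by ring
        _ ≤ (1 + 1 / (2 * Real.pi) * ∫ θ, κ θ ∂circ) * (c * ‖K θ‖) := by gcongr
        _ = _ := by ring
  -- `∫ e^{-inθ} O K` is the inner product of `R` with `conj (A⁻¹ e^{-inθ} K)`, orthogonal to the
  -- closed span of the frequencies `≤ 0` because `K` has only negative ones
  · have hQ : MemLp (fun θ => star ((((√(1 + κ θ))⁻¹ : ℝ) : ℂ) * (ex (-n) θ * K θ))) 2 circ := by
      have hm : AEStronglyMeasurable (fun θ => (((√(1 + κ θ))⁻¹ : ℝ) : ℂ) * (ex (-n) θ * K θ)) circ :=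
        hsm'.mul (integrable_ex_mul hK _).1
      refine MemLp.star ?_
      refine (memLp_two_iff_integrable_sq_norm hm).2 ((hK.norm.const_mul |c|).mono'
        (hm.norm.pow 2) (Eventually.of_forall fun θ => ?_))
      rw [Real.norm_of_nonneg (sq_nonneg _), norm_mul, norm_mul, norm_ex, one_mul, mul_pow,
        Complex.norm_real, Real.norm_of_nonneg (inv_nonneg.2 (Real.sqrt_nonneg _)), inv_pow,
        Real.sq_sqrt (hω θ).le, inv_mul_le_iff₀ (hω θ)]
      have h1 : ‖K θ‖ ≤ |c| * (1 + κ θ) := (hKc θ).trans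
        (mul_le_mul (le_abs_self c) (by linarith) (hκ0 θ) (abs_nonneg c))
      nlinarith [norm_nonneg (K θ)]
    have hin : ∀ V : VecL2 1, inner ℂ (toVec (fun θ _ =>
        star ((((√(1 + κ θ))⁻¹ : ℝ) : ℂ) * (ex (-n) θ * K θ))) fun _ => hQ) V =
        ∫ θ, (((√(1 + κ θ))⁻¹ : ℝ) : ℂ) * (ex (-n) θ * K θ) * (V θ).ofLp 0 ∂circ := by
      intro V
      rw [inner_toVec]
      simp only [dotProduct, Fin.sum_univ_one, Pi.star_apply, star_star]
    have hor : toVec (fun θ _ => star ((((√(1 + κ θ))⁻¹ : ℝ) : ℂ) * (ex (-n) θ * K θ)))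
        (fun _ : Fin 1 => hQ) ∈ (specPast hA 0)ᗮ := by
      refine (mem_orthogonal_specPast hA).2 fun k hk l => ?_
      rw [← inner_conj_symm, hin, ← map_zero (starRingEnd ℂ)]
      congr 1
      rw [← hK0 (n - k) (by omega)]
      refine integral_congr_ae ?_
      filter_upwards [coeFn_toVec _ (fun i => memLp_ex_mul (hA.memLp i l) k)] with θ h
      rw [gen, h]
      simp only [A, Matrix.of_apply, Complex.ofReal_inv]
      rw [show -(n - k) = k + -n by ring, ← ex_add]
      field_simp [hs0' θ]
    rw [← (Submodule.mem_orthogonal' _ _).1 hor R hRp, hin]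
    refine integral_congr_ae (Eventually.of_forall fun θ => ?_)
    ring

/-- The pairing of a square integrable function with frequencies `≥ 0` and an integrable function
with frequencies `≤ -1` vanishes as soon as it is integrable. For `K` in `L₂` this is Parseval's
identity; in general `K` is multiplied by the damping factors of the weights `κ/(n+1)`, with
`κ = ∑ ‖K_p‖`, which keep the frequencies negative, make `K` square integrable and tend to `1`. -/
theorem integral_dotProduct_eq_zero_of_coeff {T : ℕ} {E K : ℝ → Fin T → ℂ}
    (hE : ∀ p, MemLp (fun θ => E θ p) 2 circ) (hK : ∀ p, Integrable (fun θ => K θ p) circ)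
    (hE0 : ∀ p, ∀ n : ℤ, n < 0 → ∫ θ, ex (-n) θ * E θ p ∂circ = 0)
    (hK0 : ∀ p, ∀ n : ℤ, 0 ≤ n → ∫ θ, ex (-n) θ * K θ p ∂circ = 0)
    (hint : Integrable (fun θ => star (E θ) ⬝ᵥ K θ) circ) :
    ∫ θ, star (E θ) ⬝ᵥ K θ ∂circ = 0 := by
  have hpi := Real.pi_pos
  set κ : ℝ → ℝ := fun θ => ∑ p, ‖K θ p‖ with hκdef
  have hκ : Integrable κ circ := integrable_finsetSum _ fun p _ => (hK p).norm
  have hκ0 : ∀ θ, 0 ≤ κ θ := fun θ => Finset.sum_nonneg fun p _ => norm_nonneg _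
  have hI0 : 0 ≤ ∫ θ, κ θ ∂circ := integral_nonneg hκ0
  have hinv : ∀ n : ℕ, (0 : ℝ) < ((n : ℝ) + 1)⁻¹ := fun n => by positivity
  choose O hOm hOb hOi hOK using fun n : ℕ => exists_damping (hκ.const_mul ((n : ℝ) + 1)⁻¹)
    fun θ => mul_nonneg (hinv n).le (hκ0 θ)
  have hOb' : ∀ n, ∀ᵐ θ ∂circ, ‖O n θ‖ ^ 2 ≤
      1 + 1 / (2 * Real.pi) * (((n : ℝ) + 1)⁻¹ * ∫ θ, κ θ ∂circ) := by
    intro n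
    filter_upwards [hOb n] with θ h
    rw [integral_const_mul] at h
    nlinarith [mul_nonneg (sq_nonneg ‖O n θ‖) (mul_nonneg (hinv n).le (hκ0 θ))]
  have hzero : ∀ n, ∫ θ, O n θ * (star (E θ) ⬝ᵥ K θ) ∂circ = 0 := by
    intro n
    have hp : ∀ p, MemLp (fun θ => O n θ * K θ p) 2 circ ∧
        ∀ m : ℤ, 0 ≤ m → ∫ θ, ex (-m) θ * (O n θ * K θ p) ∂circ = 0 := fun p =>
      hOK n _ ((n : ℝ) + 1) (hK p) (fun θ => by
        rw [← mul_assoc, mul_inv_cancel₀ (by positivity), one_mul]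
        exact Finset.single_le_sum (f := fun p => ‖K θ p‖) (fun p _ => norm_nonneg _)
          (Finset.mem_univ p)) (hK0 p)
    have h1 : ∀ θ, O n θ * (star (E θ) ⬝ᵥ K θ) = ∑ p, star (E θ p) * (O n θ * K θ p) := by
      intro θ
      simp only [dotProduct, Finset.mul_sum, Pi.star_apply]
      exact Finset.sum_congr rfl fun p _ => by ring
    simp only [h1]
    rw [integral_finsetSum _ fun p _ => integrable_star_mul (hE p) (hp p).1]
    exact Finset.sum_eq_zero fun p _ =>
      integral_star_mul_eq_zero_of_coeff (hE p) (hp p).1 (hE0 p) (hp p).2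
  -- the damping factors tend to `1` in mean square, since their mean is `1`
  have hO2 : ∀ n, MemLp (O n) 2 circ := fun n => by
    refine MemLp.of_bound (hOm n) (√(1 + 1 / (2 * Real.pi) * (((n : ℝ) + 1)⁻¹ * ∫ θ, κ θ ∂circ))) ?_
    filter_upwards [hOb' n] with θ h
    exact Real.le_sqrt_of_sq_le h
  have hdist : ∀ n, ∫ θ, ‖O n θ - 1‖ ^ 2 ∂circ ≤ ((n : ℝ) + 1)⁻¹ * ∫ θ, κ θ ∂circ := by
    intro n
    have h1 : ∀ θ, ‖O n θ - 1‖ ^ 2 = ‖O n θ‖ ^ 2 - 2 * (O n θ).re + 1 := by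
      intro θ
      rw [← Complex.normSq_eq_norm_sq, ← Complex.normSq_eq_norm_sq, Complex.normSq_apply,
        Complex.normSq_apply]
      simp
      ring
    have hi2 : Integrable (fun θ => ‖O n θ‖ ^ 2) circ :=
      (memLp_two_iff_integrable_sq_norm (hOm n)).1 (hO2 n)
    have hire : Integrable (fun θ => (O n θ).re) circ := ((hO2 n).integrable (by norm_num)).re
    have hre : ∫ θ, (O n θ).re ∂circ = 2 * Real.pi := by
      have h2 := integral_re ((hO2 n).integrable (by norm_num))
      rw [hOi n] at h2
      simpa using h2
    simp only [h1]
    rw [integral_add (f := fun θ => ‖O n θ‖ ^ 2 - 2 * (O n θ).re) (hi2.sub (hire.const_mul 2))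
        (integrable_const 1),
      integral_sub hi2 (hire.const_mul 2), integral_const_mul, hre,
      integral_const_circ]
    have h3 := integral_mono_ae hi2 (integrable_const _) (hOb' n)
    rw [integral_const_circ] at h3
    have h4 : 2 * Real.pi * (1 + 1 / (2 * Real.pi) * (((n : ℝ) + 1)⁻¹ * ∫ θ, κ θ ∂circ)) =
        2 * Real.pi + ((n : ℝ) + 1)⁻¹ * ∫ θ, κ θ ∂circ := by
      field_simp
    linarith
  have hlim : Tendsto (fun n : ℕ => eLpNorm (O n - fun _ => (1 : ℂ)) 2 circ) atTop (𝓝 0) := by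
    have h1 : ∀ n, eLpNorm (O n - fun _ => (1 : ℂ)) 2 circ =
        ENNReal.ofReal ((∫ θ, ‖O n θ - 1‖ ^ 2 ∂circ) ^ ((1 : ℝ) / 2)) := by
      intro n
      rw [MemLp.eLpNorm_eq_integral_rpow_norm (by norm_num) (by norm_num)
        ((hO2 n).sub (memLp_const 1))]
      simp
    have h2 : Tendsto (fun n : ℕ => ∫ θ, ‖O n θ - 1‖ ^ 2 ∂circ) atTop (𝓝 0) := by
      refine squeeze_zero (fun n => integral_nonneg fun θ => sq_nonneg _) hdist ?_
      have := (tendsto_one_div_add_atTop_nhds_zero_nat (𝕜 := ℝ)).mul_const (∫ θ, κ θ ∂circ)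
      simpa using this
    simp only [h1]
    rw [← ENNReal.ofReal_zero]
    refine ENNReal.tendsto_ofReal ?_
    have := h2.rpow_const (p := (1 : ℝ) / 2) (Or.inr (by norm_num))
    simpa using this
  obtain ⟨ns, -, hns⟩ := (tendstoInMeasure_of_tendsto_eLpNorm two_ne_zero hOm
    aestronglyMeasurable_const hlim).exists_seq_tendsto_ae
  have hdct := tendsto_integral_of_dominated_convergence
    (F := fun i θ => O (ns i) θ * (star (E θ) ⬝ᵥ K θ)) (f := fun θ => star (E θ) ⬝ᵥ K θ)
    (fun θ => √(1 + 1 / (2 * Real.pi) * ∫ θ, κ θ ∂circ) * ‖star (E θ) ⬝ᵥ K θ‖) (μ := circ)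
    (fun i => (hOm _).mul hint.1) (hint.norm.const_mul _)
    (fun i => by
      filter_upwards [hOb' (ns i)] with θ h
      rw [norm_mul]
      refine mul_le_mul_of_nonneg_right (Real.le_sqrt_of_sq_le (h.trans ?_)) (norm_nonneg _)
      have h1 : (((ns i : ℕ) : ℝ) + 1)⁻¹ ≤ 1 := inv_le_one_of_one_le₀ (by simp)
      gcongr
      exact mul_le_of_le_one_left hI0 h1)
    (by
      filter_upwards [hns] with θ h
      simpa using h.mul_const (star (E θ) ⬝ᵥ K θ))
  simp only [hzero] at hdct
  exact (tendsto_nhds_unique hdct tendsto_const_nhds)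

/-- The equation `F c = 0` has only the trivial solution: for the residual `R` of a monomial, the
pairing of `AᴴR` with `(AᴴA)⁻¹C` vanishes, and equals the pairing of `A⁻¹R` with `C`, in which only
the coefficient of `C` at the frequency of the monomial is left. -/
theorem ae_eq_zero_of_coeff_inv_mulVec {T : ℕ} {A : ℝ → Matrix (Fin T) (Fin T) ℂ}
    (hA : IsMinimalFactor A) {C : ℝ → Fin T → ℂ} (hC : ∀ p, MemLp (fun θ => C θ p) 2 circ)
    (hC0 : ∀ p, ∀ n : ℤ, n < 0 → ∫ θ, ex (-n) θ * C θ p ∂circ = 0)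
    (hK : ∀ p, Integrable
      (fun θ => (((A θ).conjTranspose * A θ)⁻¹.mulVec (C θ)) p) circ)
    (hK0 : ∀ p, ∀ n : ℤ, 0 ≤ n →
      ∫ θ, ex (-n) θ * (((A θ).conjTranspose * A θ)⁻¹.mulVec (C θ)) p ∂circ = 0) (l : Fin T) :
    ∀ᵐ θ ∂circ, C θ l = 0 := by
  refine ae_eq_zero_of_integral_ex_eq_zero ((hC l).integrable (by norm_num)) fun n => ?_
  rcases lt_or_ge 0 n with hn | hn
  · simpa using hC0 l (-n) (by omega)
  -- pair `C` with the residual `R` of the monomial `e^{imθ} δ_l`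
  obtain ⟨m, hm⟩ := Int.eq_ofNat_of_zero_le (show 0 ≤ -n by omega)
  let b : ℕ → Fin T → ℂ := fun k p => if k = m ∧ p = l then 1 else 0
  have hb : ∀ k, m < k → b k = 0 := fun k hk => funext fun p => if_neg (by omega)
  set R := residual hA m b with hR
  have hkey : ∀ᵐ θ ∂circ, star ((A θ).conjTranspose.mulVec (R θ).ofLp) ⬝ᵥ
      (((A θ).conjTranspose * A θ)⁻¹.mulVec (C θ)) =
      star ((A θ)⁻¹.mulVec (R θ).ofLp) ⬝ᵥ C θ := by
    filter_upwards [hA.isUnit] with θ h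
    have hdet := (Matrix.isUnit_iff_isUnit_det _).1 h
    rw [Matrix.star_mulVec, Matrix.star_mulVec, Matrix.conjTranspose_conjTranspose,
      Matrix.mul_inv_rev, ← Matrix.dotProduct_mulVec, ← Matrix.dotProduct_mulVec,
      Matrix.mulVec_mulVec, ← Matrix.mul_assoc, Matrix.mul_nonsing_inv _ hdet, Matrix.one_mul,
      Matrix.conjTranspose_nonsing_inv]
  have hρ := memLp_inv_mulVec_residual hA m b
  have hint1 : ∀ p, Integrable
      (fun θ => star (((A θ)⁻¹.mulVec (R θ).ofLp) p) * C θ p) circ := fun p =>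
    integrable_star_mul (hρ p) (hC p)
  have hint : Integrable (fun θ => star ((A θ)⁻¹.mulVec (R θ).ofLp) ⬝ᵥ C θ) circ := by
    simp only [dotProduct]
    exact integrable_finsetSum _ fun p _ => hint1 p
  have h1 := integral_dotProduct_eq_zero_of_coeff
    (memLp_conjTranspose_mulVec_residual hA m b) hK
    (integral_ex_conjTranspose_mulVec_residual hA m b) hK0
    (hint.congr (hkey.mono fun θ h => h.symm))
  rw [integral_congr_ae hkey] at h1
  simp only [dotProduct, Pi.star_apply] at h1
  rw [integral_finsetSum _ fun p _ => hint1 p] at h1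
  have h2 : ∀ p, ∫ θ, star (((A θ)⁻¹.mulVec (R θ).ofLp) p) * C θ p ∂circ =
      if p = l then ∫ θ, ex n θ * C θ l ∂circ else 0 := by
    intro p
    -- `A⁻¹R` minus the monomial has frequencies `≤ -1`
    have hF : MemLp (fun θ => ((A θ)⁻¹.mulVec (R θ).ofLp) p - b m p * ex (m : ℤ) θ) 2 circ :=
      (hρ p).sub ((memLp_ex m).const_mul _)
    have h3 := integral_star_mul_eq_zero_of_coeff (hC p) hF (hC0 p) fun j hj => by
      obtain ⟨j', rfl⟩ := Int.eq_ofNat_of_zero_le hj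
      simp only [mul_sub]
      rw [integral_sub (integrable_ex_mul (integrable_inv_mulVec hA R p) _)
        (integrable_ex_mul (((memLp_ex m).const_mul _).integrable (by norm_num)) _),
        integral_ex_inv_mulVec_residual hA m b hb]
      have h4 : ∀ θ, ex (-(j' : ℤ)) θ * (b m p * ex (m : ℤ) θ) = b m p * ex (m - j') θ := by
        intro θ
        rw [show (m : ℤ) - j' = -j' + m by ring, ← ex_add]
        ring
      simp only [h4, integral_const_mul, integral_ex]
      by_cases h5 : j' = m
      · subst h5
        simp
        ring
      · rw [if_neg (by omega)]
        simp [b, h5]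
    have h4 : ∀ θ, star (((A θ)⁻¹.mulVec (R θ).ofLp) p) * C θ p =
        star (star (C θ p) * (((A θ)⁻¹.mulVec (R θ).ofLp) p - b m p * ex (m : ℤ) θ)) +
          star (b m p) * (ex n θ * C θ p) := by
      intro θ
      rw [show n = -(m : ℤ) by omega, ← star_ex]
      simp only [star_mul', star_sub, star_star]
      ring
    simp only [h4]
    have h6 : Integrable (fun θ => star (star (C θ p) *
        (((A θ)⁻¹.mulVec (R θ).ofLp) p - b m p * ex (m : ℤ) θ))) circ :=
      memLp_one_iff_integrable.1
        (memLp_one_iff_integrable.2 (integrable_star_mul (hC p) hF)).star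
    rw [integral_add h6
      ((integrable_ex_mul ((hC p).integrable (by norm_num)) _).const_mul _), integral_const_mul]
    have h5 : ∫ θ, star (star (C θ p) *
        (((A θ)⁻¹.mulVec (R θ).ofLp) p - b m p * ex (m : ℤ) θ)) ∂circ = 0 := by
      simp only [Complex.star_def] at h3 ⊢
      rw [integral_conj, h3, map_zero]
    rw [h5, zero_add]
    by_cases h6 : p = l
    · subst h6
      simp [b]
    · simp [b, h6]
  rw [Finset.sum_congr rfl fun p _ => h2 p] at h1
  simpa using h1

/-! ### The symbols of the increments -/

section
variable {r T : ℕ}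

theorem chi_neg (s d : Fin r → ℕ) (μ : Fin r → ℤ) (θ : ℝ) :
    chi s d μ (-θ) = star (chi s d μ θ) := by
  simp only [chi, star_prod, star_pow, star_sub, star_one, star_ex, ex_neg]

theorem continuous_chi (s d : Fin r → ℕ) (μ : Fin r → ℤ) : Continuous (chi s d μ) := by
  unfold chi
  exact continuous_finsetProd _ fun j _ => (continuous_const.sub (continuous_ex _)).pow _

theorem continuous_beta (s d : Fin r → ℕ) : Continuous (beta s d) := by
  unfold beta
  fun_prop

theorem measurable_chi_div_beta (s d : Fin r → ℕ) (μ : Fin r → ℤ) :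
    Measurable fun θ => chi s d μ θ / beta s d θ :=
  (continuous_chi s d μ).measurable.div (continuous_beta s d).measurable

/-- The zero `2πk/s` of the denominator nearest to `θ` is also a zero of the numerator, and the
other factors of the denominator are at least `π/s` in modulus. -/
theorem norm_one_sub_ex_div_prod_le (s : ℕ) (hs : 0 < s) (m : ℤ) : ∃ c : ℝ, 0 ≤ c ∧ ∀ θ : ℝ,
    ‖(1 - ex (-(m * (s : ℤ))) θ) / ∏ k ∈ Finset.Icc (-((s / 2 : ℕ) : ℤ)) ((s / 2 : ℕ) : ℤ),
      (Complex.I * (θ : ℂ) - 2 * (Real.pi : ℂ) * Complex.I * (k : ℂ) / (s : ℂ))‖ ≤ c := by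
  set S := Finset.Icc (-((s / 2 : ℕ) : ℤ)) ((s / 2 : ℕ) : ℤ) with hS
  have hs' : (0 : ℝ) < s := by exact_mod_cast hs
  have hδ : 0 < Real.pi / s := div_pos Real.pi_pos hs'
  refine ⟨|(m : ℝ)| * s / (Real.pi / s) ^ (S.card - 1), by positivity, fun θ => ?_⟩
  have hfac : ∀ k : ℤ, ‖Complex.I * (θ : ℂ) - 2 * (Real.pi : ℂ) * Complex.I * (k : ℂ) / (s : ℂ)‖ =
      |θ - 2 * Real.pi * k / s| := by
    intro k
    have : Complex.I * (θ : ℂ) - 2 * (Real.pi : ℂ) * Complex.I * (k : ℂ) / (s : ℂ) =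
        Complex.I * ((θ - 2 * Real.pi * k / s : ℝ) : ℂ) := by
      push_cast
      ring
    rw [this, norm_mul, Complex.norm_I, one_mul, Complex.norm_real, Real.norm_eq_abs]
  obtain ⟨k0, hk0, hmin⟩ := Finset.exists_min_image S (fun k : ℤ => |θ - 2 * Real.pi * k / s|)
    ⟨0, by rw [hS, Finset.mem_Icc]; omega⟩
  set u := θ - 2 * Real.pi * k0 / s with hu
  have hnum : ‖1 - ex (-(m * (s : ℤ))) θ‖ ≤ |(m : ℝ)| * s * |u| := by
    have h1 : ex (-(m * (s : ℤ))) θ = Complex.exp (Complex.I * ((-(m * s * u) : ℝ) : ℂ)) := by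
      have hsC : (s : ℂ) ≠ 0 := by exact_mod_cast hs.ne'
      have h2 : Complex.I * ((-(m * s * u) : ℝ) : ℂ) =
          Complex.I * ((-(m * (s : ℤ)) : ℤ) : ℂ) * (θ : ℂ) +
            (m * k0 : ℤ) * (2 * Real.pi * Complex.I) := by
        rw [hu]
        push_cast
        field_simp
        ring
      rw [h2, Complex.exp_periodic.int_mul (m * k0) _, ex]
    rw [h1, norm_sub_rev]
    refine (Real.norm_exp_I_mul_ofReal_sub_one_le).trans ?_
    rw [norm_neg, norm_mul, norm_mul, Real.norm_eq_abs, Real.norm_eq_abs, Real.norm_eq_abs,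
      abs_of_pos hs']
  rcases eq_or_ne u 0 with h0 | h0
  -- at a zero of the denominator the quotient is `0` by convention
  · have : ∏ k ∈ S, (Complex.I * (θ : ℂ) - 2 * (Real.pi : ℂ) * Complex.I * (k : ℂ) / (s : ℂ)) = 0 := by
      refine Finset.prod_eq_zero hk0 ?_
      rw [← norm_eq_zero, hfac, ← hu, h0, abs_zero]
    rw [this, div_zero, norm_zero]
    positivity
  · have hden : |u| * (Real.pi / s) ^ (S.card - 1) ≤
        ‖∏ k ∈ S, (Complex.I * (θ : ℂ) - 2 * (Real.pi : ℂ) * Complex.I * (k : ℂ) / (s : ℂ))‖ := by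
      rw [norm_prod, ← Finset.mul_prod_erase S _ hk0, hfac, ← hu, ← Finset.card_erase_of_mem hk0,
        ← Finset.prod_const]
      refine mul_le_mul_of_nonneg_left
        (Finset.prod_le_prod (fun _ _ => hδ.le) fun k hk => ?_) (abs_nonneg _)
      rw [hfac]
      have h1 := hmin k (Finset.mem_of_mem_erase hk)
      have h2 : 2 * Real.pi / s ≤ |θ - 2 * Real.pi * k / s| + |u| := by
        have h3 : (1 : ℝ) ≤ |((k0 - k : ℤ) : ℝ)| := by
          exact_mod_cast Int.one_le_abs (sub_ne_zero.2 (Finset.ne_of_mem_erase hk).symm)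
        calc 2 * Real.pi / s ≤ 2 * Real.pi / s * |((k0 - k : ℤ) : ℝ)| :=
              le_mul_of_one_le_right (by positivity) h3
          _ = |(θ - 2 * Real.pi * k / s) - u| := by
              rw [← abs_of_pos (show 0 < 2 * Real.pi / s by positivity), ← abs_mul, hu]
              congr 1
              push_cast
              ring
          _ ≤ _ := abs_sub _ _
      have h3 : 2 * Real.pi / s = 2 * (Real.pi / s) := by ring
      rw [h3] at h2
      linarith
    rw [norm_div]
    have hup : 0 < |u| := abs_pos.2 h0
    calc _ ≤ |(m : ℝ)| * s * |u| / (|u| * (Real.pi / s) ^ (S.card - 1)) := by gcongr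
      _ = _ := by field_simp

/-- The symbol of an increment is bounded, so that `χ/β` multiplies `L₂(f)` into itself for every
step. -/
theorem exists_norm_chi_div_beta_le (s d : Fin r → ℕ) (hs : ∀ i, 0 < s i) (μ : Fin r → ℤ) :
    ∃ c : ℝ, ∀ θ, ‖chi s d μ θ / beta s d θ‖ ≤ c := by
  choose c hc0 hc using fun j => norm_one_sub_ex_div_prod_le (s j) (hs j) (μ j)
  refine ⟨∏ j, c j ^ d j, fun θ => ?_⟩
  simp only [chi, beta, Finset.prod_pow]
  rw [← Finset.prod_div_distrib, norm_prod]
  refine Finset.prod_le_prod (fun j _ => norm_nonneg _) fun j _ => ?_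
  rw [← div_pow, norm_pow]
  exact pow_le_pow_left₀ (norm_nonneg _) (hc j θ) _

theorem ae_chi_ne_zero (s d : Fin r → ℕ) (hs : ∀ i, 0 < s i) (μ : Fin r → ℤ) (hμ : ∀ i, μ i ≠ 0) :
    ∀ᵐ θ ∂circ, chi s d μ θ ≠ 0 := by
  have h : ∀ j, ∀ᵐ θ ∂circ, ex (-(μ j * (s j : ℤ))) θ ≠ 1 := by
    intro j
    have hn : -(μ j * (s j : ℤ)) ≠ 0 := by
      have := hs j
      have := hμ j
      simp only [ne_eq, neg_eq_zero, mul_eq_zero, not_or]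
      omega
    refine ae_restrict_of_ae ?_
    refine ((Set.countable_range fun k : ℤ =>
      (k : ℝ) * (2 * Real.pi) / (-(μ j * (s j : ℤ)) : ℤ)).mono ?_).measure_zero _
    intro θ hθ
    simp only [Set.mem_compl_iff, Set.mem_ofPred_eq, not_not, ex] at hθ
    obtain ⟨k, hk⟩ := Complex.exp_eq_one_iff.1 hθ
    refine ⟨k, ?_⟩
    have hn' : ((-(μ j * (s j : ℤ)) : ℤ) : ℝ) ≠ 0 := by exact_mod_cast hn
    rw [div_eq_iff hn']
    have h1 : Complex.I * (((-(μ j * (s j : ℤ)) : ℤ) : ℂ) * (θ : ℂ)) =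
        Complex.I * ((k : ℂ) * (2 * Real.pi)) := by
      rw [← mul_assoc, hk]
      ring
    have h2 := mul_left_cancel₀ Complex.I_ne_zero h1
    have h3 : ((-(μ j * (s j : ℤ)) : ℤ) : ℝ) * θ = k * (2 * Real.pi) := by exact_mod_cast h2
    rw [← h3]
    ring
  filter_upwards [ae_all_iff.2 h] with θ h1
  exact Finset.prod_ne_zero_iff.2 fun j _ => pow_ne_zero _ (sub_ne_zero.2 (h1 j).symm)

theorem ae_beta_ne_zero (s d : Fin r → ℕ) : ∀ᵐ θ ∂circ, beta s d θ ≠ 0 := by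
  have h : ∀ (j : Fin r) (k : ℤ), ∀ᵐ θ ∂circ, θ ≠ 2 * Real.pi * k / s j := fun j k =>
    ae_restrict_of_ae (Measure.ae_ne volume _)
  filter_upwards [ae_all_iff.2 fun j => ae_all_iff.2 fun k => h j k] with θ h1
  refine Finset.prod_ne_zero_iff.2 fun j _ => Finset.prod_ne_zero_iff.2 fun k _ =>
    pow_ne_zero _ fun h2 => h1 j k ?_
  have h3 : Complex.I * (θ : ℂ) = Complex.I * ((2 * Real.pi * k / s j : ℝ) : ℂ) := by
    rw [sub_eq_zero.1 h2]
    push_cast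
    ring
  exact_mod_cast mul_left_cancel₀ Complex.I_ne_zero h3

/-! ### Factorization of the spectral density -/

theorem aestronglyMeasurable_det {n : ℕ} {α : Type*} [MeasurableSpace α] {ν : Measure α}
    {A : α → Matrix (Fin n) (Fin n) ℂ}
    (hA : ∀ i j, AEStronglyMeasurable (fun θ => A θ i j) ν) :
    AEStronglyMeasurable (fun θ => (A θ).det) ν := by
  simp only [Matrix.det_apply]
  refine Finset.aestronglyMeasurable_fun_sum _ fun σ _ => AEStronglyMeasurable.const_smul ?_ _
  exact Finset.aestronglyMeasurable_fun_prod _ fun i _ => hA _ _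

theorem aestronglyMeasurable_inv {n : ℕ} {α : Type*} [MeasurableSpace α] {ν : Measure α}
    {A : α → Matrix (Fin n) (Fin n) ℂ}
    (hA : ∀ i j, AEStronglyMeasurable (fun θ => A θ i j) ν) (i j : Fin n) :
    AEStronglyMeasurable (fun θ => (A θ)⁻¹ i j) ν := by
  simp only [Matrix.inv_def, Matrix.smul_apply, Ring.inverse_eq_inv', smul_eq_mul,
    Matrix.adjugate_apply]
  refine ((aestronglyMeasurable_det hA).aemeasurable.inv.aestronglyMeasurable).mul
    (aestronglyMeasurable_det fun k l => ?_)
  by_cases h : k = j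
  · subst h
    simp only [Matrix.updateRow_self]
    exact aestronglyMeasurable_const
  · simp only [Matrix.updateRow_ne h]
    exact hA k l

open scoped MatrixOrder ComplexOrder Matrix.Norms.L2Operator in
theorem continuousOn_sqrt_apply {n : ℕ} (i j : Fin n) :
    ContinuousOn (fun a : Fin n → Fin n → ℂ => (CFC.sqrt (Matrix.of a)) i j)
      {a | 0 ≤ Matrix.of a} := by
  have h1 : ContinuousOn (fun a : Fin n → Fin n → ℂ => CFC.sqrt (Matrix.of a))
      {a | 0 ≤ Matrix.of a} := by
    simp only [CFC.sqrt_eq_cfc]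
    exact ContinuousOn.cfc_nnreal_of_mem_nhdsSet (s := Set.univ) _ Filter.univ_mem
      (Continuous.continuousOn (continuous_id : Continuous fun a : Fin n → Fin n → ℂ => a))
      (fun a ha => ha) NNReal.continuous_sqrt.continuousOn
  exact (Continuous.matrix_elem continuous_id i j).comp_continuousOn h1

open scoped MatrixOrder ComplexOrder Matrix.Norms.L2Operator in
/-- A positive semidefinite matrix function has a measurable factor: the square root is continuous
on positive semidefinite matrices. -/
theorem exists_measurable_factor {f : ℝ → Matrix (Fin T) (Fin T) ℂ}
    (hm : ∀ p q, AEStronglyMeasurable (fun θ => f θ p q) circ)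
    (hpos : ∀ᵐ θ ∂circ, (f θ).PosSemidef) :
    ∃ A : ℝ → Matrix (Fin T) (Fin T) ℂ, (∀ i j, AEStronglyMeasurable (fun θ => A θ i j) circ) ∧
      ∀ᵐ θ ∂circ, (A θ).conjTranspose * A θ = (f θ).transpose := by
  classical
  refine ⟨fun θ => (CFC.sqrt (f θ)).transpose, fun i j => ?_, ?_⟩
  · have hcl : IsClosed {a : Fin T → Fin T → ℂ | 0 ≤ Matrix.of a} := by
      have : IsClosed {a : Matrix (Fin T) (Fin T) ℂ | 0 ≤ a} := CStarAlgebra.isClosed_nonneg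
      exact this
    have h1 : Measurable (({a : Fin T → Fin T → ℂ | 0 ≤ Matrix.of a}).piecewise
        (fun a => (CFC.sqrt (Matrix.of a)) j i) fun _ => 0) :=
      (continuousOn_sqrt_apply j i).measurable_piecewise continuousOn_const hcl.measurableSet
    have h2 : AEMeasurable (fun θ => (fun p q => f θ p q : Fin T → Fin T → ℂ)) circ :=
      aemeasurable_pi_lambda _ fun p => aemeasurable_pi_lambda _ fun q => (hm p q).aemeasurable
    refine ((h1.comp_aemeasurable h2).congr ?_).aestronglyMeasurable
    filter_upwards [hpos] with θ hθ
    rw [Function.comp_apply, Set.piecewise_eq_of_mem]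
    · rfl
    · exact Matrix.nonneg_iff_posSemidef.2 hθ
  · filter_upwards [hpos] with θ hθ
    have h0 : 0 ≤ f θ := Matrix.nonneg_iff_posSemidef.2 hθ
    have h1 : (CFC.sqrt (f θ)).conjTranspose = CFC.sqrt (f θ) :=
      (CFC.sqrt_nonneg (f θ)).isSelfAdjoint
    have h2 : (CFC.sqrt (f θ)).transpose.conjTranspose =
        (CFC.sqrt (f θ)).conjTranspose.transpose := rfl
    rw [h2, h1, ← Matrix.transpose_mul,
      CFC.sqrt_mul_sqrt_self (f θ) h0]

end

/-! ### Spectral integrals as isometric images -/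

/-- Two families with proportional Gram matrices are matched by a continuous linear map. -/
theorem exists_scaled_isometry {ι H K : Type*} [NormedAddCommGroup H] [InnerProductSpace ℂ H]
    [CompleteSpace H] [NormedAddCommGroup K] [InnerProductSpace ℂ K] [CompleteSpace K]
    (x : ι → H) (X : ι → K) (c : ℝ) (hgram : ∀ i j, inner ℂ (X i) (X j) = c * inner ℂ (x i) (x j))
    (htot : ∀ v, (∀ i, inner ℂ (x i) v = 0) → v = 0) :
    ∃ U : H →L[ℂ] K, (∀ i, U (x i) = X i) ∧ ∀ v w, inner ℂ (U v) (U w) = c * inner ℂ v w := by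
  set e := Finsupp.linearCombination ℂ x with he
  set g := Finsupp.linearCombination ℂ X with hg
  have hinner : ∀ a b, inner ℂ (g a) (g b) = c * inner ℂ (e a) (e b) := by
    intro a b
    induction a using Finsupp.induction_linear with
    | zero => simp
    | add a a' h h' => simp only [map_add, inner_add_left, h, h', mul_add]
    | single i α =>
      induction b using Finsupp.induction_linear with
      | zero => simp
      | add a a' h h' => simp only [map_add, inner_add_right, h, h', mul_add]
      | single j β =>
        simp only [he, hg, Finsupp.linearCombination_single, inner_smul_left, inner_smul_right,
          hgram]
        ring
  have hdense : DenseRange e := by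
    have h1 : Dense ((Submodule.span ℂ (Set.range x) : Submodule ℂ H) : Set H) := by
      rw [Submodule.dense_iff_topologicalClosure_eq_top, Submodule.topologicalClosure_eq_top_iff,
        Submodule.eq_bot_iff]
      intro v hv
      exact htot v fun i => (Submodule.mem_orthogonal _ _).1 hv _ (Submodule.subset_span ⟨i, rfl⟩)
    rw [← Finsupp.range_linearCombination] at h1
    exact h1
  have hnorm : ∀ a, ‖g a‖ ^ 2 = c * ‖e a‖ ^ 2 := by
    intro a
    have h := hinner a a
    rw [inner_self_eq_norm_sq_to_K, inner_self_eq_norm_sq_to_K] at h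
    have h' : (‖g a‖ : ℂ) ^ 2 = c * (‖e a‖ : ℂ) ^ 2 := h
    exact_mod_cast h'
  have hbound : ∃ C, ∀ a, ‖g a‖ ≤ C * ‖e a‖ := by
    refine ⟨√|c|, fun a => ?_⟩
    rw [← Real.sqrt_sq (norm_nonneg (g a)), hnorm, ← Real.sqrt_sq (norm_nonneg (e a)),
      ← Real.sqrt_mul (abs_nonneg c), Real.sqrt_sq (norm_nonneg (e a))]
    exact Real.sqrt_le_sqrt (mul_le_mul_of_nonneg_right (le_abs_self c) (sq_nonneg _))
  have hU : ∀ a, g.extendOfNorm e (e a) = g a := LinearMap.extendOfNorm_eq hdense hbound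
  refine ⟨g.extendOfNorm e, fun i => ?_, fun v w => ?_⟩
  · have h := hU (Finsupp.single i 1)
    simpa [he, hg, Finsupp.linearCombination_single] using h
  · refine hdense.induction_on₂ (p := fun v w => inner ℂ (g.extendOfNorm e v) (g.extendOfNorm e w) =
      c * inner ℂ v w) (isClosed_eq (by fun_prop) (by fun_prop)) (fun a b => ?_) v w
    rw [hU, hU, hinner]

/-- Continuous linear maps that agree on a total family are equal; totality is expressed by the
triviality of the orthogonal complement. -/
theorem eq_of_total {ι H K : Type*} [NormedAddCommGroup H] [InnerProductSpace ℂ H]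
    [CompleteSpace H] [NormedAddCommGroup K] [InnerProductSpace ℂ K]
    (x : ι → H) (htot : ∀ v, (∀ i, inner ℂ (x i) v = 0) → v = 0) {U V : H →L[ℂ] K}
    (h : ∀ i, U (x i) = V (x i)) : U = V := by
  have h1 : Dense ((Submodule.span ℂ (Set.range x) : Submodule ℂ H) : Set H) := by
    rw [Submodule.dense_iff_topologicalClosure_eq_top, Submodule.topologicalClosure_eq_top_iff,
      Submodule.eq_bot_iff]
    intro v hv
    exact htot v fun i => (Submodule.mem_orthogonal _ _).1 hv _ (Submodule.subset_span ⟨i, rfl⟩)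
  refine ContinuousLinearMap.ext_on h1 ?_
  rintro _ ⟨i, rfl⟩
  exact h i

/-- A function whose indefinite integral vanishes is zero, as the half-lines form a generating
π-system. -/
theorem ae_eq_zero_of_setIntegral_Ico {h : ℝ → ℂ} (hh : Integrable h circ)
    (h0 : ∀ t, -Real.pi ≤ t → t < Real.pi → ∫ θ in Set.Ico (-Real.pi) t, h θ = 0) :
    ∀ᵐ θ ∂circ, h θ = 0 := by
  have hIio : ∀ t, t < Real.pi → ∫ θ in Set.Iio t, h θ ∂circ = 0 := by
    intro t ht
    rw [Measure.restrict_restrict measurableSet_Iio]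
    rcases le_or_gt (-Real.pi) t with h1 | h1
    · rw [← h0 t h1 ht]
      congr 2
      ext θ
      simp only [Set.mem_inter_iff, Set.mem_Iio, Set.mem_Ico]
      constructor
      · rintro ⟨a, b, c⟩; exact ⟨b, a⟩
      · rintro ⟨a, b⟩; exact ⟨b, a, b.trans ht⟩
    · have : Set.Iio t ∩ Set.Ico (-Real.pi) Real.pi = ∅ := by
        ext θ
        simp only [Set.mem_inter_iff, Set.mem_Iio, Set.mem_Ico, Set.mem_empty_iff_false, iff_false]
        rintro ⟨a, b, c⟩
        linarith
      rw [this]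
      simp
  have hIioPi : ∫ θ in Set.Iio Real.pi, h θ ∂circ = 0 := by
    have hU : (⋃ n : ℕ, Set.Iio (Real.pi - 1 / ((n : ℝ) + 1))) = Set.Iio Real.pi := by
      ext θ
      simp only [Set.mem_iUnion, Set.mem_Iio]
      constructor
      · rintro ⟨n, hn⟩
        have : (0 : ℝ) < 1 / ((n : ℝ) + 1) := by positivity
        linarith
      · intro hθ
        obtain ⟨n, hn⟩ := exists_nat_one_div_lt (sub_pos.2 hθ)
        exact ⟨n, by linarith⟩
    have hmono : Monotone fun n : ℕ => Set.Iio (Real.pi - 1 / ((n : ℝ) + 1)) := by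
      intro m n hmn
      refine Set.Iio_subset_Iio ?_
      have : 1 / ((n : ℝ) + 1) ≤ 1 / ((m : ℝ) + 1) := by
        have : (m : ℝ) ≤ n := by exact_mod_cast hmn
        gcongr
      linarith
    have h1 := tendsto_setIntegral_of_monotone (μ := circ) (f := h) (fun n => measurableSet_Iio)
      hmono hh.integrableOn
    rw [hU] at h1
    refine tendsto_nhds_unique h1 (tendsto_const_nhds.congr fun n => (hIio _ ?_).symm)
    have : (0 : ℝ) < 1 / ((n : ℝ) + 1) := by positivity
    linarith
  have hall : ∫ θ, h θ ∂circ = 0 := by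
    have hsub : Set.Ico (-Real.pi) Real.pi ⊆ Set.Iio Real.pi := fun θ hθ => hθ.2
    rw [← hIioPi, Measure.restrict_restrict measurableSet_Iio, Set.inter_eq_right.2 hsub]
  refine hh.ae_eq_zero_of_forall_setIntegral_eq_zero fun s hs _ => ?_
  refine MeasurableSpace.induction_on_inter
    (C := fun s _ => ∫ θ in s, h θ ∂circ = 0)
    ((BorelSpace.measurable_eq (α := ℝ)).trans (borel_eq_generateFrom_Iio ℝ)) isPiSystem_Iio
    (by simp) ?_ ?_ ?_ s hs
  · rintro _ ⟨t, rfl⟩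
    rcases lt_or_ge t Real.pi with ht | ht
    · exact hIio t ht
    · rw [← hall, Measure.restrict_restrict measurableSet_Iio]
      congr 2
      ext θ
      simp only [Set.mem_inter_iff, Set.mem_Iio, Set.mem_Ico]
      constructor
      · tauto
      · rintro ⟨a, b⟩; exact ⟨b.trans_le ht, a, b⟩
  · intro t ht h1
    have h2 := integral_add_compl ht hh
    rw [h1, zero_add, hall] at h2
    exact h2
  · intro g hg hgm h1
    rw [integral_iUnion hgm hg hh.integrableOn]
    simp [h1]

section
variable {T : ℕ} {A : ℝ → Matrix (Fin T) (Fin T) ℂ}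

theorem memLp_indicator_Ico_mul {g : ℝ → ℂ} (hg : MemLp g 2 circ) (a b : ℝ) :
    MemLp (fun θ => (Set.Ico a b).indicator (fun _ => (1 : ℂ)) θ * g θ) 2 circ := by
  have h : (fun θ => (Set.Ico a b).indicator (fun _ => (1 : ℂ)) θ * g θ) =
      (Set.Ico a b).indicator g := by
    ext θ
    by_cases h : θ ∈ Set.Ico a b <;> simp [h]
  rw [h]
  exact hg.indicator measurableSet_Ico

/-- The representative `A 1_{[a,b)} δ_p` of the indicator of `[a, b)`. -/
def icoGen (hA : ∀ i j, MemLp (fun θ => A θ i j) 2 circ) (a b : ℝ) (p : Fin T) : VecL2 T :=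
  toVec (fun θ i => (Set.Ico a b).indicator (fun _ => (1 : ℂ)) θ * A θ i p)
    fun i => memLp_indicator_Ico_mul (hA i p) _ _

theorem icoGen_sub (hA : ∀ i j, MemLp (fun θ => A θ i j) 2 circ) {t a b : ℝ} (hta : t ≤ a)
    (hab : a ≤ b) (p : Fin T) : icoGen hA t b p - icoGen hA t a p = icoGen hA a b p := by
  refine ae_eq_of_ofLp ?_
  filter_upwards [Lp.coeFn_sub (icoGen hA t b p) (icoGen hA t a p),
    coeFn_toVec _ (fun j => memLp_indicator_Ico_mul (hA j p) t b),
    coeFn_toVec _ (fun j => memLp_indicator_Ico_mul (hA j p) t a),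
    coeFn_toVec _ (fun j => memLp_indicator_Ico_mul (hA j p) a b)] with θ h1 h2 h3 h4
  rw [h1, Pi.sub_apply, WithLp.ofLp_sub, icoGen, icoGen, icoGen, h2, h3, h4]
  ext j
  have h5 : (Set.Ico t b).indicator (fun _ => (1 : ℂ)) θ -
      (Set.Ico t a).indicator (fun _ => (1 : ℂ)) θ =
      (Set.Ico a b).indicator (fun _ => (1 : ℂ)) θ := by
    simp only [Set.indicator_apply, Set.mem_Ico]
    by_cases c1 : t ≤ θ <;> by_cases c2 : θ < a <;> by_cases c3 : θ < b <;>
      by_cases c4 : a ≤ θ <;> simp [c1, c2, c3, c4] <;> linarith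
  rw [Pi.sub_apply, ← h5, sub_mul]

theorem icoGen_self (hA : ∀ i j, MemLp (fun θ => A θ i j) 2 circ) (a : ℝ) (p : Fin T) :
    icoGen hA a a p = 0 := by
  rw [← icoGen_sub hA le_rfl le_rfl, sub_self]

theorem inner_icoGen (hA : ∀ i j, MemLp (fun θ => A θ i j) 2 circ) (a b a' b' : ℝ) (p q : Fin T) :
    inner ℂ (icoGen hA a b p) (icoGen hA a' b' q) =
      ∫ θ, (Set.Ico a b ∩ Set.Ico a' b').indicator
        (fun θ => ((A θ).conjTranspose * A θ) p q) θ ∂circ := by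
  rw [icoGen, inner_toVec]
  refine integral_congr_ae ?_
  filter_upwards [coeFn_toVec _ (fun j => memLp_indicator_Ico_mul (hA j q) a' b')] with θ h
  rw [icoGen, h]
  by_cases h1 : θ ∈ Set.Ico a b <;> by_cases h2 : θ ∈ Set.Ico a' b' <;>
    simp [h1, h2, dotProduct, Matrix.mul_apply]

theorem setIntegral_eq_indicator_mul {t : ℝ} (ht : t ≤ Real.pi) (g : ℝ → ℂ) :
    ∫ θ in Set.Ico (-Real.pi) t, g θ =
      ∫ θ, (Set.Ico (-Real.pi) t).indicator (fun _ => (1 : ℂ)) θ * g θ ∂circ := by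
  have h : ∀ θ, (Set.Ico (-Real.pi) t).indicator (fun _ => (1 : ℂ)) θ * g θ =
      (Set.Ico (-Real.pi) t).indicator g θ := by
    intro θ
    by_cases h : θ ∈ Set.Ico (-Real.pi) t <;> simp [h]
  simp only [h]
  rw [integral_indicator measurableSet_Ico, Measure.restrict_restrict measurableSet_Ico,
    Set.Ico_inter_Ico, sup_idem, min_eq_left ht]

theorem star_indicator_one (S : Set ℝ) (θ : ℝ) :
    star (S.indicator (fun _ => (1 : ℂ)) θ) = S.indicator (fun _ => (1 : ℂ)) θ := by
  by_cases h : θ ∈ S <;> simp [h]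

theorem inner_icoGen_eq_integral (hA : ∀ i j, MemLp (fun θ => A θ i j) 2 circ) {t : ℝ}
    (ht : t ≤ Real.pi)
    (p : Fin T) (V : VecL2 T) : inner ℂ (icoGen hA (-Real.pi) t p) V =
      ∫ θ in Set.Ico (-Real.pi) t, ((A θ).conjTranspose.mulVec (V θ).ofLp) p := by
  rw [setIntegral_eq_indicator_mul ht, icoGen, inner_toVec]
  refine integral_congr_ae (Eventually.of_forall fun θ => ?_)
  simp only [dotProduct, Matrix.mulVec, Matrix.conjTranspose_apply, Pi.star_apply, star_mul',
    star_indicator_one, Finset.mul_sum, mul_assoc]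

/-- The indicators of intervals `[-π, t)` are total in the weighted space. -/
theorem eq_zero_of_inner_icoGen (hA : ∀ i j, MemLp (fun θ => A θ i j) 2 circ)
    (hAu : ∀ᵐ θ ∂circ, IsUnit (A θ)) {V : VecL2 T}
    (h : ∀ t, -Real.pi ≤ t → t < Real.pi → ∀ p, inner ℂ (icoGen hA (-Real.pi) t p) V = 0) :
    V = 0 := by
  have h1 : ∀ l, ∀ᵐ θ ∂circ, ((A θ).conjTranspose.mulVec (V θ).ofLp) l = 0 := fun l => by
    refine ae_eq_zero_of_setIntegral_Ico ?_ fun t ht ht' => ?_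
    · simp only [Matrix.mulVec, dotProduct, Matrix.conjTranspose_apply]
      exact integrable_finsetSum _ fun i _ => integrable_star_mul (hA i l) (memLp_apply V i)
    · rw [← inner_icoGen_eq_integral hA ht'.le, h t ht ht']
  refine ae_eq_of_ofLp ?_
  filter_upwards [ae_all_iff.2 h1, hAu, Lp.coeFn_zero (EuclideanSpace ℂ (Fin T)) 2 circ]
    with θ h2 h3 h4
  rw [h4]
  have h5 : IsUnit (A θ).conjTranspose.det := by
    rw [Matrix.det_conjTranspose]
    exact ((Matrix.isUnit_iff_isUnit_det _).1 h3).star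
  exact Matrix.eq_zero_of_mulVec_eq_zero h5.ne_zero (funext h2)

/-- The vector representing a step function. -/
def stepVec (hA : ∀ i j, MemLp (fun θ => A θ i j) 2 circ) (S : StepFunction T) : VecL2 T :=
  ∑ i, ∑ p, S.w i p • icoGen hA (S.a i) (S.b i) p

theorem coeFn_finset_sum {ι : Type*} (s : Finset ι) (V : ι → VecL2 T) :
    ∀ᵐ θ ∂circ, ((∑ i ∈ s, V i : VecL2 T) θ).ofLp = ∑ i ∈ s, (V i θ).ofLp := by
  filter_upwards [Lp.coeFn_fun_finsetSum s V] with θ h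
  rw [h, WithLp.ofLp_sum]

theorem coeFn_stepVec (hA : ∀ i j, MemLp (fun θ => A θ i j) 2 circ) (S : StepFunction T) :
    ∀ᵐ θ ∂circ, (stepVec hA S θ).ofLp = (A θ).mulVec (S.eval θ) := by
  have h1 : ∀ i p, ∀ᵐ θ ∂circ, ((S.w i p • icoGen hA (S.a i) (S.b i) p :
      VecL2 T) θ).ofLp = fun j => (Set.Ico (S.a i) (S.b i)).indicator (fun _ => S.w i p) θ *
        A θ j p := by
    intro i p
    filter_upwards [Lp.coeFn_smul (S.w i p) (icoGen hA (S.a i) (S.b i) p),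
      coeFn_toVec _ (fun j => memLp_indicator_Ico_mul (hA j p) (S.a i) (S.b i))] with θ h1 h2
    rw [h1, Pi.smul_apply, WithLp.ofLp_smul, icoGen, h2]
    ext j
    simp only [Pi.smul_apply, smul_eq_mul, ← mul_assoc]
    congr 1
    by_cases h : θ ∈ Set.Ico (S.a i) (S.b i) <;> simp [h]
  filter_upwards [ae_all_iff.2 fun i => ae_all_iff.2 fun p => h1 i p,
    coeFn_finset_sum Finset.univ fun i => ∑ p, S.w i p •
      icoGen hA (S.a i) (S.b i) p,
    ae_all_iff.2 fun i => coeFn_finset_sum Finset.univ fun p => S.w i p •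
      icoGen hA (S.a i) (S.b i) p] with θ h2 h3 h4
  rw [stepVec, h3]
  simp only [h4, h2]
  ext j
  simp only [Finset.sum_apply, Matrix.mulVec, dotProduct, StepFunction.eval, Finset.mul_sum]
  rw [Finset.sum_comm]
  exact Finset.sum_congr rfl fun p _ => Finset.sum_congr rfl fun i _ => mul_comm _ _

/-- Step functions are dense in the weighted space. -/
theorem exists_seq_stepVec_tendsto (hA : ∀ i j, MemLp (fun θ => A θ i j) 2 circ)
    (hAu : ∀ᵐ θ ∂circ, IsUnit (A θ)) (V : VecL2 T) :
    ∃ S : ℕ → StepFunction T, Tendsto (fun n => stepVec hA (S n)) atTop (𝓝 V) := by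
  let 𝒮 : Submodule ℂ (VecL2 T) :=
    { carrier := {V | ∃ S : StepFunction T, stepVec hA S = V}
      zero_mem' := ⟨⟨0, Fin.elim0, Fin.elim0, Fin.elim0, fun i => i.elim0, fun i => i.elim0,
        fun i => i.elim0⟩, by simp [stepVec]⟩
      add_mem' := by
        rintro _ _ ⟨S, rfl⟩ ⟨S', rfl⟩
        refine ⟨⟨S.n + S'.n, Fin.append S.a S'.a, Fin.append S.b S'.b, Fin.append S.w S'.w,
          fun i => ?_, fun i => ?_, fun i => ?_⟩, ?_⟩
        · refine Fin.addCases (fun i => ?_) (fun i => ?_) i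
          · simpa using S.left_le i
          · simpa using S'.left_le i
        · refine Fin.addCases (fun i => ?_) (fun i => ?_) i
          · simpa using S.lt i
          · simpa using S'.lt i
        · refine Fin.addCases (fun i => ?_) (fun i => ?_) i
          · simpa using S.lt_right i
          · simpa using S'.lt_right i
        · simp only [stepVec, Fin.sum_univ_add, Fin.append_left, Fin.append_right]
      smul_mem' := by
        rintro c _ ⟨S, rfl⟩
        refine ⟨⟨S.n, S.a, S.b, fun i p => c * S.w i p, S.left_le, S.lt, S.lt_right⟩, ?_⟩
        simp only [stepVec, Finset.smul_sum, smul_smul] }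
  have hgen : ∀ t, -Real.pi ≤ t → t < Real.pi → ∀ p, icoGen hA (-Real.pi) t p ∈ 𝒮 := by
    intro t ht ht' p
    rcases ht.eq_or_lt with h | h
    · rw [← h, icoGen_self]
      exact 𝒮.zero_mem
    · refine ⟨⟨1, fun _ => -Real.pi, fun _ => t, fun _ => Pi.single p 1, fun _ => le_rfl, fun _ => h,
        fun _ => ht'⟩, ?_⟩
      simp [stepVec, Pi.single_apply]
  have htop : 𝒮.topologicalClosure = ⊤ := by
    rw [Submodule.topologicalClosure_eq_top_iff, Submodule.eq_bot_iff]
    intro W hW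
    exact eq_zero_of_inner_icoGen hA hAu fun t ht ht' p =>
      (Submodule.mem_orthogonal _ _).1 hW _ (hgen t ht ht' p)
  have hV : V ∈ closure (𝒮 : Set (VecL2 T)) := by
    rw [← Submodule.topologicalClosure_coe, htop]
    trivial
  obtain ⟨x, hx, hlim⟩ := mem_closure_iff_seq_limit.1 hV
  choose S hS using hx
  exact ⟨S, by simpa only [hS] using hlim⟩

/-- The norm of `L₂(f)` in terms of a factor of the density. -/
theorem sqNorm_eq_eLpNorm {f : ℝ → Matrix (Fin T) (Fin T) ℂ}
    (hAf : ∀ᵐ θ ∂circ, (A θ).conjTranspose * A θ = (f θ).transpose) (g : ℝ → Fin T → ℂ) :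
    sqNorm f g = eLpNorm (fun θ =>
      (WithLp.toLp 2 ((A θ).mulVec (g θ)) : EuclideanSpace ℂ (Fin T))) 2 circ ^ 2 := by
  rw [eLpNorm_eq_lintegral_rpow_enorm_toReal two_ne_zero ENNReal.ofNat_ne_top, sqNorm,
    ← ENNReal.rpow_natCast, ← ENNReal.rpow_mul]
  simp only [ENNReal.toReal_ofNat, one_div, Nat.cast_ofNat]
  rw [inv_mul_cancel₀ two_ne_zero, ENNReal.rpow_one]
  refine lintegral_congr_ae ?_
  filter_upwards [hAf] with θ h
  have h1 : g θ ⬝ᵥ (f θ).mulVec (star (g θ)) =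
      star ((A θ).mulVec (g θ)) ⬝ᵥ (A θ).mulVec (g θ) := by
    rw [Matrix.star_mulVec, ← Matrix.dotProduct_mulVec, Matrix.mulVec_mulVec, h,
      Matrix.dotProduct_mulVec, Matrix.mulVec_transpose, dotProduct_comm]
  rw [h1, star_dotProduct_self, Complex.ofReal_re]
  have h2 := EuclideanSpace.norm_sq_eq
    (WithLp.toLp 2 ((A θ).mulVec (g θ)) : EuclideanSpace ℂ (Fin T))
  simp only at h2
  rw [← h2, ENNReal.ofReal_pow (norm_nonneg _), ofReal_norm, ← ENNReal.rpow_natCast]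
  simp

/-- The spectral integral is the continuous extension `U` of the integral of step functions. -/
theorem hasSpectralIntegral_iff {Ω : Type*} [MeasurableSpace Ω] {P : Measure Ω}
    {f : ℝ → Matrix (Fin T) (Fin T) ℂ}
    (hAf : ∀ᵐ θ ∂circ, (A θ).conjTranspose * A θ = (f θ).transpose)
    (hA : ∀ i j, MemLp (fun θ => A θ i j) 2 circ) (hAu : ∀ᵐ θ ∂circ, IsUnit (A θ))
    (U : VecL2 T →L[ℂ] Lp ℂ 2 P) {Z : ℝ → Fin T → Ω → ℂ}
    (hZ : ∀ a b : ℝ, -Real.pi ≤ a → a < b → b < Real.pi → ∀ p,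
      ∀ᵐ ω ∂P, Z b p ω - Z a p ω = U (icoGen hA a b p) ω)
    {g : ℝ → Fin T → ℂ} (hg : ∀ p, AEStronglyMeasurable (fun θ => g θ p) circ) (Y : Ω → ℂ) :
    HasSpectralIntegral P f Z g Y ↔
      ∃ V : VecL2 T, (∀ᵐ θ ∂circ, (V θ).ofLp = (A θ).mulVec (g θ)) ∧ Y =ᵐ[P] U V := by
  have hint : ∀ S : StepFunction T, (fun ω => S.integral Z ω) =ᵐ[P] U (stepVec hA S) := by
    intro S
    have h1 : U (stepVec hA S) = ∑ i, ∑ p, S.w i p •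
        U (icoGen hA (S.a i) (S.b i) p) := by
      simp only [stepVec, map_sum, map_smul]
    have hsum : ∀ {ι : Type} (s : Finset ι) (W : ι → Lp ℂ 2 P),
        ∀ᵐ ω ∂P, (∑ i ∈ s, W i : Lp ℂ 2 P) ω = ∑ i ∈ s, W i ω := by
      intro ι s W
      have := Lp.coeFn_finsetSum s W
      filter_upwards [this] with ω h
      rw [h, Finset.sum_apply]
    filter_upwards [hsum Finset.univ fun i => ∑ p, S.w i p •
        U (icoGen hA (S.a i) (S.b i) p),
      ae_all_iff.2 fun i => hsum Finset.univ fun p => S.w i p •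
        U (icoGen hA (S.a i) (S.b i) p),
      ae_all_iff.2 fun i => ae_all_iff.2 fun p => Lp.coeFn_smul (S.w i p)
        (U (icoGen hA (S.a i) (S.b i) p)),
      ae_all_iff.2 fun i => ae_all_iff.2 fun p =>
        hZ _ _ (S.left_le i) (S.lt i) (S.lt_right i) p] with ω h2 h3 h4 h5
    rw [h1, h2]
    simp only [h3, h4, Pi.smul_apply, smul_eq_mul, StepFunction.integral, h5]
  -- the distance in `L₂(f)` is the distance of representatives
  have hdist : ∀ (V : VecL2 T), (∀ᵐ θ ∂circ, (V θ).ofLp = (A θ).mulVec (g θ)) →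
      ∀ S : StepFunction T, sqNorm f (fun θ p => S.eval θ p - g θ p) =
        eLpNorm (⇑(stepVec hA S) - ⇑V) 2 circ ^ 2 := by
    intro V hV S
    rw [sqNorm_eq_eLpNorm hAf]
    congr 1
    refine eLpNorm_congr_ae ?_
    filter_upwards [hV, coeFn_stepVec hA S] with θ h1 h2
    refine WithLp.ofLp_injective 2 ?_
    rw [Pi.sub_apply, WithLp.ofLp_sub, h1, h2, ← Matrix.mulVec_sub]
    rfl
  have hsq : ∀ u : ℕ → ENNReal, Tendsto (fun n => u n ^ 2) atTop (𝓝 0) ↔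
      Tendsto u atTop (𝓝 0) := by
    intro u
    constructor
    · intro h
      have h1 := (ENNReal.continuous_rpow_const (y := (1 / 2 : ℝ))).tendsto 0 |>.comp h
      rw [ENNReal.zero_rpow_of_pos (by norm_num)] at h1
      refine h1.congr fun n => ?_
      simp only [Function.comp_apply]
      rw [← ENNReal.rpow_natCast, ← ENNReal.rpow_mul]
      simp
    · intro h
      have h1 := (ENNReal.continuous_pow 2).tendsto 0 |>.comp h
      simpa [Function.comp_def] using h1
  constructor
  · rintro ⟨-, hYm, S, hS1, hS2⟩
    -- `g` itself belongs to `L₂(f)`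
    have hAgm : ∀ i, AEStronglyMeasurable (fun θ => (A θ).mulVec (g θ) i) circ := fun i => by
      simp only [Matrix.mulVec, dotProduct]
      exact Finset.aestronglyMeasurable_fun_sum _ fun j _ => (hA i j).1.mul (hg j)
    have hmem : ∀ i, MemLp (fun θ => (A θ).mulVec (g θ) i) 2 circ := by
      obtain ⟨n, hn⟩ := (hS1.eventually (gt_mem_nhds ENNReal.zero_lt_top)).exists
      rw [sqNorm_eq_eLpNorm hAf, ENNReal.pow_lt_top_iff] at hn
      have h1 : ∀ i, MemLp (fun θ => (A θ).mulVec (fun p => (S n).eval θ p - g θ p) i) 2 circ := by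
        have hm : ∀ i, AEStronglyMeasurable
            (fun θ => (A θ).mulVec (fun p => (S n).eval θ p - g θ p) i) circ := fun i => by
          have h2 : AEStronglyMeasurable (fun θ => (A θ).mulVec ((S n).eval θ) i) circ := by
            refine (memLp_apply (stepVec hA (S n)) i).1.congr ?_
            filter_upwards [coeFn_stepVec hA (S n)] with θ h
            rw [h]
          refine (h2.sub (hAgm i)).congr (Eventually.of_forall fun θ => ?_)
          change _ = (A θ).mulVec ((S n).eval θ - g θ) i
          rw [Matrix.mulVec_sub]
          rfl
        refine memLp_piLp_iff.1 (⟨?_, by simpa using hn⟩ : MemLp (fun θ => (WithLp.toLp 2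
          ((A θ).mulVec fun p => (S n).eval θ p - g θ p) : EuclideanSpace ℂ (Fin T))) 2 circ)
        exact (PiLp.continuous_toLp 2 _).comp_aestronglyMeasurable
          (aemeasurable_pi_lambda _ fun i => (hm i).aemeasurable).aestronglyMeasurable
      intro i
      refine ((memLp_apply (stepVec hA (S n)) i).sub (h1 i)).ae_eq ?_
      filter_upwards [coeFn_stepVec hA (S n)] with θ h
      rw [Pi.sub_apply, h]
      change _ - (A θ).mulVec ((S n).eval θ - g θ) i = _
      rw [Matrix.mulVec_sub, Pi.sub_apply, sub_sub_cancel]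
    refine ⟨toVec _ hmem, coeFn_toVec _ hmem, ?_⟩
    set V := toVec _ hmem with hV
    have hlim : Tendsto (fun n => stepVec hA (S n)) atTop (𝓝 V) := by
      rw [Lp.tendsto_Lp_iff_tendsto_eLpNorm', ← hsq]
      refine hS1.congr fun n => ?_
      rw [hdist V (coeFn_toVec _ hmem)]
    have hUlim := (U.continuous.tendsto V).comp hlim
    rw [Lp.tendsto_Lp_iff_tendsto_eLpNorm'] at hUlim
    have hle : ∀ n, eLpNorm (Y - ⇑(U V)) 2 P ≤ eLpNorm (fun ω => (S n).integral Z ω - Y ω) 2 P +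
        eLpNorm (⇑(U (stepVec hA (S n))) - ⇑(U V)) 2 P := by
      intro n
      have h1 : Y - ⇑(U V) =ᵐ[P] (fun ω => -((S n).integral Z ω - Y ω)) +
          (⇑(U (stepVec hA (S n))) - ⇑(U V)) := by
        filter_upwards [hint (S n)] with ω h
        simp only [Pi.sub_apply, Pi.add_apply, h]
        ring
      have hm1 : AEStronglyMeasurable (fun ω => (S n).integral Z ω - Y ω) P :=
        ((Lp.aestronglyMeasurable _).congr (hint (S n)).symm).sub hYm
      rw [eLpNorm_congr_ae h1]
      refine (eLpNorm_add_le hm1.neg ((Lp.aestronglyMeasurable _).sub (Lp.aestronglyMeasurable _))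
        (by norm_num)).trans ?_
      rw [← eLpNorm_neg (f := fun ω => (S n).integral Z ω - Y ω)]
    have h0 : eLpNorm (Y - ⇑(U V)) 2 P = 0 := by
      refine le_antisymm ?_ bot_le
      have := hS2.add hUlim
      rw [add_zero] at this
      exact ge_of_tendsto' this hle
    rw [eLpNorm_eq_zero_iff (hYm.sub (Lp.aestronglyMeasurable _)) two_ne_zero] at h0
    filter_upwards [h0] with ω h
    exact sub_eq_zero.1 h
  · rintro ⟨V, hV, hY⟩
    obtain ⟨S, hS⟩ := exists_seq_stepVec_tendsto hA hAu V
    refine ⟨hg, (Lp.aestronglyMeasurable _).congr hY.symm, S, ?_, ?_⟩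
    · rw [Lp.tendsto_Lp_iff_tendsto_eLpNorm', ← hsq] at hS
      exact hS.congr fun n => (hdist V hV (S n)).symm
    · have hUlim := (U.continuous.tendsto V).comp hS
      rw [Lp.tendsto_Lp_iff_tendsto_eLpNorm'] at hUlim
      refine hUlim.congr fun n => eLpNorm_congr_ae ?_
      filter_upwards [hint (S n), hY] with ω h1 h2
      rw [Pi.sub_apply, Function.comp_apply, h2, ← h1]

end

/-! ### Increments and their spectral representation -/

/-- The symbol `χ_μ(e^{-iθ}) / β(iθ)` of the increments with step `μ`. -/
def symbolRatio {r : ℕ} (s d : Fin r → ℕ) (μ : Fin r → ℤ) (θ : ℝ) : ℂ :=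
  chi s d μ θ / beta s d θ

theorem aestronglyMeasurable_symbolRatio {r : ℕ} (s d : Fin r → ℕ) (μ : Fin r → ℤ) :
    AEStronglyMeasurable (symbolRatio s d μ) circ :=
  (measurable_chi_div_beta s d μ).aestronglyMeasurable

theorem ae_symbolRatio_ne_zero {r : ℕ} (s d : Fin r → ℕ) (hs : ∀ i, 0 < s i) (μ : Fin r → ℕ)
    (hμ : ∀ i, 0 < μ i) : ∀ᵐ θ ∂circ, symbolRatio s d (zstep μ) θ ≠ 0 := by
  filter_upwards [ae_chi_ne_zero s d hs (zstep μ) (fun i => by have := hμ i; simp [zstep]; omega),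
    ae_beta_ne_zero s d] with θ h1 h2
  exact div_ne_zero h1 h2

theorem memLp_symbolRatio_mul {r : ℕ} (s d : Fin r → ℕ) (hs : ∀ i, 0 < s i) (μ : Fin r → ℤ)
    {g : ℝ → ℂ} (hg : MemLp g 2 circ) : MemLp (fun θ => symbolRatio s d μ θ * g θ) 2 circ := by
  obtain ⟨c, hc⟩ := exists_norm_chi_div_beta_le s d hs μ
  refine (hg.const_mul (c : ℂ)).of_le ((aestronglyMeasurable_symbolRatio s d μ).mul hg.1)
    (Eventually.of_forall fun θ => ?_)
  rw [norm_mul, norm_mul, Complex.norm_real]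
  exact mul_le_mul_of_nonneg_right ((hc θ).trans (le_abs_self c)) (norm_nonneg _)

/-- `A` is a factor of the spectral density `f`: the function `g` of `L₂(f)` is represented by
`A g` in `VecL2`. -/
structure IsDensityFactor {T : ℕ} (f A : ℝ → Matrix (Fin T) (Fin T) ℂ) : Prop where
  memLp : ∀ i j, MemLp (fun θ => A θ i j) 2 circ
  isUnit : ∀ᵐ θ ∂circ, IsUnit (A θ)
  mul_eq : ∀ᵐ θ ∂circ, (A θ).conjTranspose * A θ = (f θ).transpose

section
variable {r T : ℕ} {s d : Fin r → ℕ} {f A : ℝ → Matrix (Fin T) (Fin T) ℂ}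

theorem sum_norm_sq_eq_conjTranspose_mul {n : ℕ} (B : Matrix (Fin n) (Fin n) ℂ) (j : Fin n) :
    ((∑ i, ‖B i j‖ ^ 2 : ℝ) : ℂ) = (B.conjTranspose * B) j j := by
  rw [← star_dotProduct_self fun i => B i j]
  rfl

open scoped ComplexOrder in
theorem exists_isDensityFactor (hint : ∀ p q, Integrable (fun θ => f θ p q) circ)
    (hpos : ∀ᵐ θ ∂circ, (f θ).PosSemidef) (hu : ∀ᵐ θ ∂circ, IsUnit (f θ)) :
    ∃ A, IsDensityFactor f A := by
  obtain ⟨A, hAm, hAf⟩ := exists_measurable_factor (fun p q => (hint p q).1) hpos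
  refine ⟨A, fun i j => ?_, ?_, hAf⟩
  · refine (memLp_two_iff_integrable_sq_norm (hAm i j)).2 ((hint j j).norm.mono'
      ((hAm i j).norm.pow 2) ?_)
    filter_upwards [hAf] with θ h
    have h1 := sum_norm_sq_eq_conjTranspose_mul (A θ) j
    rw [h, Matrix.transpose_apply] at h1
    rw [Real.norm_of_nonneg (sq_nonneg _), ← h1, Complex.norm_real]
    exact (Finset.single_le_sum (f := fun i => ‖A θ i j‖ ^ 2) (fun i _ => sq_nonneg _)
      (Finset.mem_univ i)).trans (le_abs_self _)
  · filter_upwards [hAf, hu] with θ h1 h2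
    rw [Matrix.isUnit_iff_isUnit_det] at h2 ⊢
    have h3 := congrArg Matrix.det h1
    rw [Matrix.det_mul, Matrix.det_transpose] at h3
    rw [← h3] at h2
    exact isUnit_of_mul_isUnit_right h2

theorem conjTranspose_smul_mul_smul (c : ℂ) (B : Matrix (Fin T) (Fin T) ℂ) :
    (c • B).conjTranspose * (c • B) = ((‖c‖ ^ 2 : ℝ) : ℂ) • (B.conjTranspose * B) := by
  rw [Matrix.conjTranspose_smul, Matrix.smul_mul, Matrix.mul_smul, smul_smul, Complex.star_def,
    mul_comm, Complex.mul_conj, Complex.normSq_eq_norm_sq]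

/-- `|χ|²/|β|² f` is the inverse of `invDensity`. -/
theorem IsDensityFactor.ae_inv_eq (hA : IsDensityFactor f A) (hs : ∀ i, 0 < s i) {μ : Fin r → ℕ}
    (hμ : ∀ i, 0 < μ i) : ∀ᵐ θ ∂circ,
      ((symbolRatio s d (zstep μ) θ • A θ).conjTranspose * (symbolRatio s d (zstep μ) θ • A θ))⁻¹ =
        (invDensity s d μ f θ).transpose := by
  filter_upwards [hA.mul_eq, hA.isUnit, ae_symbolRatio_ne_zero s d hs μ hμ] with θ h1 h2 h3
  have hf : IsUnit (f θ).transpose.det := by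
    rw [← h1, Matrix.det_mul, Matrix.det_conjTranspose]
    have := (Matrix.isUnit_iff_isUnit_det _).1 h2
    exact this.star.mul this
  rw [conjTranspose_smul_mul_smul, h1]
  refine Matrix.inv_eq_right_inv ?_
  rw [invDensity, Matrix.transpose_smul, Matrix.transpose_nonsing_inv, Matrix.smul_mul,
    Matrix.mul_smul, Matrix.mul_nonsing_inv _ hf, smul_smul, ← Complex.ofReal_mul]
  have h4 : ‖symbolRatio s d (zstep μ) θ‖ ^ 2 *
      (‖beta s d θ‖ ^ 2 / ‖chi s d (zstep μ) θ‖ ^ 2) = 1 := by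
    have h5 : chi s d (zstep μ) θ ≠ 0 := fun h => h3 (by simp [symbolRatio, h])
    have h6 : beta s d θ ≠ 0 := fun h => h3 (by simp [symbolRatio, h])
    have h5' := norm_ne_zero_iff.2 h5
    have h6' := norm_ne_zero_iff.2 h6
    rw [symbolRatio, norm_div]
    field_simp
  rw [h4, Complex.ofReal_one, one_smul]

theorem IsDensityFactor.isMinimalFactor (hA : IsDensityFactor f A) (hs : ∀ i, 0 < s i)
    {μ : Fin r → ℕ} (hμ : ∀ i, 0 < μ i) (hmin : IsMinimal s d μ f) :
    IsMinimalFactor fun θ => symbolRatio s d (zstep μ) θ • A θ := by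
  have hm : ∀ i j, MemLp (fun θ => (symbolRatio s d (zstep μ) θ • A θ) i j) 2 circ :=
    fun i j => memLp_symbolRatio_mul s d hs _ (hA.memLp i j)
  refine ⟨hm, fun i j => ?_, ?_⟩
  · have hm' := aestronglyMeasurable_inv (fun i j => (hm i j).1) i j
    refine (memLp_two_iff_integrable_sq_norm hm').2 (hmin.2.norm.mono' (hm'.norm.pow 2) ?_)
    filter_upwards [hA.ae_inv_eq (d := d) hs hμ] with θ h
    set B := symbolRatio s d (zstep μ) θ • A θ
    have h1 : (invDensity s d μ f θ).trace = ((∑ p, ∑ q, ‖B⁻¹ p q‖ ^ 2 : ℝ) : ℂ) := by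
      rw [← Matrix.trace_transpose, ← h, Matrix.mul_inv_rev, Matrix.trace, Complex.ofReal_sum]
      refine Finset.sum_congr rfl fun p _ => ?_
      have h2 := sum_norm_sq_eq_conjTranspose_mul (B⁻¹).conjTranspose p
      rw [Matrix.conjTranspose_conjTranspose] at h2
      rw [Matrix.diag_apply, ← Matrix.conjTranspose_nonsing_inv, ← h2]
      simp only [Matrix.conjTranspose_apply, norm_star]
    rw [Real.norm_of_nonneg (sq_nonneg _), h1, Complex.norm_real]
    refine le_trans ?_ (le_abs_self _)
    exact (Finset.single_le_sum (f := fun q => ‖B⁻¹ i q‖ ^ 2) (fun i _ => sq_nonneg _)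
      (Finset.mem_univ j)).trans (Finset.single_le_sum (f := fun p => ∑ q, ‖B⁻¹ p q‖ ^ 2)
        (fun i _ => Finset.sum_nonneg fun j _ => sq_nonneg _) (Finset.mem_univ i))
  · filter_upwards [hA.isUnit, ae_symbolRatio_ne_zero s d hs μ hμ] with θ h1 h2
    exact h1.smul (Units.mk0 _ h2)

/-- The vector representing the spectral characteristic `e^{ikθ} χ_ν(e^{-iθ})/β(iθ) δ_p` of an
increment. -/
def incGen (hA : IsDensityFactor f A) (d : Fin r → ℕ) (hs : ∀ i, 0 < s i) (ν : Fin r → ℤ) (k : ℤ)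
    (p : Fin T) : VecL2 T :=
  toVec (fun θ i => ex k θ * (symbolRatio s d ν θ * A θ i p))
    fun i => memLp_ex_mul (memLp_symbolRatio_mul s d hs ν (hA.memLp i p)) k

theorem inner_incGen (hA : IsDensityFactor f A) (hs : ∀ i, 0 < s i) (ν ν' : Fin r → ℤ) (k m : ℤ)
    (p q : Fin T) : inner ℂ (incGen hA d hs ν k p) (incGen hA d hs ν' m q) =
      ∫ θ, ex (m - k) θ * (chi s d ν' θ * chi s d ν (-θ) /
        ((‖beta s d θ‖ ^ 2 : ℝ) : ℂ)) * f θ q p ∂circ := by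
  rw [incGen, inner_toVec]
  refine integral_congr_ae ?_
  filter_upwards [coeFn_toVec _ (fun i => memLp_ex_mul
    (memLp_symbolRatio_mul s d hs ν' (hA.memLp i q)) m), hA.mul_eq] with θ h1 h2
  rw [incGen, h1, chi_neg, show m - k = -k + m by ring, ← ex_add, ← star_ex,
    ← Matrix.transpose_apply (f θ), ← h2, Matrix.mul_apply, Finset.mul_sum]
  simp only [dotProduct, Pi.star_apply, star_mul', symbolRatio, Matrix.conjTranspose_apply,
    star_div₀]
  refine Finset.sum_congr rfl fun i _ => ?_
  have h3 : ((‖beta s d θ‖ ^ 2 : ℝ) : ℂ) = beta s d θ * star (beta s d θ) := by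
    rw [Complex.star_def, Complex.mul_conj, Complex.normSq_eq_norm_sq]
  rw [h3, div_eq_mul_inv, div_eq_mul_inv, div_eq_mul_inv, mul_inv]
  ring

variable {Ω : Type*} [MeasurableSpace Ω] {P : Measure Ω} {ζ : ℤ → Ω → ℂ}

theorem gmIncrement_blocks (s d : Fin r → ℕ) (ν : Fin r → ℤ) (η : ℤ → ℂ) (m p : ℤ) :
    gmIncrement s d ν (fun j => η (j * (T : ℤ) + p)) m =
      gmIncrement (fun i => T * s i) d ν η (m * T + p) := by
  unfold gmIncrement
  refine Finset.sum_congr rfl fun l _ => ?_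
  congr 1
  change η ((m - ∑ i, ν i * (s i : ℤ) * (l i : ℤ)) * (T : ℤ) + p) = _
  congr 1
  rw [sub_mul, Finset.sum_mul, sub_add_eq_add_sub]
  congr 1
  refine Finset.sum_congr rfl fun i _ => ?_
  push_cast
  ring

theorem memLp_vecIncrement (hζ : IsPeriodicallyStationary P T s d ζ) {ν : Fin r → ℤ}
    (hν : IsStep ν) (m : ℤ) (p : Fin T) : MemLp (vecIncrement s d ν (blocks T ζ) m p) 2 P := by
  have h : vecIncrement s d ν (blocks T ζ) m p =
      fun ω => gmIncrement (fun i => T * s i) d ν (fun j => ζ j ω) (m * T + (p : ℤ)) :=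
    funext fun ω => gmIncrement_blocks s d ν (fun j => ζ j ω) m p
  rw [h]
  exact hζ.memLp ν hν _

/-- The increments as elements of `L₂(P)`. -/
def incLp (hζ : IsPeriodicallyStationary P T s d ζ) {ν : Fin r → ℤ} (hν : IsStep ν) (k : ℤ)
    (p : Fin T) : Lp ℂ 2 P := (memLp_vecIncrement hζ hν k p).toLp

theorem inner_toLp {g h : Ω → ℂ} (hg : MemLp g 2 P) (hh : MemLp h 2 P) :
    inner ℂ hg.toLp hh.toLp = ∫ ω, h ω * star (g ω) ∂P := by
  rw [L2.inner_def]
  refine integral_congr_ae ?_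
  filter_upwards [hg.coeFn_toLp, hh.coeFn_toLp] with ω h1 h2
  rw [h1, h2, RCLike.inner_apply]
  rfl

theorem inner_incLp (hζ : IsPeriodicallyStationary P T s d ζ)
    (hf : IsSpectralDensity P s d (blocks T ζ) f) (hA : IsDensityFactor f A) (hs : ∀ i, 0 < s i)
    {ν ν' : Fin r → ℤ} (hν : IsStep ν) (hν' : IsStep ν') (k m : ℤ) (p q : Fin T) :
    inner ℂ (incLp hζ hν k p) (incLp hζ hν' m q) =
      ((1 / (2 * Real.pi) : ℝ) : ℂ) *
        inner ℂ (incGen hA d hs ν k p) (incGen hA d hs ν' m q) := by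
  rw [inner_incGen, incLp, incLp, inner_toLp]
  have h := hf.structural ν' ν hν' hν q p (m - k) k
  rw [add_sub_cancel] at h
  rw [h]
  push_cast
  rfl

theorem isStep_zstep {μ : Fin r → ℕ} (hμ : ∀ i, 0 < μ i) : IsStep (zstep μ) :=
  Or.inl fun i => by simpa [zstep] using hμ i

/-- The isometry, up to the factor `1/2π`, between the spectral domain and the closed span of the
increments. The increments with the one step `μ` already span the spectral domain; the isometry is
compatible with all steps because the structural function is given for all pairs of steps. -/
theorem exists_spectral_isometry (hζ : IsPeriodicallyStationary P T s d ζ)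
    (hf : IsSpectralDensity P s d (blocks T ζ) f) (hA : IsDensityFactor f A) (hs : ∀ i, 0 < s i)
    {μ : Fin r → ℕ} (hμ : ∀ i, 0 < μ i) (hmin : IsMinimal s d μ f) :
    ∃ U : VecL2 T →L[ℂ] Lp ℂ 2 P,
      (∀ (ν : Fin r → ℤ) (hν : IsStep ν) k p, U (incGen hA d hs ν k p) = incLp hζ hν k p) ∧
      ∀ V W, inner ℂ (U V) (U W) = ((1 / (2 * Real.pi) : ℝ) : ℂ) * inner ℂ V W := by
  obtain ⟨U, h1, h2⟩ := exists_scaled_isometry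
    (ι := {ν : Fin r → ℤ // IsStep ν} × ℤ × Fin T)
    (fun i => incGen hA d hs i.1.1 i.2.1 i.2.2) (fun i => incLp hζ i.1.2 i.2.1 i.2.2)
    (1 / (2 * Real.pi)) (fun i j => inner_incLp hζ hf hA hs i.1.2 j.1.2 _ _ _ _)
    (fun v hv => eq_zero_of_inner_gen (hA.isMinimalFactor hs hμ hmin) fun k l =>
      hv ⟨⟨_, isStep_zstep hμ⟩, k, l⟩)
  exact ⟨U, fun ν hν k p => h1 ⟨⟨ν, hν⟩, k, p⟩, h2⟩

theorem inner_icoGen_density (hA : IsDensityFactor f A) {a b a' b' : ℝ} (p q : Fin T) :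
    inner ℂ (icoGen hA.memLp a b p) (icoGen hA.memLp a' b' q) =
      ∫ θ, (Set.Ico a b ∩ Set.Ico a' b').indicator (fun θ => f θ q p) θ ∂circ := by
  rw [inner_icoGen]
  refine integral_congr_ae ?_
  filter_upwards [hA.mul_eq] with θ h
  simp only [Set.indicator_apply, h, Matrix.transpose_apply]

theorem integral_indicator_circ {a b : ℝ} (ha : -Real.pi ≤ a) (hb : b ≤ Real.pi) (g : ℝ → ℂ) :
    ∫ θ, (Set.Ico a b).indicator g θ ∂circ = ∫ θ in Set.Ico a b, g θ := by
  rw [integral_indicator measurableSet_Ico, Measure.restrict_restrict measurableSet_Ico,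
    Set.Ico_inter_Ico, max_eq_left ha, min_eq_left hb]

/-- Once the increments of `Z` are the images of indicators under `U`, the spectral representation
of the increments says that `U` maps their spectral characteristics to them. -/
theorem representation_iff (hA : IsDensityFactor f A) (hs : ∀ i, 0 < s i)
    (U : VecL2 T →L[ℂ] Lp ℂ 2 P) {Z : ℝ → Fin T → Ω → ℂ}
    (hZ : ∀ a b : ℝ, -Real.pi ≤ a → a < b → b < Real.pi → ∀ p,
      ∀ᵐ ω ∂P, Z b p ω - Z a p ω = U (icoGen hA.memLp a b p) ω)
    (hζ : IsPeriodicallyStationary P T s d ζ) {ν : Fin r → ℤ} (hν : IsStep ν) (m : ℤ) (p : Fin T) :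
    HasSpectralIntegral P f Z
      (fun θ => Pi.single p (ex m θ * (chi s d ν θ / beta s d θ)))
      (vecIncrement s d ν (blocks T ζ) m p) ↔ U (incGen hA d hs ν m p) = incLp hζ hν m p := by
  have hV : ∀ᵐ θ ∂circ, (incGen hA d hs ν m p θ).ofLp =
      (A θ).mulVec (Pi.single p (ex m θ * (chi s d ν θ / beta s d θ))) := by
    filter_upwards [coeFn_toVec _ (fun i => memLp_ex_mul
      (memLp_symbolRatio_mul s d hs ν (hA.memLp i p)) m)] with θ h
    rw [incGen, h]
    ext i
    simp only [Matrix.mulVec_single, symbolRatio]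
    simp
    ring
  rw [hasSpectralIntegral_iff hA.mul_eq hA.memLp hA.isUnit U hZ]
  · constructor
    · rintro ⟨V, hV1, hV2⟩
      have h1 : V = incGen hA d hs ν m p := by
        refine ae_eq_of_ofLp ?_
        filter_upwards [hV, hV1] with θ h1 h2
        rw [h1, h2]
      rw [← h1]
      refine Lp.ext ?_
      filter_upwards [hV2, (memLp_vecIncrement hζ hν m p).coeFn_toLp] with ω h2 h3
      rw [incLp, h3, h2]
    · intro h
      refine ⟨_, hV, ?_⟩
      rw [h]
      exact (memLp_vecIncrement hζ hν m p).coeFn_toLp.symm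
  · intro q
    have hm : AEStronglyMeasurable (fun θ => ex m θ * (chi s d ν θ / beta s d θ)) circ :=
      (continuous_ex m).aestronglyMeasurable.mul (aestronglyMeasurable_symbolRatio s d ν)
    by_cases h : q = p
    · subst h
      simpa using hm
    · simp only [Pi.single_eq_of_ne h]
      exact aestronglyMeasurable_const

/-- The spectral process is obtained from the isometry. -/
theorem isSpectralProcess_of_isometry [IsProbabilityMeasure P]
    (hζ : IsPeriodicallyStationary P T s d ζ) (hA : IsDensityFactor f A) (hs : ∀ i, 0 < s i)
    {μ : Fin r → ℕ} (hμ : ∀ i, 0 < μ i) (hmin : IsMinimal s d μ f)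
    (hmean : ∀ m p, ∫ ω, vecIncrement s d (zstep μ) (blocks T ζ) m p ω ∂P = 0)
    {U : VecL2 T →L[ℂ] Lp ℂ 2 P}
    (hU : ∀ (ν : Fin r → ℤ) (hν : IsStep ν) k p, U (incGen hA d hs ν k p) = incLp hζ hν k p)
    (hU2 : ∀ V W, inner ℂ (U V) (U W) = ((1 / (2 * Real.pi) : ℝ) : ℂ) * inner ℂ V W) :
    IsSpectralProcess P s d (blocks T ζ) f
      fun t p => U (icoGen hA.memLp (-Real.pi) t p) := by
  have hinc : ∀ a b : ℝ, -Real.pi ≤ a → a < b → ∀ p, ∀ᵐ ω ∂P,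
      U (icoGen hA.memLp (-Real.pi) b p) ω - U (icoGen hA.memLp (-Real.pi) a p) ω =
        U (icoGen hA.memLp a b p) ω := by
    intro a b ha hab p
    rw [← icoGen_sub hA.memLp ha hab.le, map_sub]
    filter_upwards [Lp.coeFn_sub (U (icoGen hA.memLp (-Real.pi) b p))
      (U (icoGen hA.memLp (-Real.pi) a p))] with ω h
    rw [h, Pi.sub_apply]
  -- the constants are orthogonal to the increments with step `μ`, hence to the range of `U`
  have hmeanU : ∀ V, ∫ ω, U V ω ∂P = 0 := by
    let one : Lp ℂ 2 P := (memLp_const (1 : ℂ)).toLp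
    have hone : ∀ W : Lp ℂ 2 P, inner ℂ one W = ∫ ω, W ω ∂P := by
      intro W
      rw [L2.inner_def]
      refine integral_congr_ae ?_
      filter_upwards [(memLp_const (μ := P) (p := 2) (1 : ℂ)).coeFn_toLp] with ω h
      simp [one]
    have h0 : (innerSL ℂ one).comp U = 0 := by
      refine eq_of_total (ι := ℤ × Fin T) (fun i => incGen hA d hs (zstep μ) i.1 i.2)
        (fun v hv => eq_zero_of_inner_gen (hA.isMinimalFactor hs hμ hmin) fun k l => hv (k, l))
        fun i => ?_
      rw [ContinuousLinearMap.comp_apply, hU _ (isStep_zstep hμ), innerSL_apply_apply, hone]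
      exact (integral_congr_ae
        (memLp_vecIncrement hζ (isStep_zstep hμ) i.1 i.2).coeFn_toLp).trans (hmean _ _)
    intro V
    rw [← hone, ← innerSL_apply_apply ℂ, ← ContinuousLinearMap.comp_apply, h0]
    rfl
  have hcov : ∀ a b a' b' : ℝ, -Real.pi ≤ a → a < b → -Real.pi ≤ a' → a' < b' → ∀ p q,
      ∫ ω, (U (icoGen hA.memLp (-Real.pi) b p) ω - U (icoGen hA.memLp (-Real.pi) a p) ω) *
        star (U (icoGen hA.memLp (-Real.pi) b' q) ω - U (icoGen hA.memLp (-Real.pi) a' q) ω) ∂P =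
      1 / (2 * (Real.pi : ℂ)) *
        ∫ θ, (Set.Ico a' b' ∩ Set.Ico a b).indicator (fun θ => f θ p q) θ ∂circ := by
    intro a b a' b' ha hab ha' hab' p q
    have h1 := hU2 (icoGen hA.memLp a' b' q) (icoGen hA.memLp a b p)
    rw [inner_icoGen_density hA, L2.inner_def] at h1
    push_cast at h1
    rw [← h1]
    refine integral_congr_ae ?_
    filter_upwards [hinc a b ha hab p, hinc a' b' ha' hab' q] with ω h2 h3
    rw [h2, h3, RCLike.inner_apply]
    rfl
  refine ⟨fun a b ha hab hb p => ?_, fun a b ha hab hb p => ?_, fun a b ha hab hb p q => ?_,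
    fun a b a' b' ha hab hb ha' hb' p q => ?_, fun ν hν m p => ?_⟩
  · exact (Lp.memLp _).sub (Lp.memLp _)
  · rw [integral_congr_ae (hinc a b ha hab p), hmeanU]
  · rw [hcov a b a b ha hab ha hab, Set.inter_self, integral_indicator_circ ha hb.le]
  · rw [hcov a b a' b' ha hab (by linarith) ha']
    have : Set.Ico a' b' ∩ Set.Ico a b = ∅ := by
      ext θ
      simp only [Set.mem_inter_iff, Set.mem_Ico, Set.mem_empty_iff_false, iff_false]
      rintro ⟨⟨h1, -⟩, -, h2⟩
      linarith
    simp [this]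
  · exact (representation_iff hA hs U (fun a b ha hab _ p => hinc a b ha hab p) hζ hν m p).2
      (hU ν hν m p)

/-- The spectral process is unique: the isometry it defines on step functions is the spectral
isometry. -/
theorem IsSpectralProcess.eq_isometry (hζ : IsPeriodicallyStationary P T s d ζ)
    (hA : IsDensityFactor f A) (hs : ∀ i, 0 < s i)
    {μ : Fin r → ℕ} (hμ : ∀ i, 0 < μ i) (hmin : IsMinimal s d μ f)
    {U : VecL2 T →L[ℂ] Lp ℂ 2 P}
    (hU : ∀ (ν : Fin r → ℤ) (hν : IsStep ν) k p, U (incGen hA d hs ν k p) = incLp hζ hν k p)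
    {Z : ℝ → Fin T → Ω → ℂ} (hZ : IsSpectralProcess P s d (blocks T ζ) f Z)
    (a b : ℝ) (ha : -Real.pi ≤ a) (hab : a < b) (hb : b < Real.pi) (p : Fin T) :
    ∀ᵐ ω ∂P, Z b p ω - Z a p ω = U (icoGen hA.memLp a b p) ω := by
  have hmem : ∀ (t : Set.Ico (-Real.pi) Real.pi) (p : Fin T),
      MemLp (fun ω => Z t p ω - Z (-Real.pi) p ω) 2 P := by
    rintro ⟨t, ht, ht'⟩ p
    rcases ht.eq_or_lt with h | h
    · subst h
      simp
    · exact hZ.memLp _ _ le_rfl h ht' p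
  -- the variables `Z(t) - Z(-π)` have the Gram matrix of the indicators, and so define an isometry
  have hgram : ∀ (t u : Set.Ico (-Real.pi) Real.pi) (p q : Fin T), (t : ℝ) ≤ u →
      inner ℂ (hmem t p).toLp (hmem u q).toLp = ((1 / (2 * Real.pi) : ℝ) : ℂ) *
        inner ℂ (icoGen hA.memLp (-Real.pi) t p) (icoGen hA.memLp (-Real.pi) u q) := by
    rintro ⟨t, ht, ht'⟩ ⟨u, hu, hu'⟩ p q htu
    change t ≤ u at htu
    rw [inner_toLp, inner_icoGen_density hA, Set.inter_eq_left.2 (Set.Ico_subset_Ico_right htu)]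
    simp only
    rcases ht.eq_or_lt with h | h
    · subst h
      simp
    have h1 := hZ.structural _ _ le_rfl h ht' q p
    rw [integral_indicator_circ le_rfl ht'.le]
    push_cast
    rw [← h1]
    rcases htu.eq_or_lt with h' | h'
    · subst h'
      rfl
    have h2 := hZ.uncorrelated _ _ _ _ le_rfl h le_rfl h' hu' p q
    have hm1 := hmem ⟨t, ht, ht'⟩
    have hm2 : MemLp (fun ω => Z u q ω - Z t q ω) 2 P := hZ.memLp _ _ ht h' hu' q
    have h3 : ∫ ω, star (Z t p ω - Z (-Real.pi) p ω) * (Z u q ω - Z t q ω) ∂P = 0 := by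
      have h4 := congrArg star h2
      rw [Complex.star_def, ← integral_conj, map_zero] at h4
      rw [← h4]
      refine integral_congr_ae (Eventually.of_forall fun ω => ?_)
      simp only [map_mul, ← Complex.star_def, star_star]
    have h5 : ∀ ω, (Z u q ω - Z (-Real.pi) q ω) * star (Z t p ω - Z (-Real.pi) p ω) =
        star (Z t p ω - Z (-Real.pi) p ω) * (Z t q ω - Z (-Real.pi) q ω) +
          star (Z t p ω - Z (-Real.pi) p ω) * (Z u q ω - Z t q ω) := fun ω => by ring
    simp only [h5]
    rw [integral_add (integrable_star_mul (hm1 p) (hm1 q)) (integrable_star_mul (hm1 p) hm2), h3,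
      add_zero]
    refine integral_congr_ae (Eventually.of_forall fun ω => mul_comm _ _)
  have htot : ∀ v : VecL2 T, (∀ i : Set.Ico (-Real.pi) Real.pi × Fin T,
      inner ℂ (icoGen hA.memLp (-Real.pi) i.1 i.2) v = 0) → v = 0 := fun v hv =>
    eq_zero_of_inner_icoGen hA.memLp hA.isUnit fun t ht ht' p => hv (⟨t, ht, ht'⟩, p)
  obtain ⟨V, hV, -⟩ := exists_scaled_isometry
    (ι := Set.Ico (-Real.pi) Real.pi × Fin T)
    (fun i => icoGen hA.memLp (-Real.pi) i.1 i.2) (fun i => (hmem i.1 i.2).toLp)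
    (1 / (2 * Real.pi)) (fun i j => by
      rcases le_total (i.1 : ℝ) j.1 with h | h
      · exact hgram _ _ _ _ h
      · rw [← inner_conj_symm, hgram _ _ _ _ h, map_mul, inner_conj_symm, Complex.conj_ofReal])
    htot
  have hZV : ∀ a b : ℝ, -Real.pi ≤ a → a < b → b < Real.pi → ∀ p,
      ∀ᵐ ω ∂P, Z b p ω - Z a p ω = V (icoGen hA.memLp a b p) ω := by
    intro a b ha hab hb p
    have ha' : a < Real.pi := hab.trans hb
    have hb' : -Real.pi ≤ b := ha.trans hab.le
    rw [← icoGen_sub hA.memLp ha hab.le, map_sub]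
    have h1 := hV (⟨b, hb', hb⟩, p)
    have h2 := hV (⟨a, ha, ha'⟩, p)
    simp only at h1 h2
    rw [h1, h2]
    filter_upwards [Lp.coeFn_sub (hmem ⟨b, hb', hb⟩ p).toLp (hmem ⟨a, ha, ha'⟩ p).toLp,
      (hmem ⟨b, hb', hb⟩ p).coeFn_toLp, (hmem ⟨a, ha, ha'⟩ p).coeFn_toLp] with ω h3 h4 h5
    rw [h3, Pi.sub_apply, h4, h5]
    ring
  -- both isometries map the spectral characteristics of the increments to the increments
  have hUV : U = V := by
    refine eq_of_total (ι := ℤ × Fin T) (fun i => incGen hA d hs (zstep μ) i.1 i.2)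
      (fun v hv => eq_zero_of_inner_gen (hA.isMinimalFactor hs hμ hmin) fun k l => hv (k, l))
      fun i => ?_
    rw [hU _ (isStep_zstep hμ)]
    exact ((representation_iff hA hs V hZV hζ (isStep_zstep hμ) _ _).1
      (hZ.representation _ (isStep_zstep hμ) _ _)).symm
  rw [hUV]
  exact hZV a b ha hab hb p

end

/-! ### The increment operator and its inverse -/

section
variable {r : ℕ} {s d μ : Fin r → ℕ}

/-- `e_γ` as a sum over the multi-indices of the GM increment. -/
theorem eCoeff_eq_sum (s d μ : Fin r → ℕ) (k : ℕ) : eCoeff s d μ k =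
    ∑ l ∈ Fintype.piFinset (fun i => Finset.range (d i + 1)),
      if k = ∑ i, μ i * s i * l i then ∏ i, (-1 : ℂ) ^ l i * ((d i).choose (l i) : ℂ) else 0 := by
  have h1 : ∀ i, (1 - (Polynomial.X : Polynomial ℂ) ^ (μ i * s i)) ^ d i =
      ∑ l ∈ Finset.range (d i + 1), Polynomial.C ((-1 : ℂ) ^ l * ((d i).choose l : ℂ)) *
        Polynomial.X ^ (μ i * s i * l) := by
    intro i
    rw [sub_eq_neg_add, add_pow]
    refine Finset.sum_congr rfl fun l _ => ?_
    rw [one_pow, mul_one, neg_pow, ← pow_mul, Polynomial.C_mul, Polynomial.C_pow, Polynomial.C_neg,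
      Polynomial.C_1, Polynomial.C_eq_natCast]
    ring
  simp only [eCoeff, h1]
  rw [Finset.prod_univ_sum, Polynomial.finsetSum_coeff]
  refine Finset.sum_congr rfl fun l _ => ?_
  rw [Finset.prod_mul_distrib, ← map_prod, Finset.prod_pow_eq_pow_sum, Polynomial.coeff_C_mul_X_pow]

theorem sum_le_nGamma {l : Fin r → ℕ}
    (hl : l ∈ Fintype.piFinset (fun i => Finset.range (d i + 1))) :
    ∑ i, μ i * s i * l i ≤ nGamma s d μ :=
  Finset.sum_le_sum fun i _ => Nat.mul_le_mul_left _
    (Nat.lt_succ_iff.1 (Finset.mem_range.1 (Fintype.mem_piFinset.1 hl i)))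

theorem eCoeff_eq_zero_of_lt {k : ℕ} (hk : nGamma s d μ < k) : eCoeff s d μ k = 0 := by
  rw [eCoeff_eq_sum]
  refine Finset.sum_eq_zero fun l hl => if_neg ?_
  have := sum_le_nGamma (s := s) (μ := μ) hl
  omega

theorem eCoeff_zero (hs : ∀ i, 0 < s i) (hμ : ∀ i, 0 < μ i) : eCoeff s d μ 0 = 1 := by
  rw [eCoeff, Polynomial.coeff_zero_eq_eval_zero, Polynomial.eval_prod]
  refine Finset.prod_eq_one fun i _ => ?_
  have : μ i * s i ≠ 0 := (Nat.mul_pos (hμ i) (hs i)).ne'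
  simp [this]

theorem gmIncrement_eq_sum_eCoeff (s d μ : Fin r → ℕ) (η : ℤ → ℂ) (m : ℤ) :
    gmIncrement s d (zstep μ) η m =
      ∑ j ∈ Finset.range (nGamma s d μ + 1), eCoeff s d μ j * η (m - j) := by
  simp only [eCoeff_eq_sum, Finset.sum_mul]
  rw [Finset.sum_comm, gmIncrement]
  refine Finset.sum_congr rfl fun l hl => ?_
  simp only [ite_mul, zero_mul, Finset.sum_ite_eq', Finset.mem_range]
  rw [if_pos (Nat.lt_succ_of_le (sum_le_nGamma hl))]
  simp [zstep]

/-- The generating functions of `d_μ` and `e_γ` are inverse to each other. -/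
theorem sum_dCoeff_mul_eCoeff (hs : ∀ i, 0 < s i) (hμ : ∀ i, 0 < μ i) (n : ℕ) :
    ∑ x ∈ Finset.HasAntidiagonal.antidiagonal n, dCoeff s d μ x.1 * eCoeff s d μ x.2 =
      if n = 0 then 1 else 0 := by
  have h1 : ∀ a : ℕ, 0 < a → (PowerSeries.mk (fun n => if a ∣ n then (1 : ℂ) else 0)) *
      (1 - PowerSeries.X ^ a) = 1 := by
    intro a ha
    ext n
    rw [mul_sub, mul_one, map_sub, PowerSeries.coeff_mk, PowerSeries.coeff_mul_X_pow',
      PowerSeries.coeff_one]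
    simp only [PowerSeries.coeff_mk]
    rcases lt_or_ge n a with h | h
    · rw [if_neg (not_le.2 h), sub_zero]
      by_cases h0 : n = 0
      · simp [h0]
      · rw [if_neg h0, if_neg fun hd => absurd (Nat.le_of_dvd (by omega) hd) (by omega)]
    · rw [if_pos h, if_neg (by omega : n ≠ 0)]
      have : a ∣ n - a ↔ a ∣ n := (Nat.dvd_sub_iff_left h dvd_rfl)
      simp [this]
  have h2 : ((∏ i, (1 - (Polynomial.X : Polynomial ℂ) ^ (μ i * s i)) ^ d i : Polynomial ℂ) :
      PowerSeries ℂ) = ∏ i, (1 - (PowerSeries.X : PowerSeries ℂ) ^ (μ i * s i)) ^ d i := by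
    rw [← Polynomial.coeToPowerSeries.ringHom_apply, map_prod]
    simp
  have h3 : (∏ i, (PowerSeries.mk (fun n => if μ i * s i ∣ n then (1 : ℂ) else 0)) ^ d i) *
      ((∏ i, (1 - (Polynomial.X : Polynomial ℂ) ^ (μ i * s i)) ^ d i : Polynomial ℂ) :
      PowerSeries ℂ) = 1 := by
    rw [h2, ← Finset.prod_mul_distrib]
    refine Finset.prod_eq_one fun i _ => ?_
    rw [← mul_pow, h1 _ (Nat.mul_pos (hμ i) (hs i)), one_pow]
  have h4 := congrArg (PowerSeries.coeff n) h3
  rw [PowerSeries.coeff_mul, PowerSeries.coeff_one] at h4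
  rw [← h4]
  refine Finset.sum_congr rfl fun x _ => ?_
  rw [Polynomial.coeff_coe]
  rfl

/-- The coefficients of `η` in `∑_k b(k) χη(k)`. -/
theorem sum_mul_gmIncrement (s d μ : Fin r → ℕ) (N : ℕ) (b : ℕ → ℂ) (η : ℤ → ℂ) :
    ∑ k ∈ Finset.range (N + 1), b k * gmIncrement s d (zstep μ) η (k : ℤ) =
      ∑ t ∈ Finset.Icc (-(nGamma s d μ : ℤ)) N,
        (∑ k ∈ (Finset.range (N + 1)).filter (fun k : ℕ => t ≤ k),
          eCoeff s d μ ((k : ℤ) - t).toNat * b k) * η t := by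
  have h1 : ∀ k ∈ Finset.range (N + 1), b k * gmIncrement s d (zstep μ) η (k : ℤ) =
      ∑ t ∈ Finset.Icc (-(nGamma s d μ : ℤ)) N,
        if t ≤ k then eCoeff s d μ ((k : ℤ) - t).toNat * b k * η t else 0 := by
    intro k hk
    have hk' := Finset.mem_range.1 hk
    rw [gmIncrement_eq_sum_eCoeff, Finset.mul_sum]
    have h2 : ∀ j ∈ Finset.range (nGamma s d μ + 1), b k * (eCoeff s d μ j * η ((k : ℤ) - j)) =
        (fun t : ℤ => eCoeff s d μ ((k : ℤ) - t).toNat * b k * η t) ((k : ℤ) - j) := by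
      intro j _
      simp only [sub_sub_cancel, Int.toNat_natCast]
      ring
    rw [Finset.sum_congr rfl h2, ← Finset.sum_image (s := Finset.range (nGamma s d μ + 1))
      (g := fun j : ℕ => (k : ℤ) - j) (f := fun t : ℤ => eCoeff s d μ ((k : ℤ) - t).toNat * b k * η t)
      (fun i _ j _ h => by simpa using h), ← Finset.sum_filter]
    refine Finset.sum_subset (fun t ht => ?_) fun t ht ht' => ?_
    · obtain ⟨j, hj, rfl⟩ := Finset.mem_image.1 ht
      have := Finset.mem_range.1 hj
      rw [Finset.mem_filter, Finset.mem_Icc]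
      omega
    · rw [Finset.mem_filter, Finset.mem_Icc] at ht
      rw [eCoeff_eq_zero_of_lt, zero_mul, zero_mul]
      by_contra hcon
      exact ht' (Finset.mem_image.2 ⟨((k : ℤ) - t).toNat, Finset.mem_range.2 (by omega), by omega⟩)
  rw [Finset.sum_congr rfl h1, Finset.sum_comm]
  refine Finset.sum_congr rfl fun t _ => ?_
  rw [← Finset.sum_filter, Finset.sum_mul]

theorem sum_eCoeff_mul_dCoeff (hs : ∀ i, 0 < s i) (hμ : ∀ i, 0 < μ i) (N : ℕ) (α : ℕ → ℂ) (t : ℕ)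
    (ht : t ≤ N) :
    ∑ k ∈ (Finset.range (N + 1)).filter (fun k : ℕ => (t : ℤ) ≤ k),
      eCoeff s d μ ((k : ℤ) - (t : ℤ)).toNat * ∑ m ∈ Finset.Icc k N, dCoeff s d μ (m - k) * α m =
      α t := by
  have h1 : ∀ m ∈ Finset.Icc t N, ∑ k ∈ Finset.Icc t m, eCoeff s d μ (k - t) * dCoeff s d μ (m - k) =
      if m = t then 1 else 0 := by
    intro m hm
    rw [Finset.mem_Icc] at hm
    obtain ⟨n, rfl⟩ := Nat.exists_eq_add_of_le hm.1
    have h2 := sum_dCoeff_mul_eCoeff (d := d) hs hμ n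
    rw [Finset.Nat.sum_antidiagonal_eq_sum_range_succ_mk, Nat.succ_eq_add_one] at h2
    rw [if_congr (by omega : t + n = t ↔ n = 0) rfl rfl, ← h2]
    refine Finset.sum_bij' (fun k _ => t + n - k) (fun j _ => t + n - j) ?_ ?_ ?_ ?_ ?_
    · intro k hk; simp only [Finset.mem_Icc, Finset.mem_range] at hk ⊢; omega
    · intro k hk; simp only [Finset.mem_Icc, Finset.mem_range] at hk ⊢; omega
    · intro k hk; simp only [Finset.mem_Icc] at hk; omega
    · intro k hk; simp only [Finset.mem_range] at hk; omega
    · intro k hk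
      simp only [Finset.mem_Icc] at hk
      rw [mul_comm, show n - (t + n - k) = k - t by omega]
  have h3 : (Finset.range (N + 1)).filter (fun k : ℕ => (t : ℤ) ≤ k) = Finset.Icc t N := by
    ext k
    simp only [Finset.mem_filter, Finset.mem_range, Finset.mem_Icc, Nat.cast_le]
    omega
  rw [h3]
  simp only [Finset.mul_sum]
  have h4 : ∑ k ∈ Finset.Icc t N, ∑ m ∈ Finset.Icc k N,
      eCoeff s d μ ((k : ℤ) - (t : ℤ)).toNat * (dCoeff s d μ (m - k) * α m) =
      ∑ m ∈ Finset.Icc t N, ∑ k ∈ Finset.Icc t m,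
        eCoeff s d μ (k - t) * dCoeff s d μ (m - k) * α m := by
    rw [Finset.sum_sigma', Finset.sum_sigma']
    refine Finset.sum_bij' (fun x _ => ⟨x.2, x.1⟩) (fun x _ => ⟨x.2, x.1⟩) ?_ ?_ ?_ ?_ ?_
    · intro x hx; simp only [Finset.mem_sigma, Finset.mem_Icc] at hx ⊢; omega
    · intro x hx; simp only [Finset.mem_sigma, Finset.mem_Icc] at hx ⊢; omega
    · intro x _; rfl
    · intro x _; rfl
    · intro x _
      have h6 : ((x.1 : ℤ) - (t : ℤ)).toNat = x.1 - t := by omega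
      dsimp only
      rw [h6, mul_assoc]
  rw [h4]
  have h5 : ∀ m ∈ Finset.Icc t N, ∑ k ∈ Finset.Icc t m,
      eCoeff s d μ (k - t) * dCoeff s d μ (m - k) * α m = (if m = t then α m else 0) := by
    intro m hm
    rw [← Finset.sum_mul, h1 m hm, ite_mul, one_mul, zero_mul]
  rw [Finset.sum_congr rfl h5, Finset.sum_ite_eq', if_pos (Finset.mem_Icc.2 ⟨le_rfl, ht⟩)]

/-- Summation by parts: a linear form in `η(0), …, η(N)` is a linear form in increments minus
initial values. -/
theorem sum_mul_gmIncrement_inverse (hs : ∀ i, 0 < s i) (hμ : ∀ i, 0 < μ i) (N : ℕ)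
    (α b : ℕ → ℂ) (hb : ∀ k, b k = ∑ m ∈ Finset.Icc k N, dCoeff s d μ (m - k) * α m) (η : ℤ → ℂ) :
    ∑ k ∈ Finset.range (N + 1), b k * gmIncrement s d (zstep μ) η (k : ℤ) =
      ∑ k ∈ Finset.range (N + 1), α k * η (k : ℤ) +
        ∑ k ∈ Finset.Icc (-(nGamma s d μ : ℤ)) (-1),
          (∑ l ∈ Finset.range (min N (k + (nGamma s d μ : ℤ)).toNat + 1),
            eCoeff s d μ ((l : ℤ) - k).toNat * b l) * η k := by
  rw [sum_mul_gmIncrement]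
  have h1 : Finset.Icc (-(nGamma s d μ : ℤ)) N =
      Finset.Icc (-(nGamma s d μ : ℤ)) (-1) ∪ (Finset.range (N + 1)).map Nat.castEmbedding := by
    ext t
    simp only [Finset.mem_union, Finset.mem_Icc, Finset.mem_map, Finset.mem_range,
      Nat.castEmbedding_apply]
    constructor
    · intro h
      rcases lt_or_ge t 0 with h0 | h0
      · left; omega
      · right; exact ⟨t.toNat, by omega, by omega⟩
    · rintro (h | ⟨k, h, rfl⟩) <;> omega
  rw [h1, Finset.sum_union, Finset.sum_map, add_comm]
  · congr 1
    · refine Finset.sum_congr rfl fun t ht => ?_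
      have ht' := Finset.mem_range.1 ht
      simp only [Nat.castEmbedding_apply, hb]
      rw [sum_eCoeff_mul_dCoeff hs hμ N α t (by omega)]
    · refine Finset.sum_congr rfl fun t ht => ?_
      rw [Finset.mem_Icc] at ht
      congr 1
      symm
      refine Finset.sum_subset (fun l hl => ?_) fun l hl hl' => ?_
      · simp only [Finset.mem_range, Finset.mem_filter] at hl ⊢
        omega
      · simp only [Finset.mem_range, Finset.mem_filter] at hl hl'
        rw [eCoeff_eq_zero_of_lt (by omega), zero_mul]
  · rw [Finset.disjoint_left]
    intro t ht ht'
    obtain ⟨k, -, rfl⟩ := Finset.mem_map.1 ht'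
    rw [Finset.mem_Icc] at ht
    simp only [Nat.castEmbedding_apply] at ht
    omega

theorem sum_range_mul_eq {β : Type*} [AddCommMonoid β] (T n : ℕ) (g : ℕ → β) :
    ∑ j ∈ Finset.range (n * T), g j = ∑ k ∈ Finset.range n, ∑ p : Fin T, g (k * T + p) := by
  induction n with
  | zero => simp
  | succ n ih => rw [Nat.succ_mul, Finset.sum_range_add, ih, Finset.sum_range_succ, Finset.sum_range
      (fun x => g (n * T + x))]

/-- `A_M ζ = A_N ξ`. -/
theorem sum_eq_sum_vecCoeff {T : ℕ} (hT : 0 < T) (a : ℕ → ℂ) (M : ℕ) (η : ℤ → ℂ) :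
    ∑ k ∈ Finset.range (M + 1), a k * η (k : ℤ) =
      ∑ k ∈ Finset.range (M / T + 1), ∑ p : Fin T,
        vecCoeff T a M k p * η ((k : ℤ) * T + (p : ℤ)) := by
  have h1 := sum_range_mul_eq T (M / T + 1) fun j => if j ≤ M then a j * η (j : ℤ) else 0
  have h2 : ∀ (k : ℕ) (p : Fin T), vecCoeff T a M k p * η ((k : ℤ) * T + (p : ℤ)) =
      if k * T + (p : ℕ) ≤ M then a (k * T + p) * η ((k * T + p : ℕ) : ℤ) else 0 := by
    intro k p
    rw [vecCoeff]
    push_cast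
    split_ifs <;> simp
  simp only [h2]
  rw [← h1, ← Finset.sum_filter]
  congr 1
  ext j
  simp only [Finset.mem_range, Finset.mem_filter]
  have h3 : M < (M / T + 1) * T := by
    have := Nat.lt_div_mul_add hT (a := M)
    rw [Nat.succ_mul]
    omega
  omega

/-- `A_M ζ = B_N χ ξ - V_N ξ`. -/
theorem sum_eq_sum_bCoeff_sub {T : ℕ} (hT : 0 < T) (hs : ∀ i, 0 < s i) (hμ : ∀ i, 0 < μ i)
    (a : ℕ → ℂ) (M : ℕ) (η : ℤ → ℂ) :
    ∑ k ∈ Finset.range (M + 1), a k * η (k : ℤ) =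
      ∑ k ∈ Finset.range (M / T + 1), ∑ p : Fin T, bCoeff T s d μ a M k p *
        gmIncrement s d (zstep μ) (fun j => η (j * (T : ℤ) + (p : ℤ))) (k : ℤ) -
      ∑ k ∈ Finset.Icc (-(nGamma s d μ : ℤ)) (-1), ∑ p : Fin T,
        vCoeff T s d μ a M k p * η (k * (T : ℤ) + (p : ℤ)) := by
  rw [sum_eq_sum_vecCoeff hT, eq_sub_iff_add_eq, Finset.sum_comm,
    Finset.sum_comm (s := Finset.Icc _ _), ← Finset.sum_add_distrib, Finset.sum_comm]
  refine Finset.sum_congr rfl fun p _ => ?_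
  exact (sum_mul_gmIncrement_inverse hs hμ (M / T) (fun m => vecCoeff T a M m p)
    (fun k => bCoeff T s d μ a M k p) (fun k => rfl) fun j => η (j * (T : ℤ) + (p : ℤ))).symm

/-! ### Elementary estimates -/

/-- The operator on coefficient sequences dual to the increment operator: `∑ b(j) χη(j)` is the
linear form in `η` with coefficients `incCoeff b`. -/
def incCoeff (s d μ : Fin r → ℕ) : (ℤ →₀ ℂ) →ₗ[ℂ] (ℤ →₀ ℂ) :=
  Finsupp.linearCombination ℂ fun j : ℤ =>
    ∑ i ∈ Finset.range (nGamma s d μ + 1), Finsupp.single (j - (i : ℤ)) (eCoeff s d μ i)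

theorem linearCombination_incCoeff (η : ℤ → ℂ) (b : ℤ →₀ ℂ) :
    Finsupp.linearCombination ℂ η (incCoeff s d μ b) =
      Finsupp.linearCombination ℂ (gmIncrement s d (zstep μ) η) b := by
  induction b using Finsupp.induction_linear with
  | zero => simp
  | add f g hf hg => simp only [map_add, hf, hg]
  | single j y =>
    rw [incCoeff, Finsupp.linearCombination_single, Finsupp.linearCombination_single, map_smul,
      map_sum, gmIncrement_eq_sum_eCoeff]
    simp [Finsupp.linearCombination_single]

theorem incCoeff_mem_supported {n : ℤ} {b : ℤ →₀ ℂ} (hb : b ∈ Finsupp.supported ℂ ℂ (Set.Iic n)) :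
    incCoeff s d μ b ∈ Finsupp.supported ℂ ℂ (Set.Iic n) := by
  rw [incCoeff, Finsupp.linearCombination_apply]
  refine Submodule.sum_mem _ fun j hj => Submodule.smul_mem _ _ (Submodule.sum_mem _ fun i _ =>
    Finsupp.single_mem_supported ℂ _ ?_)
  have := (Finsupp.mem_supported _ _).1 hb hj
  simp only [Set.mem_Iic] at this ⊢
  omega

theorem incCoeff_apply_eq (hs : ∀ i, 0 < s i) (hμ : ∀ i, 0 < μ i) {n : ℤ} {b : ℤ →₀ ℂ}
    (hb : b ∈ Finsupp.supported ℂ ℂ (Set.Iic n)) : incCoeff s d μ b n = b n := by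
  rw [incCoeff, Finsupp.linearCombination_apply, Finsupp.sum, Finsupp.finsetSum_apply]
  have h1 : ∀ j ∈ b.support, (b j • ∑ i ∈ Finset.range (nGamma s d μ + 1),
      Finsupp.single (j - (i : ℤ)) (eCoeff s d μ i)) n = if j = n then b j else 0 := by
    intro j hj
    have hj' : j ≤ n := (Finsupp.mem_supported _ _).1 hb hj
    rw [Finsupp.smul_apply, Finsupp.finsetSum_apply, Finset.sum_range_succ', Finset.sum_eq_zero]
    · rw [Finsupp.single_apply, eCoeff_zero hs hμ]
      simp
    · intro i _
      rw [Finsupp.single_apply, if_neg]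
      push_cast
      omega
  rw [Finset.sum_congr rfl h1, Finset.sum_ite_eq']
  split_ifs with h
  · rfl
  · exact (Finsupp.notMem_support_iff.1 h).symm

/-- The dual increment operator is triangular with unit diagonal, so it reflects supports. -/
theorem mem_supported_of_incCoeff (hs : ∀ i, 0 < s i) (hμ : ∀ i, 0 < μ i) {n : ℤ} {b : ℤ →₀ ℂ}
    (hb : incCoeff s d μ b ∈ Finsupp.supported ℂ ℂ (Set.Iic n)) :
    b ∈ Finsupp.supported ℂ ℂ (Set.Iic n) := by
  rw [Finsupp.mem_supported]
  intro j hj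
  by_contra hjn
  have hne : b.support.Nonempty := ⟨j, hj⟩
  set j0 := b.support.max' hne
  have h1 : b ∈ Finsupp.supported ℂ ℂ (Set.Iic j0) := (Finsupp.mem_supported _ _).2 fun i hi =>
    Finset.le_max' _ _ hi
  have h2 := incCoeff_apply_eq hs hμ (d := d) h1
  have h3 : b j0 ≠ 0 := Finsupp.mem_support_iff.1 (Finset.max'_mem _ hne)
  rw [← h2] at h3
  have h4 : j0 ≤ n := (Finsupp.mem_supported _ _).1 hb (Finsupp.mem_support_iff.2 h3)
  exact hjn ((Finset.le_max' _ _ hj).trans h4)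

/-- The elementary estimates are the forms `A_M ζ - B_N χ ξ - ∑_{j ≤ -1} δ(j) χζ(j)`: the
coefficients of the increments at nonnegative times are forced. -/
theorem isElementaryEstimate_iff {T : ℕ} (hT : 0 < T) (hs : ∀ i, 0 < s i) (hμ : ∀ i, 0 < μ i)
    (a : ℕ → ℂ) (M : ℕ) (u : ℤ →₀ ℂ) : IsElementaryEstimate T s d μ a M u ↔
      ∃ δ : ℤ →₀ ℂ, (∀ j ∈ δ.support, j ≤ -1) ∧ ∀ η : ℤ → ℂ,
        ∑ k ∈ Finset.range (M + 1), a k * η (k : ℤ) - u.sum (fun k x => x * η k) =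
          ∑ k ∈ Finset.range (M / T + 1), ∑ p : Fin T, bCoeff T s d μ a M k p *
            gmIncrement s d (zstep μ) (fun j => η (j * (T : ℤ) + (p : ℤ))) (k : ℤ) +
          δ.sum (fun j y => y * gmIncrement (fun i => T * s i) d (zstep μ) η j) := by
  have hTs : ∀ i, 0 < T * s i := fun i => Nat.mul_pos hT (hs i)
  -- the coefficient sequence of the increments in `B_N χ ξ`, and that of the initial values
  set b0 : ℤ →₀ ℂ := ∑ k ∈ Finset.range (M / T + 1), ∑ p : Fin T,
    Finsupp.single ((k : ℤ) * T + (p : ℤ)) (bCoeff T s d μ a M k p) with hb0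
  set v0 : ℤ →₀ ℂ := ∑ k ∈ Finset.Icc (-(nGamma s d μ : ℤ)) (-1), ∑ p : Fin T,
    Finsupp.single (k * (T : ℤ) + (p : ℤ)) (vCoeff T s d μ a M k p) with hv0
  have hb0' : ∀ η : ℤ → ℂ, Finsupp.linearCombination ℂ
      (gmIncrement (fun i => T * s i) d (zstep μ) η) b0 =
      ∑ k ∈ Finset.range (M / T + 1), ∑ p : Fin T, bCoeff T s d μ a M k p *
        gmIncrement s d (zstep μ) (fun j => η (j * (T : ℤ) + (p : ℤ))) (k : ℤ) := by
    intro η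
    simp only [hb0, map_sum, Finsupp.linearCombination_single, smul_eq_mul, gmIncrement_blocks]
  have hv0' : ∀ η : ℤ → ℂ, Finsupp.linearCombination ℂ η v0 =
      ∑ k ∈ Finset.Icc (-(nGamma s d μ : ℤ)) (-1), ∑ p : Fin T,
        vCoeff T s d μ a M k p * η (k * (T : ℤ) + (p : ℤ)) := by
    intro η
    simp only [hv0, map_sum, Finsupp.linearCombination_single, smul_eq_mul]
  have hv0s : v0 ∈ Finsupp.supported ℂ ℂ (Set.Iic (-1)) := by
    refine Submodule.sum_mem _ fun k hk => Submodule.sum_mem _ fun p _ =>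
      Finsupp.single_mem_supported ℂ _ ?_
    rw [Finset.mem_Icc] at hk
    have hp := p.2
    have : k * (T : ℤ) ≤ -1 * (T : ℤ) := mul_le_mul_of_nonneg_right hk.2 (by positivity)
    simp only [Set.mem_Iic]
    omega
  have hmain : ∀ η : ℤ → ℂ, ∑ k ∈ Finset.range (M + 1), a k * η (k : ℤ) =
      Finsupp.linearCombination ℂ (gmIncrement (fun i => T * s i) d (zstep μ) η) b0 -
        Finsupp.linearCombination ℂ η v0 := fun η => by
    rw [hb0', hv0', sum_eq_sum_bCoeff_sub hT hs hμ]
  -- a form that vanishes identically in `η` has zero coefficients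
  have hext : ∀ x y : ℤ →₀ ℂ, (∀ η : ℤ → ℂ, Finsupp.linearCombination ℂ η x =
      Finsupp.linearCombination ℂ η y) → x = y := by
    intro x y h
    ext j
    have := h (Pi.single j 1)
    have h2 : ∀ x : ℤ →₀ ℂ, Finsupp.linearCombination ℂ (Pi.single j (1 : ℂ)) x = x j := by
      intro x
      rw [Finsupp.linearCombination_apply, Finsupp.sum, Finset.sum_eq_single j]
      · simp
      · intro i _ hi
        simp [hi]
      · intro hj
        simp [Finsupp.notMem_support_iff.1 hj]
    rwa [h2, h2] at this
  constructor
  · rintro ⟨hu, b, hb⟩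
    have hu' : u ∈ Finsupp.supported ℂ ℂ (Set.Iic (-1)) := (Finsupp.mem_supported _ _).2 hu
    have h1 : incCoeff (fun i => T * s i) d μ (b - b0) = -(v0 + u) := by
      refine hext _ _ fun η => ?_
      have h2 := hb η
      rw [hmain] at h2
      rw [linearCombination_incCoeff]
      simp only [map_sub, map_neg, map_add]
      change _ - _ - Finsupp.linearCombination ℂ η u = Finsupp.linearCombination ℂ _ b at h2
      rw [← h2]
      ring
    have h3 : b - b0 ∈ Finsupp.supported ℂ ℂ (Set.Iic (-1)) :=
      mem_supported_of_incCoeff hTs hμ (h1 ▸ Submodule.neg_mem _ (Submodule.add_mem _ hv0s hu'))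
    refine ⟨b - b0, fun j hj => (Finsupp.mem_supported _ _).1 h3 hj, fun η => ?_⟩
    rw [hb, ← hb0']
    change Finsupp.linearCombination ℂ _ b = _ + Finsupp.linearCombination ℂ _ (b - b0)
    rw [map_sub]
    ring
  · rintro ⟨δ, hδ, h⟩
    have hδ' : δ ∈ Finsupp.supported ℂ ℂ (Set.Iic (-1)) := (Finsupp.mem_supported _ _).2 hδ
    have h1 : u = -(v0 + incCoeff (fun i => T * s i) d μ δ) := by
      refine hext _ _ fun η => ?_
      have h2 := h η
      rw [hmain, ← hb0'] at h2
      simp only [map_neg, map_add, linearCombination_incCoeff]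
      change _ - _ - Finsupp.linearCombination ℂ η u =
        _ + Finsupp.linearCombination ℂ (gmIncrement (fun i => T * s i) d (zstep μ) η) δ at h2
      linear_combination -h2
    refine ⟨fun k hk => ?_, b0 + δ, fun η => ?_⟩
    · have h2 : u ∈ Finsupp.supported ℂ ℂ (Set.Iic (-1)) := h1 ▸ Submodule.neg_mem _
        (Submodule.add_mem _ hv0s (incCoeff_mem_supported hδ'))
      exact (Finsupp.mem_supported _ _).1 h2 hk
    · rw [h η, ← hb0']
      change _ + Finsupp.linearCombination ℂ _ δ = Finsupp.linearCombination ℂ _ (b0 + δ)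
      rw [map_add]

/-- Every finite combination of past increments is the correction in an elementary estimate. -/
theorem exists_isElementaryEstimate {T : ℕ} (hT : 0 < T) (hs : ∀ i, 0 < s i) (hμ : ∀ i, 0 < μ i)
    (a : ℕ → ℂ) (M : ℕ) (δ : ℤ →₀ ℂ) (hδ : ∀ j ∈ δ.support, j ≤ -1) :
    ∃ u, IsElementaryEstimate T s d μ a M u ∧ ∀ η : ℤ → ℂ,
        ∑ k ∈ Finset.range (M + 1), a k * η (k : ℤ) - u.sum (fun k x => x * η k) =
          ∑ k ∈ Finset.range (M / T + 1), ∑ p : Fin T, bCoeff T s d μ a M k p *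
            gmIncrement s d (zstep μ) (fun j => η (j * (T : ℤ) + (p : ℤ))) (k : ℤ) +
          δ.sum (fun j y => y * gmIncrement (fun i => T * s i) d (zstep μ) η j) := by
  refine ⟨-(∑ k ∈ Finset.Icc (-(nGamma s d μ : ℤ)) (-1), ∑ p : Fin T,
    Finsupp.single (k * (T : ℤ) + (p : ℤ)) (vCoeff T s d μ a M k p) +
      incCoeff (fun i => T * s i) d μ δ), ?_⟩
  rw [isElementaryEstimate_iff hT hs hμ]
  have h : ∀ η : ℤ → ℂ,
        ∑ k ∈ Finset.range (M + 1), a k * η (k : ℤ) -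
          (-(∑ k ∈ Finset.Icc (-(nGamma s d μ : ℤ)) (-1), ∑ p : Fin T,
    Finsupp.single (k * (T : ℤ) + (p : ℤ)) (vCoeff T s d μ a M k p) +
      incCoeff (fun i => T * s i) d μ δ)).sum (fun k x => x * η k) =
          ∑ k ∈ Finset.range (M / T + 1), ∑ p : Fin T, bCoeff T s d μ a M k p *
            gmIncrement s d (zstep μ) (fun j => η (j * (T : ℤ) + (p : ℤ))) (k : ℤ) +
          δ.sum (fun j y => y * gmIncrement (fun i => T * s i) d (zstep μ) η j) := by
    intro η
    change _ - Finsupp.linearCombination ℂ η _ = _ + Finsupp.linearCombination ℂ _ δ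
    rw [map_neg, map_add, linearCombination_incCoeff, sum_eq_sum_bCoeff_sub (d := d) hT hs hμ]
    simp only [map_sum, Finsupp.linearCombination_single, smul_eq_mul]
    ring
  exact ⟨⟨δ, hδ, h⟩, h⟩

end

/-! ### The optimal estimate -/

section
variable {r T : ℕ} {s d μ : Fin r → ℕ} {f A : ℝ → Matrix (Fin T) (Fin T) ℂ}
  {Ω : Type*} [MeasurableSpace Ω] {P : Measure Ω} {ζ : ℤ → Ω → ℂ} {U : VecL2 T →L[ℂ] Lp ℂ 2 P}

theorem norm_sq_isometry
    (hU2 : ∀ V W, inner ℂ (U V) (U W) = ((1 / (2 * Real.pi) : ℝ) : ℂ) * inner ℂ V W)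
    (V : VecL2 T) : ‖U V‖ ^ 2 = 1 / (2 * Real.pi) * ‖V‖ ^ 2 := by
  have h := hU2 V V
  rw [inner_self_eq_norm_sq_to_K, inner_self_eq_norm_sq_to_K] at h
  have h' : ((‖U V‖ ^ 2 : ℝ) : ℂ) = ((1 / (2 * Real.pi) * ‖V‖ ^ 2 : ℝ) : ℂ) := by
    push_cast at h ⊢
    exact h
  exact_mod_cast h'

theorem antilipschitz_isometry
    (hU2 : ∀ V W, inner ℂ (U V) (U W) = ((1 / (2 * Real.pi) : ℝ) : ℂ) * inner ℂ V W) :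
    AntilipschitzWith (Real.toNNReal √(2 * Real.pi)) U := by
  refine AddMonoidHomClass.antilipschitz_of_bound U fun V => ?_
  have h0 : (0 : ℝ) < 2 * Real.pi := by positivity
  rw [Real.coe_toNNReal _ (Real.sqrt_nonneg _), ← Real.sqrt_sq (norm_nonneg (U V)),
    ← Real.sqrt_mul h0.le, norm_sq_isometry hU2]
  refine Real.le_sqrt_of_sq_le (le_of_eq ?_)
  field_simp

theorem integral_norm_sq_eq (g : Lp ℂ 2 P) : ∫ ω, ‖g ω‖ ^ 2 ∂P = ‖g‖ ^ 2 := by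
  have h := inner_self_eq_norm_sq_to_K (𝕜 := ℂ) g
  rw [L2.inner_def] at h
  have h2 : ∀ ω, inner ℂ (g ω) (g ω) = ((‖g ω‖ ^ 2 : ℝ) : ℂ) := fun ω => by
    rw [inner_self_eq_norm_sq_to_K]
    push_cast
    rfl
  simp only [h2] at h
  rw [integral_complex_ofReal] at h
  exact Complex.ofReal_injective (h.trans (Complex.ofReal_pow _ _).symm)

theorem coeFn_smul_incLp (hζ : IsPeriodicallyStationary P T s d ζ) {ν : Fin r → ℤ}
    (hν : IsStep ν) (x : ℂ) (k : ℤ) (p : Fin T) :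
    ∀ᵐ ω ∂P, (x • incLp hζ hν k p : Lp ℂ 2 P) ω = x * vecIncrement s d ν (blocks T ζ) k p ω := by
  filter_upwards [Lp.coeFn_smul x (incLp hζ hν k p), (memLp_vecIncrement hζ hν k p).coeFn_toLp]
    with ω h1 h2
  rw [h1, Pi.smul_apply, smul_eq_mul, incLp, h2]

/-- `B_N χ ξ` is represented by a trigonometric polynomial. -/
theorem ae_trigPoly (hs : ∀ i, 0 < s i) (hμ : ∀ i, 0 < μ i)
    (hζ : IsPeriodicallyStationary P T s d ζ) (hA : IsDensityFactor f A) (hmin : IsMinimal s d μ f)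
    (hU : ∀ (ν : Fin r → ℤ) (hν : IsStep ν) k p, U (incGen hA d hs ν k p) = incLp hζ hν k p)
    (a : ℕ → ℂ) (M : ℕ) :
    ∀ᵐ ω ∂P, U (trigPoly (hA.isMinimalFactor hs hμ hmin) (M / T) (bCoeff T s d μ a M)) ω =
      ∑ k ∈ Finset.range (M / T + 1), ∑ p : Fin T, bCoeff T s d μ a M k p *
        gmIncrement s d (zstep μ) (fun j => ζ (j * (T : ℤ) + (p : ℤ)) ω) (k : ℤ) := by
  have hg : ∀ k p, U (gen (hA.isMinimalFactor hs hμ hmin) k p) = incLp hζ (isStep_zstep hμ) k p :=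
    hU _ (isStep_zstep hμ)
  simp only [trigPoly, map_sum, map_smul, hg]
  filter_upwards [Lp.coeFn_fun_finsetSum (Finset.range (M / T + 1)) fun k => ∑ p : Fin T,
      bCoeff T s d μ a M k p • incLp hζ (isStep_zstep hμ) (k : ℤ) p,
    ae_all_iff.2 fun k : ℕ => Lp.coeFn_fun_finsetSum Finset.univ fun p : Fin T =>
      bCoeff T s d μ a M k p • incLp hζ (isStep_zstep hμ) (k : ℤ) p,
    ae_all_iff.2 fun k : ℕ => ae_all_iff.2 fun p : Fin T =>
      coeFn_smul_incLp hζ (isStep_zstep hμ) (bCoeff T s d μ a M k p) (k : ℤ) p] with ω h1 h2 h3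
  rw [h1]
  refine Finset.sum_congr rfl fun k _ => ?_
  rw [h2]
  exact Finset.sum_congr rfl fun p _ => h3 k p

/-- The time `j = kT + p` as the pair `(k, p)`. -/
def timeIndex (hT : 0 < T) (j : ℤ) : ℤ × Fin T :=
  (j / T, ⟨(j % T).toNat, by
    have h1 := Int.emod_nonneg j (by omega : (T : ℤ) ≠ 0)
    have h2 := Int.emod_lt_of_pos j (by omega : (0 : ℤ) < T)
    omega⟩)

theorem timeIndex_eq (hT : 0 < T) (j : ℤ) :
    (timeIndex hT j).1 * (T : ℤ) + ((timeIndex hT j).2 : ℤ) = j := by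
  have h1 := Int.emod_nonneg j (by omega : (T : ℤ) ≠ 0)
  have h2 := Int.mul_ediv_add_emod j T
  simp only [timeIndex]
  rw [Int.toNat_of_nonneg h1, mul_comm]
  exact h2

theorem timeIndex_mul_add (hT : 0 < T) (k : ℤ) (p : Fin T) :
    timeIndex hT (k * (T : ℤ) + (p : ℤ)) = (k, p) := by
  have hp := p.2
  have h1 : (k * (T : ℤ) + (p : ℤ)) / T = k := by
    rw [add_comm, Int.add_mul_ediv_right _ _ (by omega),
      Int.ediv_eq_zero_of_lt (by omega) (by omega),
      zero_add]
  have h2 : (k * (T : ℤ) + (p : ℤ)) % T = p := by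
    rw [add_comm, Int.add_mul_emod_self_right, Int.emod_eq_of_lt (by omega) (by omega)]
  refine Prod.ext h1 (Fin.ext ?_)
  simp only [timeIndex, h2, Int.toNat_natCast]

theorem timeIndex_fst_le (hT : 0 < T) {j : ℤ} : (timeIndex hT j).1 ≤ -1 ↔ j ≤ -1 := by
  have h : (timeIndex hT j).1 < 0 ↔ j < 0 :=
    (Int.ediv_lt_iff_lt_mul (by omega)).trans (by simp)
  omega

/-- The vector representing a combination of increments of `ζ`. -/
def incVec (hT : 0 < T) (hA : IsMinimalFactor A) : (ℤ →₀ ℂ) →ₗ[ℂ] VecL2 T :=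
  Finsupp.linearCombination ℂ fun j => gen hA (timeIndex hT j).1 (timeIndex hT j).2

theorem map_incVec (hT : 0 < T) (hA : IsMinimalFactor A) :
    (Finsupp.supported ℂ ℂ (Set.Iic (-1 : ℤ))).map (incVec hT hA) =
      Submodule.span ℂ {V | ∃ k ≤ (-1 : ℤ), ∃ l, V = gen hA k l} := by
  rw [incVec, ← Finsupp.span_image_eq_map_linearCombination]
  congr 1
  ext V
  constructor
  · rintro ⟨j, hj, rfl⟩
    exact ⟨_, (timeIndex_fst_le hT).2 hj, _, rfl⟩
  · rintro ⟨k, hk, l, rfl⟩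
    refine ⟨k * (T : ℤ) + (l : ℤ), (timeIndex_fst_le hT).1 ?_, ?_⟩
    · rwa [timeIndex_mul_add]
    · simp only [timeIndex_mul_add]

theorem ae_incVec (hT : 0 < T) (hs : ∀ i, 0 < s i) (hμ : ∀ i, 0 < μ i)
    (hζ : IsPeriodicallyStationary P T s d ζ) (hA : IsDensityFactor f A) (hmin : IsMinimal s d μ f)
    (hU : ∀ (ν : Fin r → ℤ) (hν : IsStep ν) k p, U (incGen hA d hs ν k p) = incLp hζ hν k p)
    (δ : ℤ →₀ ℂ) : ∀ᵐ ω ∂P, U (incVec hT (hA.isMinimalFactor hs hμ hmin) δ) ω =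
      δ.sum (fun j y => y * gmIncrement (fun i => T * s i) d (zstep μ) (fun j => ζ j ω) j) := by
  have hg : ∀ k p, U (gen (hA.isMinimalFactor hs hμ hmin) k p) = incLp hζ (isStep_zstep hμ) k p :=
    hU _ (isStep_zstep hμ)
  simp only [incVec, Finsupp.linearCombination_apply, Finsupp.sum, map_sum, map_smul, hg]
  filter_upwards [Lp.coeFn_fun_finsetSum δ.support fun j =>
      δ j • incLp hζ (isStep_zstep hμ) (timeIndex hT j).1 (timeIndex hT j).2,
    ae_all_iff.2 fun j => coeFn_smul_incLp hζ (isStep_zstep hμ) (δ j) (timeIndex hT j).1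
      (timeIndex hT j).2] with ω h1 h2
  rw [h1]
  refine Finset.sum_congr rfl fun j _ => ?_
  rw [h2]
  congr 1
  have h3 := gmIncrement_blocks (T := T) s d (zstep μ) (fun j => ζ j ω) (timeIndex hT j).1
    (timeIndex hT j).2
  rw [timeIndex_eq] at h3
  exact h3

theorem aestronglyMeasurable_functional (hζ : IsPeriodicallyStationary P T s d ζ) (a : ℕ → ℂ)
    (M : ℕ) : AEStronglyMeasurable (functional a M ζ) P :=
  Finset.aestronglyMeasurable_fun_sum _ fun k _ => (hζ.measurable k).const_mul (a k)

/-- The errors of the linear estimates form the affine space `B_N χ ξ + 𝓜`, where `𝓜` is the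
closed span of the past increments. -/
theorem isLinearEstimate_iff (hT : 0 < T) (hs : ∀ i, 0 < s i) (hμ : ∀ i, 0 < μ i)
    (hζ : IsPeriodicallyStationary P T s d ζ) (hA : IsDensityFactor f A) (hmin : IsMinimal s d μ f)
    (hU : ∀ (ν : Fin r → ℤ) (hν : IsStep ν) k p, U (incGen hA d hs ν k p) = incLp hζ hν k p)
    (hU2 : ∀ V W, inner ℂ (U V) (U W) = ((1 / (2 * Real.pi) : ℝ) : ℂ) * inner ℂ V W)
    (a : ℕ → ℂ) (M : ℕ) (Y : Ω → ℂ) :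
    IsLinearEstimate P T s d μ ζ a M Y ↔ AEStronglyMeasurable Y P ∧
      ∃ W ∈ specPast (hA.isMinimalFactor hs hμ hmin) (-1), ∀ᵐ ω ∂P, functional a M ζ ω - Y ω =
        U (trigPoly (hA.isMinimalFactor hs hμ hmin) (M / T) (bCoeff T s d μ a M) + W) ω := by
  set hA' := hA.isMinimalFactor hs hμ hmin
  set B := trigPoly hA' (M / T) (bCoeff T s d μ a M) with hB
  -- the error of an elementary estimate
  have hel : ∀ (u δ : ℤ →₀ ℂ), (∀ η : ℤ → ℂ,
        ∑ k ∈ Finset.range (M + 1), a k * η (k : ℤ) - u.sum (fun k x => x * η k) =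
          ∑ k ∈ Finset.range (M / T + 1), ∑ p : Fin T, bCoeff T s d μ a M k p *
            gmIncrement s d (zstep μ) (fun j => η (j * (T : ℤ) + (p : ℤ))) (k : ℤ) +
          δ.sum (fun j y => y * gmIncrement (fun i => T * s i) d (zstep μ) η j)) →
      ∀ᵐ ω ∂P, functional a M ζ ω - u.sum (fun k x => x * ζ k ω) =
        U (B + incVec hT hA' δ) ω := by
    intro u δ h
    rw [map_add]
    filter_upwards [Lp.coeFn_add (U B) (U (incVec hT hA' δ)),
      ae_trigPoly hs hμ hζ hA hmin hU a M,
      ae_incVec hT hs hμ hζ hA hmin hU δ] with ω h1 h2 h3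
    rw [h1, Pi.add_apply, hB, h2, h3]
    exact h fun j => ζ j ω
  refine and_congr_right fun hY => ⟨?_, ?_⟩
  · rintro ⟨u, hu, hlim⟩
    simp only [isElementaryEstimate_iff hT hs hμ] at hu
    choose δ hδ hδ' using hu
    have hdiff : ∀ n, ∀ᵐ ω ∂P, (u n).sum (fun k x => x * ζ k ω) - Y ω =
        functional a M ζ ω - Y ω - U (B + incVec hT hA' (δ n)) ω := by
      intro n
      filter_upwards [hel (u n) (δ n) (hδ' n)] with ω h
      rw [← h]
      ring
    have hD : MemLp (fun ω => functional a M ζ ω - Y ω) 2 P := by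
      have h1 : ∀ᶠ n in atTop,
          eLpNorm (fun ω => (u n).sum (fun k x => x * ζ k ω) - Y ω) 2 P < ⊤ :=
        hlim.eventually_lt_const ENNReal.zero_lt_top
      obtain ⟨n, hn⟩ := h1.exists
      have hm : AEStronglyMeasurable (fun ω => functional a M ζ ω - Y ω) P :=
        (aestronglyMeasurable_functional hζ a M).sub hY
      have h2 : MemLp (fun ω => functional a M ζ ω - Y ω - U (B + incVec hT hA' (δ n)) ω) 2 P := by
        refine ⟨hm.sub (Lp.aestronglyMeasurable _), ?_⟩
        rwa [← eLpNorm_congr_ae (hdiff n)]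
      convert h2.add (Lp.memLp (U (B + incVec hT hA' (δ n)))) using 1
      ext ω
      simp
    have hconv : Tendsto (fun n => U (B + incVec hT hA' (δ n))) atTop (𝓝 hD.toLp) := by
      rw [Lp.tendsto_Lp_iff_tendsto_eLpNorm']
      refine hlim.congr fun n => ?_
      rw [eLpNorm_congr_ae (hdiff n), ← eLpNorm_neg]
      refine eLpNorm_congr_ae ?_
      filter_upwards [hD.coeFn_toLp] with ω h
      simp only [Pi.neg_apply, Pi.sub_apply, h]
      ring
    -- the image of the past under the isometry is closed, so the limit of the corrections is in it
    have hcl : IsClosed (U '' (specPast hA' (-1) : Set (VecL2 T))) :=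
      ((antilipschitz_isometry hU2).isClosedEmbedding U.uniformContinuous).isClosedMap _
        (Submodule.isClosed_topologicalClosure _)
    have hlim2 : Tendsto (fun n => U (incVec hT hA' (δ n))) atTop (𝓝 (hD.toLp - U B)) := by
      refine (hconv.sub_const (U B)).congr fun n => ?_
      rw [map_add, add_sub_cancel_left]
    obtain ⟨W, hW, hW2⟩ := hcl.mem_of_tendsto hlim2 (Eventually.of_forall fun n =>
      ⟨_, Submodule.le_topologicalClosure _ ((map_incVec hT hA') ▸
        Submodule.mem_map_of_mem ((Finsupp.mem_supported _ _).2 (hδ n))), rfl⟩)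
    refine ⟨W, hW, ?_⟩
    rw [map_add, hW2, add_sub_cancel]
    filter_upwards [hD.coeFn_toLp] with ω h using h.symm
  -- approximate `W` by combinations of increments, which are realized by elementary estimates
  · rintro ⟨W, hW, hWY⟩
    obtain ⟨V, hV, hVW⟩ := mem_closure_iff_seq_limit.1 hW
    have hδ : ∀ n, ∃ δ : ℤ →₀ ℂ, (∀ j ∈ δ.support, j ≤ -1) ∧ incVec hT hA' δ = V n := by
      intro n
      have h1 := hV n
      rw [← map_incVec hT hA'] at h1
      obtain ⟨δ, h2, h3⟩ := h1
      exact ⟨δ, (Finsupp.mem_supported _ _).1 h2, h3⟩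
    choose δ hδ hδV using hδ
    choose u hu hu' using fun n => exists_isElementaryEstimate (d := d) hT hs hμ a M (δ n) (hδ n)
    refine ⟨u, hu, ?_⟩
    have h1 : Tendsto (fun n => U (B + V n)) atTop (𝓝 (U (B + W))) :=
      (U.continuous.tendsto _).comp (hVW.const_add B)
    rw [Lp.tendsto_Lp_iff_tendsto_eLpNorm'] at h1
    refine h1.congr fun n => ?_
    rw [← eLpNorm_neg]
    refine eLpNorm_congr_ae ?_
    filter_upwards [hWY, hel (u n) (δ n) (hu' n)] with ω h2 h3
    rw [hδV] at h3
    simp only [Pi.neg_apply, Pi.sub_apply, ← h2, ← h3]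
    ring

/-- The error of the optimal estimate, in the spectral domain. -/
abbrev optResidual (hs : ∀ i, 0 < s i) (hμ : ∀ i, 0 < μ i) (hA : IsDensityFactor f A)
    (hmin : IsMinimal s d μ f) (a : ℕ → ℂ) (M : ℕ) : VecL2 T :=
  residual (hA.isMinimalFactor hs hμ hmin) (M / T) (bCoeff T s d μ a M)

theorem mse_eq_norm_sq
    (hU2 : ∀ V W, inner ℂ (U V) (U W) = ((1 / (2 * Real.pi) : ℝ) : ℂ) * inner ℂ V W)
    {a : ℕ → ℂ} {M : ℕ} {Y : Ω → ℂ} {V : VecL2 T}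
    (h : ∀ᵐ ω ∂P, functional a M ζ ω - Y ω = U V ω) :
    mse P ζ a M Y = 1 / (2 * Real.pi) * ‖V‖ ^ 2 := by
  rw [← norm_sq_isometry hU2, ← integral_norm_sq_eq, mse]
  refine integral_congr_ae ?_
  filter_upwards [h] with ω h1
  rw [h1]

/-- The optimal estimates are those whose error is represented by the residual. -/
theorem isOptimalEstimate_iff (hT : 0 < T) (hs : ∀ i, 0 < s i) (hμ : ∀ i, 0 < μ i)
    (hζ : IsPeriodicallyStationary P T s d ζ) (hA : IsDensityFactor f A) (hmin : IsMinimal s d μ f)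
    (hU : ∀ (ν : Fin r → ℤ) (hν : IsStep ν) k p, U (incGen hA d hs ν k p) = incLp hζ hν k p)
    (hU2 : ∀ V W, inner ℂ (U V) (U W) = ((1 / (2 * Real.pi) : ℝ) : ℂ) * inner ℂ V W)
    (a : ℕ → ℂ) (M : ℕ) (Y : Ω → ℂ) :
    IsOptimalEstimate P T s d μ ζ a M Y ↔
      ∀ᵐ ω ∂P, functional a M ζ ω - Y ω = U (optResidual hs hμ hA hmin a M) ω := by
  set hA' := hA.isMinimalFactor hs hμ hmin
  set B := trigPoly hA' (M / T) (bCoeff T s d μ a M) with hB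
  set R := optResidual hs hμ hA hmin a M with hR
  set Q := (specPast hA' (-1)).starProjection B with hQ
  have hRB : R = B - Q := rfl
  have hQm : Q ∈ specPast hA' (-1) := Submodule.starProjection_apply_mem _ _
  -- `R` is orthogonal to the past, so `B + W` has least norm exactly if it equals `R`
  have hpyth : ∀ W ∈ specPast hA' (-1), ‖B + W‖ ^ 2 = ‖R‖ ^ 2 + ‖Q + W‖ ^ 2 := by
    intro W hW
    have h1 : B + W = R + (Q + W) := by rw [hRB]; abel
    rw [h1, sq, sq, sq]
    exact norm_add_sq_eq_norm_sq_add_norm_sq_of_inner_eq_zero _ _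
      ((Submodule.mem_orthogonal' _ _).1 (residual_mem_orthogonal hA' _ _) _
        (Submodule.add_mem _ hQm hW))
  have hc : (0 : ℝ) < 1 / (2 * Real.pi) := by positivity
  have hlin : ∀ Y, AEStronglyMeasurable Y P → (∀ᵐ ω ∂P, functional a M ζ ω - Y ω = U R ω) →
      IsLinearEstimate P T s d μ ζ a M Y := by
    intro Y hY h
    refine (isLinearEstimate_iff hT hs hμ hζ hA hmin hU hU2 a M Y).2
      ⟨hY, -Q, Submodule.neg_mem _ hQm, ?_⟩
    rw [← sub_eq_add_neg]
    exact h
  constructor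
  · rintro ⟨h1, -, h3⟩
    obtain ⟨-, W, hW, h2⟩ := (isLinearEstimate_iff hT hs hμ hζ hA hmin hU hU2 a M Y).1 h1
    have h4 : ∀ᵐ ω ∂P, functional a M ζ ω - (functional a M ζ ω - U R ω) = U R ω :=
      Eventually.of_forall fun ω => by ring
    have h5 := h3 _ (hlin (fun ω => functional a M ζ ω - U R ω)
      ((aestronglyMeasurable_functional hζ a M).sub (Lp.aestronglyMeasurable _)) h4)
    rw [mse_eq_norm_sq hU2 h2, mse_eq_norm_sq hU2 h4, mul_le_mul_iff_right₀ hc,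
      hpyth W hW] at h5
    have h6 : Q + W = 0 := norm_eq_zero.1 (pow_eq_zero_iff two_ne_zero |>.1
      (le_antisymm (by linarith) (sq_nonneg _)))
    have h7 : B + W = R := by
      rw [hRB, sub_eq_add_neg, ← eq_neg_of_add_eq_zero_right h6]
    rwa [← h7]
  · intro h
    have hY : AEStronglyMeasurable Y P := by
      refine ((aestronglyMeasurable_functional hζ a M).sub
        (Lp.aestronglyMeasurable (U R))).congr ?_
      filter_upwards [h] with ω h1
      rw [Pi.sub_apply, ← h1]
      ring
    refine ⟨hlin Y hY h, (memLp_congr_ae h).2 (Lp.memLp _), fun Y' hY' => ?_⟩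
    obtain ⟨-, W, hW, h2⟩ := (isLinearEstimate_iff hT hs hμ hζ hA hmin hU hU2 a M Y').1 hY'
    rw [mse_eq_norm_sq hU2 h, mse_eq_norm_sq hU2 h2, mul_le_mul_iff_right₀ hc, hpyth W hW]
    linarith [sq_nonneg ‖Q + W‖]

end

/-! ### The solution of the Toeplitz equation and the spectral characteristic -/

section
variable {r T : ℕ} {s d μ : Fin r → ℕ} {f A : ℝ → Matrix (Fin T) (Fin T) ℂ}
  {Ω : Type*} [MeasurableSpace Ω] {P : Measure Ω} {ζ : ℤ → Ω → ℂ} {U : VecL2 T →L[ℂ] Lp ℂ 2 P}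

theorem bCoeff_eq_zero_of_lt (T : ℕ) (s d μ : Fin r → ℕ) (a : ℕ → ℂ) (M : ℕ) (k : ℕ)
    (hk : M / T < k) : bCoeff T s d μ a M k = 0 := by
  ext p
  rw [bCoeff, Finset.Icc_eq_empty (by omega), Finset.sum_empty, Pi.zero_apply]

theorem coeFn_trigPoly (hA : IsMinimalFactor A) (N : ℕ) (b : ℕ → Fin T → ℂ) :
    ∀ᵐ θ ∂circ, (trigPoly hA N b θ).ofLp =
      (A θ).mulVec fun p => ∑ k ∈ Finset.range (N + 1), b k p * ex (k : ℤ) θ := by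
  have h1 : ∀ (k : ℕ) p, ∀ᵐ θ ∂circ, ((b k p • gen hA (k : ℤ) p : VecL2 T) θ).ofLp =
      fun i => b k p * (ex (k : ℤ) θ * A θ i p) := by
    intro k p
    filter_upwards [Lp.coeFn_smul (b k p) (gen hA (k : ℤ) p),
      coeFn_toVec _ (fun i => memLp_ex_mul (hA.memLp i p) (k : ℤ))] with θ h1 h2
    rw [h1, Pi.smul_apply, WithLp.ofLp_smul, gen, h2]
    rfl
  filter_upwards [ae_all_iff.2 fun k => ae_all_iff.2 fun p => h1 k p,
    coeFn_finset_sum (Finset.range (N + 1)) fun k => ∑ p, b k p • gen hA (k : ℤ) p,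
    ae_all_iff.2 fun k : ℕ => coeFn_finset_sum Finset.univ fun p => b k p • gen hA (k : ℤ) p]
    with θ h2 h3 h4
  rw [trigPoly, h3]
  simp only [h4, h2]
  ext i
  simp only [Finset.sum_apply, Matrix.mulVec, dotProduct, Finset.mul_sum]
  rw [Finset.sum_comm]
  exact Finset.sum_congr rfl fun p _ => Finset.sum_congr rfl fun k _ => by ring

theorem ae_eq_of_coeff_eq {g h : ℝ → ℂ} (hg : MemLp g 2 circ) (hh : MemLp h 2 circ)
    (heq : ∀ n : ℤ, ∫ θ, ex (-n) θ * g θ ∂circ = ∫ θ, ex (-n) θ * h θ ∂circ) :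
    ∀ᵐ θ ∂circ, g θ = h θ := by
  have hg' : Integrable g circ := hg.integrable (by norm_num)
  have hh' : Integrable h circ := hh.integrable (by norm_num)
  filter_upwards [ae_eq_zero_of_integral_ex_eq_zero (hg'.sub hh') fun n => by
    have := heq (-n)
    rw [neg_neg] at this
    simp only [Pi.sub_apply, mul_sub]
    rw [integral_sub (integrable_ex_mul hg' n) (integrable_ex_mul hh' n), this, sub_self]] with θ h
  exact sub_eq_zero.1 h

/-- The Fourier coefficients of `AᴴR`, `R` the residual. -/
def residualCoeff (hA : IsMinimalFactor A) (N : ℕ) (b : ℕ → Fin T → ℂ) (n : ℕ) (p : Fin T) : ℂ :=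
  1 / (2 * (Real.pi : ℂ)) *
    ∫ θ, ex (-(n : ℤ)) θ * ((A θ).conjTranspose.mulVec (residual hA N b θ).ofLp) p ∂circ

theorem isSymbol_residualCoeff (hA : IsMinimalFactor A) (N : ℕ) (b : ℕ → Fin T → ℂ) :
    IsSymbol (residualCoeff hA N b)
      fun θ => (A θ).conjTranspose.mulVec (residual hA N b θ).ofLp := by
  refine fun p => ⟨memLp_conjTranspose_mulVec_residual hA N b p, fun n => ?_⟩
  dsimp only
  split_ifs with hn
  · obtain ⟨j, rfl⟩ := Int.eq_ofNat_of_zero_le hn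
    rfl
  · rw [integral_ex_conjTranspose_mulVec_residual hA N b p n (by omega), mul_zero]

theorem inv_mul_conjTranspose_mulVec {B : Matrix (Fin T) (Fin T) ℂ} (hB : IsUnit B)
    (v : Fin T → ℂ) :
    (B.conjTranspose * B)⁻¹.mulVec (B.conjTranspose.mulVec v) = B⁻¹.mulVec v := by
  have h1 : IsUnit B.conjTranspose.det := by
    rw [Matrix.det_conjTranspose]
    exact ((Matrix.isUnit_iff_isUnit_det _).1 hB).star
  rw [Matrix.mulVec_mulVec, Matrix.mul_inv_rev, mul_assoc, Matrix.nonsing_inv_mul _ h1, mul_one]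

/-- The equation `F c = b` in terms of a square root `A` of the density. -/
def SolvesToeplitz (A : ℝ → Matrix (Fin T) (Fin T) ℂ) (C : ℝ → Fin T → ℂ) (b : ℕ → Fin T → ℂ) :
    Prop :=
  ∀ p, Integrable (fun θ => ((A θ).conjTranspose * A θ)⁻¹.mulVec (C θ) p) circ ∧
    ∀ j : ℕ, 1 / (2 * (Real.pi : ℂ)) *
      ∫ θ, ex (-(j : ℤ)) θ * ((A θ).conjTranspose * A θ)⁻¹.mulVec (C θ) p ∂circ = b j p

/-- The residual gives a solution of the equation. -/
theorem solvesToeplitz_residual (hA : IsMinimalFactor A) (N : ℕ) (b : ℕ → Fin T → ℂ)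
    (hb : ∀ k, N < k → b k = 0) :
    SolvesToeplitz A (fun θ => (A θ).conjTranspose.mulVec (residual hA N b θ).ofLp) b := by
  have h : ∀ᵐ θ ∂circ, ((A θ).conjTranspose * A θ)⁻¹.mulVec
      ((A θ).conjTranspose.mulVec (residual hA N b θ).ofLp) =
        (A θ)⁻¹.mulVec (residual hA N b θ).ofLp := by
    filter_upwards [hA.isUnit] with θ h using inv_mul_conjTranspose_mulVec h _
  refine fun p => ⟨?_, fun j => ?_⟩
  · refine (integrable_inv_mulVec hA (residual hA N b) p).congr ?_
    filter_upwards [h] with θ h1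
    rw [h1]
  · have h2 : ∫ θ, ex (-(j : ℤ)) θ * ((A θ).conjTranspose * A θ)⁻¹.mulVec
        ((A θ).conjTranspose.mulVec (residual hA N b θ).ofLp) p ∂circ =
        ∫ θ, ex (-(j : ℤ)) θ * (A θ)⁻¹.mulVec (residual hA N b θ).ofLp p ∂circ := by
      refine integral_congr_ae ?_
      filter_upwards [h] with θ h1
      rw [h1]
    rw [h2, integral_ex_inv_mulVec_residual hA N b hb]
    have := two_pi_ne_zero
    field_simp

/-- The symbol of a solution of `F c = b` is `AᴴR`. -/
theorem SolvesToeplitz.ae_eq (hA : IsMinimalFactor A) {N : ℕ} {b c : ℕ → Fin T → ℂ}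
    (hb : ∀ k, N < k → b k = 0) {C : ℝ → Fin T → ℂ} (hc : IsSymbol c C)
    (hC : SolvesToeplitz A C b) :
    ∀ᵐ θ ∂circ, C θ = (A θ).conjTranspose.mulVec (residual hA N b θ).ofLp := by
  set C₀ : ℝ → Fin T → ℂ := fun θ => (A θ).conjTranspose.mulVec (residual hA N b θ).ofLp with hC₀
  have hc₀ := isSymbol_residualCoeff hA N b
  have hS₀ := solvesToeplitz_residual hA N b hb
  have hcoef0 : ∀ {g : ℝ → ℂ} {γ : ℤ → ℂ}, HasFourierSeries g γ → ∀ n, γ n = 0 →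
      ∫ θ, ex (-n) θ * g θ ∂circ = 0 := by
    intro g γ h n hn
    have h1 := h.2 n
    rw [hn] at h1
    exact (mul_eq_zero.1 h1).resolve_left (one_div_ne_zero two_pi_ne_zero)
  have hI : ∀ {C : ℝ → Fin T → ℂ} {c : ℕ → Fin T → ℂ}, IsSymbol c C → ∀ p,
      Integrable (fun θ => C θ p) circ := fun h p => (h p).1.integrable (by norm_num)
  have h0 := ae_eq_zero_of_coeff_inv_mulVec hA (C := fun θ => C θ - C₀ θ)
    (fun p => (hc p).1.sub (hc₀ p).1) (fun p n hn => by
      simp only [Pi.sub_apply, mul_sub]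
      rw [integral_sub (integrable_ex_mul (hI hc p) _) (integrable_ex_mul (hI hc₀ p) _),
        hcoef0 (hc p) n (if_neg (by omega)), hcoef0 (hc₀ p) n (if_neg (by omega)), sub_self])
    (fun p => by
      simp only [Matrix.mulVec_sub, Pi.sub_apply]
      exact (hC p).1.sub (hS₀ p).1)
    (fun p n hn => by
      obtain ⟨j, rfl⟩ := Int.eq_ofNat_of_zero_le hn
      simp only [Matrix.mulVec_sub, Pi.sub_apply, mul_sub]
      rw [integral_sub (integrable_ex_mul (hC p).1 _) (integrable_ex_mul (hS₀ p).1 _),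
        sub_eq_zero]
      exact mul_left_cancel₀ (one_div_ne_zero two_pi_ne_zero)
        (((hC p).2 j).trans ((hS₀ p).2 j).symm))
  filter_upwards [ae_all_iff.2 h0] with θ h
  exact funext fun p => sub_eq_zero.1 (h p)

theorem IsSymbol.eq_of_ae_eq {c c' : ℕ → Fin T → ℂ} {C C' : ℝ → Fin T → ℂ} (hc : IsSymbol c C)
    (hc' : IsSymbol c' C') (h : ∀ᵐ θ ∂circ, C θ = C' θ) : c = c' := by
  ext n p
  have h1 := (hc p).2 n
  have h2 := (hc' p).2 n
  simp only [Int.natCast_nonneg, if_true, Int.toNat_natCast] at h1 h2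
  rw [← h1, ← h2]
  congr 1
  refine integral_congr_ae ?_
  filter_upwards [h] with θ h3
  rw [h3]

theorem IsSymbol.ae_eq {c : ℕ → Fin T → ℂ} {C C' : ℝ → Fin T → ℂ} (hc : IsSymbol c C)
    (hc' : IsSymbol c C') : ∀ᵐ θ ∂circ, C θ = C' θ := by
  have h : ∀ p, ∀ᵐ θ ∂circ, C θ p = C' θ p := fun p =>
    ae_eq_of_coeff_eq (hc p).1 (hc' p).1 fun n => mul_left_cancel₀ (one_div_ne_zero two_pi_ne_zero)
      (((hc p).2 n).trans ((hc' p).2 n).symm)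
  filter_upwards [ae_all_iff.2 h] with θ h using funext h

theorem fApply_iff (hs : ∀ i, 0 < s i) (hμ : ∀ i, 0 < μ i) (hA : IsDensityFactor f A)
    (c b : ℕ → Fin T → ℂ) : FApply s d μ f c b ↔
      ∃ C, IsSymbol c C ∧ SolvesToeplitz (fun θ => symbolRatio s d (zstep μ) θ • A θ) C b := by
  refine exists_congr fun C => and_congr_right fun _ => forall_congr' fun p => ?_
  have h := hA.ae_inv_eq (d := d) hs hμ
  refine and_congr (integrable_congr ?_) (forall_congr' fun j => ?_)
  · filter_upwards [h] with θ h1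
    rw [h1]
  · rw [integral_congr_ae (show _ =ᵐ[circ] fun θ => ex (-(j : ℤ)) θ *
      ((symbolRatio s d (zstep μ) θ • A θ).conjTranspose *
        (symbolRatio s d (zstep μ) θ • A θ))⁻¹.mulVec (C θ) p from ?_)]
    filter_upwards [h] with θ h1
    rw [h1]

theorem existsUnique_fApply (hs : ∀ i, 0 < s i) (hμ : ∀ i, 0 < μ i) (hA : IsDensityFactor f A)
    (hmin : IsMinimal s d μ f) (a : ℕ → ℂ) (M : ℕ) :
    ∃! c, FApply s d μ f c (bCoeff T s d μ a M) := by
  have hb := bCoeff_eq_zero_of_lt T s d μ a M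
  refine ⟨residualCoeff (hA.isMinimalFactor hs hμ hmin) (M / T) (bCoeff T s d μ a M),
    (fApply_iff hs hμ hA _ _).2 ⟨_, isSymbol_residualCoeff _ _ _,
      solvesToeplitz_residual _ _ _ hb⟩, fun c hc => ?_⟩
  obtain ⟨C, hC, hS⟩ := (fApply_iff hs hμ hA _ _).1 hc
  exact hC.eq_of_ae_eq (isSymbol_residualCoeff _ _ _) (hS.ae_eq _ hb hC)

theorem ae_symbol_eq (hs : ∀ i, 0 < s i) (hμ : ∀ i, 0 < μ i) (hA : IsDensityFactor f A)
    (hmin : IsMinimal s d μ f) (a : ℕ → ℂ) (M : ℕ) {c : ℕ → Fin T → ℂ}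
    (hc : FApply s d μ f c (bCoeff T s d μ a M)) {C : ℝ → Fin T → ℂ} (hC : IsSymbol c C) :
    ∀ᵐ θ ∂circ, C θ = (symbolRatio s d (zstep μ) θ • A θ).conjTranspose.mulVec
      (optResidual hs hμ hA hmin a M θ).ofLp := by
  obtain ⟨C', hC', hS⟩ := (fApply_iff hs hμ hA _ _).1 hc
  filter_upwards [hC.ae_eq hC', hS.ae_eq (hA.isMinimalFactor hs hμ hmin)
    (bCoeff_eq_zero_of_lt T s d μ a M) hC'] with θ h1 h2
  rw [h1, h2]

theorem star_beta_div_chi_neg (s d : Fin r → ℕ) (ν : Fin r → ℤ) (θ : ℝ) :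
    star (beta s d θ) / chi s d ν (-θ) = star (symbolRatio s d ν θ)⁻¹ := by
  rw [chi_neg, symbolRatio, inv_div, star_div₀]

/-- `A h = A_w B - R`: the spectral characteristic represents the projection. -/
theorem ae_mulVec_hFun (hs : ∀ i, 0 < s i) (hμ : ∀ i, 0 < μ i) (hA : IsDensityFactor f A)
    (hmin : IsMinimal s d μ f) (a : ℕ → ℂ) (M : ℕ) {c : ℕ → Fin T → ℂ}
    (hc : FApply s d μ f c (bCoeff T s d μ a M)) {C : ℝ → Fin T → ℂ} (hC : IsSymbol c C) :
    ∀ᵐ θ ∂circ, ((specPast (hA.isMinimalFactor hs hμ hmin) (-1)).starProjection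
      (trigPoly (hA.isMinimalFactor hs hμ hmin) (M / T) (bCoeff T s d μ a M)) θ).ofLp =
        (A θ).mulVec (hFun T s d μ f a M C θ) := by
  set hA' := hA.isMinimalFactor hs hμ hmin
  set B := trigPoly hA' (M / T) (bCoeff T s d μ a M) with hB
  have h0 : (specPast hA' (-1)).starProjection B = B - optResidual hs hμ hA hmin a M :=
    (sub_sub_cancel _ _).symm
  rw [h0]
  filter_upwards [Lp.coeFn_sub B (optResidual hs hμ hA hmin a M),
    coeFn_trigPoly hA' (M / T) (bCoeff T s d μ a M), ae_symbol_eq hs hμ hA hmin a M hc hC,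
    hA.mul_eq, hA.isUnit, ae_symbolRatio_ne_zero s d hs μ hμ] with θ h1 h2 h3 h4 h5 h6
  set w := symbolRatio s d (zstep μ) θ
  set R := (optResidual hs hμ hA hmin a M θ).ofLp
  have h7 : hFun T s d μ f a M C θ = w • BFun T s d μ a M θ - (A θ)⁻¹.mulVec R := by
    have h8 : Matrix.vecMul (C θ) (f θ)⁻¹ = star w • (A θ)⁻¹.mulVec R := by
      rw [← Matrix.mulVec_transpose, Matrix.transpose_nonsing_inv, ← h4, h3,
        Matrix.conjTranspose_smul, Matrix.smul_mulVec, Matrix.mulVec_smul,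
        inv_mul_conjTranspose_mulVec h5]
    ext p
    rw [hFun, star_beta_div_chi_neg, h8]
    have h9 : star w⁻¹ * (star w • (A θ)⁻¹.mulVec R) p = (A θ)⁻¹.mulVec R p := by
      rw [Pi.smul_apply, smul_eq_mul, ← mul_assoc, ← star_mul', inv_mul_cancel₀ h6, star_one,
        one_mul]
    rw [h9]
    simp only [Pi.sub_apply, Pi.smul_apply, smul_eq_mul]
    rw [mul_comm]
    rfl
  rw [h1, Pi.sub_apply, WithLp.ofLp_sub, h7, Matrix.mulVec_sub, Matrix.mulVec_smul,
    Matrix.mulVec_mulVec, Matrix.mul_nonsing_inv _ ((Matrix.isUnit_iff_isUnit_det _).1 h5),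
    Matrix.one_mulVec, hB, h2, Matrix.smul_mulVec]
  rfl

theorem aestronglyMeasurable_of_mulVec (hA : IsDensityFactor f A) {g : ℝ → Fin T → ℂ} {V : VecL2 T}
    (h : ∀ᵐ θ ∂circ, (V θ).ofLp = (A θ).mulVec (g θ)) (p : Fin T) :
    AEStronglyMeasurable (fun θ => g θ p) circ := by
  have hm : AEStronglyMeasurable (fun θ => (A θ)⁻¹.mulVec (V θ).ofLp p) circ := by
    simp only [Matrix.mulVec, dotProduct]
    exact Finset.aestronglyMeasurable_fun_sum _ fun i _ =>
      (aestronglyMeasurable_inv (fun i j => (hA.memLp i j).1) p i).mul (memLp_apply V i).1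
  refine hm.congr ?_
  filter_upwards [h, hA.isUnit] with θ h1 h2
  rw [h1, Matrix.mulVec_mulVec, Matrix.nonsing_inv_mul _ ((Matrix.isUnit_iff_isUnit_det _).1 h2),
    Matrix.one_mulVec]

theorem dotProduct_mulVec_star_eq {F B : Matrix (Fin T) (Fin T) ℂ}
    (h : B.conjTranspose * B = F.transpose) (g x : Fin T → ℂ) :
    g ⬝ᵥ F.mulVec (star x) = star (B.mulVec x) ⬝ᵥ B.mulVec g := by
  rw [Matrix.star_mulVec, ← Matrix.dotProduct_mulVec, Matrix.mulVec_mulVec, h,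
    Matrix.dotProduct_mulVec, Matrix.mulVec_transpose, dotProduct_comm]

theorem coeFn_gen (hs : ∀ i, 0 < s i) (hμ : ∀ i, 0 < μ i) (hA : IsDensityFactor f A)
    (hmin : IsMinimal s d μ f) (k : ℤ) (l : Fin T) :
    ∀ᵐ θ ∂circ, (gen (hA.isMinimalFactor hs hμ hmin) k l θ).ofLp =
      (A θ).mulVec (Pi.single l (ex k θ * (chi s d (zstep μ) θ / beta s d θ))) := by
  filter_upwards [coeFn_toVec _ (fun i => memLp_ex_mul
    ((hA.isMinimalFactor hs hμ hmin).memLp i l) k)] with θ h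
  rw [gen, h]
  ext i
  simp only [Matrix.mulVec_single, Matrix.smul_apply, smul_eq_mul, symbolRatio]
  simp
  ring

theorem exists_finsupp_of_mem_span (hs : ∀ i, 0 < s i) (hμ : ∀ i, 0 < μ i)
    (hA : IsDensityFactor f A) (hmin : IsMinimal s d μ f) {V : VecL2 T}
    (hV : V ∈ Submodule.span ℂ {V | ∃ k ≤ (-1 : ℤ), ∃ l,
      V = gen (hA.isMinimalFactor hs hμ hmin) k l}) :
    ∃ S : ℤ →₀ (Fin T → ℂ), (∀ k ∈ S.support, k ≤ -1) ∧ ∀ᵐ θ ∂circ, (V θ).ofLp =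
      (A θ).mulVec fun p =>
        S.sum fun k w => w p * (ex k θ * (chi s d (zstep μ) θ / beta s d θ)) := by
  classical
  induction hV using Submodule.span_induction with
  | mem V hV =>
    obtain ⟨k, hk, l, rfl⟩ := hV
    refine ⟨Finsupp.single k (Pi.single l 1), fun j hj => ?_, ?_⟩
    · rw [Finset.mem_singleton.1 (Finsupp.support_single_subset hj)]
      exact hk
    · filter_upwards [coeFn_gen hs hμ hA hmin k l] with θ h
      rw [h]
      congr 1
      ext p
      rw [Finsupp.sum_single_index (by simp)]
      by_cases hp : p = l
      · subst hp; simp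
      · simp [Pi.single_eq_of_ne hp]
  | zero =>
    refine ⟨0, by simp, ?_⟩
    filter_upwards [Lp.coeFn_zero (EuclideanSpace ℂ (Fin T)) 2 circ] with θ h
    rw [h]
    ext i
    simp [Matrix.mulVec, dotProduct]
  | add V W _ _ hV hW =>
    obtain ⟨S, hS, hV⟩ := hV
    obtain ⟨S', hS', hW⟩ := hW
    refine ⟨S + S', fun k hk => (Finset.mem_union.1 (Finsupp.support_add hk)).elim (hS k) (hS' k),
      ?_⟩
    filter_upwards [hV, hW, Lp.coeFn_add V W] with θ h1 h2 h3
    rw [h3, Pi.add_apply, WithLp.ofLp_add, h1, h2, ← Matrix.mulVec_add]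
    congr 1
    ext p
    rw [Finsupp.sum_add_index' (by simp) fun k x y => by simp [add_mul]]
    rfl
  | smul x V _ hV =>
    obtain ⟨S, hS, hV⟩ := hV
    refine ⟨x • S, fun k hk => hS k (Finsupp.support_smul hk), ?_⟩
    filter_upwards [hV, Lp.coeFn_smul x V] with θ h1 h3
    rw [h3, Pi.smul_apply, WithLp.ofLp_smul, h1, ← Matrix.mulVec_smul]
    congr 1
    ext p
    rw [Finsupp.sum_smul_index' (by simp), Pi.smul_apply, Finsupp.smul_sum]
    simp only [Pi.smul_apply, smul_eq_mul, mul_assoc]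

/-- `A h` is the projection of `A_w B` to the spectral past, which is a statement about `h` in
`L₂(f)`. -/
theorem isSpectralCharacteristic_hFun (hs : ∀ i, 0 < s i) (hμ : ∀ i, 0 < μ i)
    (hA : IsDensityFactor f A) (hmin : IsMinimal s d μ f) (a : ℕ → ℂ) (M : ℕ) {c : ℕ → Fin T → ℂ}
    (hc : FApply s d μ f c (bCoeff T s d μ a M)) {C : ℝ → Fin T → ℂ} (hC : IsSymbol c C) :
    IsSpectralCharacteristic T s d μ f a M (hFun T s d μ f a M C) := by
  set hA' := hA.isMinimalFactor hs hμ hmin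
  set B := trigPoly hA' (M / T) (bCoeff T s d μ a M) with hB
  set Q := (specPast hA' (-1)).starProjection B with hQ
  have hQh : ∀ᵐ θ ∂circ, (Q θ).ofLp = (A θ).mulVec (hFun T s d μ f a M C θ) :=
    ae_mulVec_hFun hs hμ hA hmin a M hc hC
  refine ⟨aestronglyMeasurable_of_mulVec hA hQh, ?_, fun k hk l => ?_⟩
  · have hQm : Q ∈ specPast hA' (-1) := Submodule.starProjection_apply_mem _ _
    obtain ⟨V, hV, hVQ⟩ := mem_closure_iff_seq_limit.1 hQm
    choose S hS hSV using fun n => exists_finsupp_of_mem_span hs hμ hA hmin (hV n)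
    refine ⟨S, hS, ?_⟩
    rw [Lp.tendsto_Lp_iff_tendsto_eLpNorm'] at hVQ
    have h0 : Tendsto (fun n => eLpNorm (⇑(V n) - ⇑Q) 2 circ ^ 2) atTop (𝓝 0) := by
      simpa using ENNReal.Tendsto.pow (n := 2) hVQ
    refine h0.congr fun n => ?_
    rw [sqNorm_eq_eLpNorm hA.mul_eq]
    congr 1
    refine eLpNorm_congr_ae ?_
    filter_upwards [hSV n, hQh] with θ h1 h2
    refine WithLp.ofLp_injective 2 ?_
    rw [Pi.sub_apply, WithLp.ofLp_sub, h1, h2, ← Matrix.mulVec_sub]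
    rfl
  · have h1 := (mem_orthogonal_specPast hA').1
      (residual_mem_orthogonal hA' (M / T) (bCoeff T s d μ a M)) k hk l
    rw [inner_eq_integral] at h1
    rw [← h1]
    refine integral_congr_ae ?_
    have hR : residual hA' (M / T) (bCoeff T s d μ a M) = B - Q := rfl
    filter_upwards [hA.mul_eq, hQh, coeFn_gen hs hμ hA hmin k l, Lp.coeFn_sub B Q,
      coeFn_trigPoly hA' (M / T) (bCoeff T s d μ a M)] with θ h2 h3 h4 h5 h6
    rw [dotProduct_mulVec_star_eq h2, ← h4, hR, h5, Pi.sub_apply, WithLp.ofLp_sub, h3, hB, h6,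
      Matrix.smul_mulVec, ← Matrix.mulVec_smul, ← Matrix.mulVec_sub]
    congr 2
    ext p
    simp only [Pi.sub_apply, Pi.smul_apply, smul_eq_mul]
    rw [mul_comm]
    rfl

/-- The optimal estimate is `A_M ζ - U R = U (B - R) - V_N ξ`, and `B - R` represents the spectral
characteristic. -/
theorem isOptimalEstimate_iff_hasSpectralIntegral (hT : 0 < T) (hs : ∀ i, 0 < s i)
    (hμ : ∀ i, 0 < μ i)
    (hζ : IsPeriodicallyStationary P T s d ζ) (hA : IsDensityFactor f A) (hmin : IsMinimal s d μ f)
    (hU : ∀ (ν : Fin r → ℤ) (hν : IsStep ν) k p, U (incGen hA d hs ν k p) = incLp hζ hν k p)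
    (hU2 : ∀ V W, inner ℂ (U V) (U W) = ((1 / (2 * Real.pi) : ℝ) : ℂ) * inner ℂ V W)
    (a : ℕ → ℂ) (M : ℕ) {c : ℕ → Fin T → ℂ}
    (hc : FApply s d μ f c (bCoeff T s d μ a M)) {C : ℝ → Fin T → ℂ} (hC : IsSymbol c C)
    {Z : ℝ → Fin T → Ω → ℂ} (hZ : IsSpectralProcess P s d (blocks T ζ) f Z) (Y : Ω → ℂ) :
    IsOptimalEstimate P T s d μ ζ a M Y ↔ HasSpectralIntegral P f Z (hFun T s d μ f a M C)
      (fun ω => Y ω + initialPart T s d μ ζ a M ω) := by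
  set hA' := hA.isMinimalFactor hs hμ hmin with hA'_def
  set B := trigPoly hA' (M / T) (bCoeff T s d μ a M) with hB
  set Q := (specPast hA' (-1)).starProjection B with hQ
  have hQh : ∀ᵐ θ ∂circ, (Q θ).ofLp = (A θ).mulVec (hFun T s d μ f a M C θ) :=
    ae_mulVec_hFun hs hμ hA hmin a M hc hC
  have hR : optResidual hs hμ hA hmin a M = B - Q := rfl
  rw [isOptimalEstimate_iff hT hs hμ hζ hA hmin hU hU2,
    hasSpectralIntegral_iff hA.mul_eq hA.memLp hA.isUnit U (hZ.eq_isometry hζ hA hs hμ hmin hU)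
      (aestronglyMeasurable_of_mulVec hA hQh), hR, map_sub]
  have hfun : ∀ᵐ ω ∂P, functional a M ζ ω - Y ω = (U B - U Q) ω ↔
      Y ω + initialPart T s d μ ζ a M ω = U Q ω := by
    filter_upwards [ae_trigPoly hs hμ hζ hA hmin hU a M, Lp.coeFn_sub (U B) (U Q)] with ω h1 h2
    have h3 : functional a M ζ ω = U B ω - initialPart T s d μ ζ a M ω := by
      rw [hB, h1]
      exact sum_eq_sum_bCoeff_sub hT hs hμ a M fun j => ζ j ω
    rw [h2, Pi.sub_apply, h3]
    constructor
    · intro h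
      linear_combination -h
    · intro h
      linear_combination -h
  constructor
  · intro h
    refine ⟨Q, hQh, ?_⟩
    filter_upwards [h, hfun] with ω h1 h2 using h2.1 h1
  · rintro ⟨V, hV, hVY⟩
    have hVQ : V = Q := ae_eq_of_ofLp <| by
      filter_upwards [hV, hQh] with θ h1 h2
      rw [h1, h2]
    rw [hVQ] at hVY
    filter_upwards [hVY, hfun] with ω h1 h2 using h2.2 h1

/-- The density of the mean square error is the squared norm of the residual. -/
theorem ae_error_density (hs : ∀ i, 0 < s i) (hμ : ∀ i, 0 < μ i) (hA : IsDensityFactor f A)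
    (hmin : IsMinimal s d μ f) (a : ℕ → ℂ) (M : ℕ) {c : ℕ → Fin T → ℂ}
    (hc : FApply s d μ f c (bCoeff T s d μ a M)) {C : ℝ → Fin T → ℂ} (hC : IsSymbol c C) :
    ∀ᵐ θ ∂circ, star (optResidual hs hμ hA hmin a M θ).ofLp ⬝ᵥ
        (optResidual hs hμ hA hmin a M θ).ofLp =
      star (beta s d θ) / chi s d (zstep μ) (-θ) * (C θ ⬝ᵥ ((f θ)⁻¹).mulVec (star (C θ))) *
        (beta s d θ / chi s d (zstep μ) θ) := by
  filter_upwards [ae_symbol_eq hs hμ hA hmin a M hc hC,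
    hA.mul_eq, hA.isUnit, ae_symbolRatio_ne_zero s d hs μ hμ] with θ h3 h4 h5 h6
  set w := symbolRatio s d (zstep μ) θ with hw
  set R := (optResidual hs hμ hA hmin a M θ).ofLp
  have h8 : Matrix.vecMul (C θ) (f θ)⁻¹ = star w • (A θ)⁻¹.mulVec R := by
    rw [← Matrix.mulVec_transpose, Matrix.transpose_nonsing_inv, ← h4, h3,
      Matrix.conjTranspose_smul, Matrix.smul_mulVec, Matrix.mulVec_smul,
      inv_mul_conjTranspose_mulVec h5]
  have h9 : beta s d θ / chi s d (zstep μ) θ = w⁻¹ := by rw [hw, symbolRatio, inv_div]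
  have h10 : (A θ)⁻¹.mulVec R ⬝ᵥ star (C θ) = w * (star R ⬝ᵥ R) := by
    rw [h3, Matrix.star_mulVec, Matrix.conjTranspose_conjTranspose, Matrix.vecMul_smul,
      dotProduct_smul, smul_eq_mul, dotProduct_comm, ← Matrix.dotProduct_mulVec,
      Matrix.mulVec_mulVec, Matrix.mul_nonsing_inv _ ((Matrix.isUnit_iff_isUnit_det _).1 h5),
      Matrix.one_mulVec]
  rw [star_beta_div_chi_neg, h9, Matrix.dotProduct_mulVec, h8, smul_dotProduct, h10, smul_eq_mul,
    ← hw, star_inv₀]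
  have h11 : star w ≠ 0 := star_ne_zero.2 h6
  field_simp

/-- `‖R‖² = ⟨B, R⟩`, in terms of Fourier coefficients. -/
theorem norm_sq_residual (hA : IsMinimalFactor A) (N : ℕ) (b : ℕ → Fin T → ℂ) :
    ((1 / (2 * Real.pi) * ‖residual hA N b‖ ^ 2 : ℝ) : ℂ) =
      ∑ k ∈ Finset.range (N + 1), b k ⬝ᵥ star (residualCoeff hA N b k) := by
  have h1 : inner ℂ (residual hA N b) (residual hA N b) =
      inner ℂ (residual hA N b) (trigPoly hA N b) := by
    conv_lhs => arg 3; rw [residual]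
    rw [inner_sub_right, (Submodule.mem_orthogonal' _ _).1 (residual_mem_orthogonal hA N b) _
      (Submodule.starProjection_apply_mem _ _), sub_zero]
  rw [inner_self_eq_norm_sq_to_K] at h1
  push_cast
  have h2 : ((‖residual hA N b‖ : ℝ) : ℂ) ^ 2 = inner ℂ (residual hA N b) (trigPoly hA N b) := h1
  rw [h2, trigPoly]
  simp only [inner_sum, inner_smul_right, dotProduct, Finset.mul_sum]
  refine Finset.sum_congr rfl fun k _ => Finset.sum_congr rfl fun p _ => ?_
  rw [Pi.star_apply, residualCoeff, ← inner_gen hA, star_mul', ← inner_conj_symm (residual hA N b)]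
  simp only [star_div₀, star_one, Complex.star_def, map_mul, Complex.conj_ofReal, map_ofNat]
  ring

end

/-! ### The canonical factorization -/

section
variable {H : Type*} [NormedAddCommGroup H] [InnerProductSpace ℂ H]

theorem mem_orthogonal_closure_span_iff {S : Set H} {v : H} :
    v ∈ (Submodule.span ℂ S).topologicalClosureᗮ ↔ ∀ u ∈ S, inner ℂ u v = 0 := by
  rw [Submodule.orthogonal_closure, Submodule.mem_orthogonal]
  refine ⟨fun h u hu => h u (Submodule.subset_span hu), fun h u hu => ?_⟩
  induction hu using Submodule.span_induction with
  | mem x hx => exact h x hx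
  | zero => simp
  | add x y _ _ hx hy => rw [inner_add_left, hx, hy, add_zero]
  | smul a x _ hx => rw [inner_smul_left, hx, mul_zero]

/-- If a finite family together with a closed subspace `K` spans a subspace that contains an
orthonormal family orthogonal to `K`, then the orthonormal family is not the larger one. -/
theorem card_le_of_orthonormal_of_mem [CompleteSpace H] {m n : ℕ} {S : Set H} (x : Fin n → H)
    (e : Fin m → H) (he : Orthonormal ℂ e)
    (hmem : ∀ j, e j ∈ (Submodule.span ℂ (S ∪ Set.range x)).topologicalClosure)
    (horth : ∀ j, ∀ u ∈ S, inner ℂ u (e j) = 0) : m ≤ n := by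
  set K := (Submodule.span ℂ S).topologicalClosure with hK
  have : CompleteSpace K := (Submodule.isClosed_topologicalClosure _).completeSpace_coe
  set L : Submodule ℂ H := Submodule.span ℂ (Set.range fun i => Kᗮ.starProjection (x i)) with hL
  have hLc : IsClosed (L : Set H) := by
    have : FiniteDimensional ℂ L := FiniteDimensional.span_of_finite ℂ (Set.finite_range _)
    exact L.closed_of_finiteDimensional
  have hle : (Submodule.span ℂ (S ∪ Set.range x)).topologicalClosure ≤
      L.comap (Kᗮ.starProjection : H →ₗ[ℂ] H) := by
    refine Submodule.topologicalClosure_minimal _ (Submodule.span_le.2 ?_)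
      (hLc.preimage (Kᗮ.starProjection).continuous)
    rintro u (hu | ⟨i, rfl⟩)
    · have h1 : u ∈ K := Submodule.le_topologicalClosure _ (Submodule.subset_span hu)
      have h2 : Kᗮ.starProjection u = 0 := by
        rw [Submodule.starProjection_apply_eq_zero_iff, Submodule.orthogonal_orthogonal]
        exact h1
      change Kᗮ.starProjection u ∈ L
      rw [h2]
      exact Submodule.zero_mem _
    · exact Submodule.subset_span ⟨i, rfl⟩
  -- `e` is unchanged by the projection to `Kᗮ`, which maps the whole span to that of the images of `x`
  have hin : Set.range e ⊆ L := by
    rintro _ ⟨j, rfl⟩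
    have h1 : e j ∈ Kᗮ := mem_orthogonal_closure_span_iff.2 (horth j)
    have h2 : Kᗮ.starProjection (e j) ∈ L := hle (hmem j)
    rwa [Submodule.starProjection_eq_self_iff.2 h1] at h2
  have := (Set.finite_range fun i => Kᗮ.starProjection (x i)).fintype
  have h3 := linearIndependent_le_span' e he.linearIndependent
    (Set.range fun i => Kᗮ.starProjection (x i)) hin
  rw [Cardinal.mk_fin, Nat.cast_le] at h3
  refine h3.trans ?_
  have h4 := Nat.card_le_card_of_surjective _
    (Set.rangeFactorization_surjective (f := fun i => Kᗮ.starProjection (x i)))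
  rwa [Nat.card_eq_fintype_card, Nat.card_fin] at h4

end

section
variable {r T q : ℕ} {s d μ : Fin r → ℕ} {f A : ℝ → Matrix (Fin T) (Fin T) ℂ}
  {Ω : Type*} [MeasurableSpace Ω] {P : Measure Ω} {ζ : ℤ → Ω → ℂ} {U : VecL2 T →L[ℂ] Lp ℂ 2 P}

theorem past_eq_closure_span {n : ℕ} {X : ℤ → Fin n → Ω → ℂ}
    (hX : ∀ m i, MemLp (X m i) 2 P) (t : ℤ) :
    past P X t = (Submodule.span ℂ
      {g : Lp ℂ 2 P | ∃ m ≤ t, ∃ i, g = (hX m i).toLp}).topologicalClosure := by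
  rw [past]
  congr 3
  ext g
  refine exists_congr fun m => and_congr_right fun _ => exists_congr fun i => ?_
  constructor
  · intro h
    exact Lp.ext (h.trans (hX m i).coeFn_toLp.symm)
  · rintro rfl
    exact (hX m i).coeFn_toLp

variable {X : ℤ → Fin T → Ω → ℂ} {φ : ℕ → Matrix (Fin T) (Fin q) ℂ} {ε : ℤ → Fin q → Ω → ℂ}

/-- The innovations as elements of `L₂(P)`. -/
def innovLp (h : IsCanonicalMA P X φ ε) (u : ℤ) (j : Fin q) : Lp ℂ 2 P := (h.memLp u j).toLp

theorem inner_innovLp (h : IsCanonicalMA P X φ ε) (u v : ℤ) (i j : Fin q) :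
    inner ℂ (innovLp h u i) (innovLp h v j) = if i = j ∧ u = v then 1 else 0 := by
  rw [innovLp, innovLp, inner_toLp, h.orthonormal]
  simp only [eq_comm]

/-- The moving average coefficients are the inner products with the innovations. -/
theorem inner_innovLp_toLp (h : IsCanonicalMA P X φ ε) (hX : ∀ m i, MemLp (X m i) 2 P) (u m : ℤ)
    (j : Fin q) (p : Fin T) : inner ℂ (innovLp h u j) (hX m p).toLp =
      if u ≤ m then φ (m - u).toNat p j else 0 := by
  let S : ℕ → Lp ℂ 2 P := fun n => ∑ k ∈ Finset.range n, ∑ i, φ k p i • innovLp h (m - (k : ℤ)) i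
  have hS : ∀ n, ∀ᵐ ω ∂P, S n ω =
      ∑ k ∈ Finset.range n, (φ k).mulVec (fun j => ε (m - (k : ℤ)) j ω) p := by
    intro n
    filter_upwards [Lp.coeFn_fun_finsetSum (Finset.range n) fun k =>
        ∑ i, φ k p i • innovLp h (m - (k : ℤ)) i,
      ae_all_iff.2 fun k : ℕ => Lp.coeFn_fun_finsetSum Finset.univ fun i =>
        φ k p i • innovLp h (m - (k : ℤ)) i,
      ae_all_iff.2 fun k : ℕ => ae_all_iff.2 fun i =>
        Lp.coeFn_smul (φ k p i) (innovLp h (m - (k : ℤ)) i),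
      ae_all_iff.2 fun k : ℕ => ae_all_iff.2 fun i =>
        (h.memLp (m - (k : ℤ)) i).coeFn_toLp] with ω h1 h2 h3 h4
    rw [h1]
    refine Finset.sum_congr rfl fun k _ => ?_
    rw [h2]
    refine Finset.sum_congr rfl fun i _ => ?_
    rw [h3, Pi.smul_apply, innovLp, h4, smul_eq_mul]
  have hlim : Tendsto S atTop (𝓝 (hX m p).toLp) := by
    rw [Lp.tendsto_Lp_iff_tendsto_eLpNorm']
    refine (h.representation m p).congr fun n => eLpNorm_congr_ae ?_
    filter_upwards [hS n, (hX m p).coeFn_toLp] with ω h1 h2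
    rw [Pi.sub_apply, h1, h2]
  have hin : ∀ n, inner ℂ (innovLp h u j) (S n) =
      ∑ k ∈ Finset.range n, if m - (k : ℤ) = u then φ k p j else 0 := by
    intro n
    simp only [S, inner_sum, inner_smul_right, inner_innovLp]
    refine Finset.sum_congr rfl fun k _ => ?_
    by_cases hk : m - (k : ℤ) = u
    · simp [hk]
    · simp [hk, Ne.symm hk]
  have hlim2 : Tendsto (fun n => inner ℂ (innovLp h u j) (S n)) atTop
      (𝓝 (inner ℂ (innovLp h u j) (hX m p).toLp)) :=
    ((innerSL ℂ (innovLp h u j)).continuous.tendsto _).comp hlim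
  refine tendsto_nhds_unique hlim2 (tendsto_const_nhds.congr' ?_)
  filter_upwards [eventually_gt_atTop (m - u).toNat] with n hn
  rw [hin]
  split_ifs with hu
  · rw [Finset.sum_eq_single (m - u).toNat]
    · rw [if_pos (by omega)]
    · intro k _ hk
      rw [if_neg (by omega)]
    · intro hk
      exact absurd (Finset.mem_range.2 hn) hk
  · refine (Finset.sum_eq_zero fun k _ => if_neg ?_).symm
    omega

/-- The number of innovations does not exceed the dimension: the projections of the `T` present
values off the past span the innovations. -/
theorem IsCanonicalMA.card_le (h : IsCanonicalMA P X φ ε) (hX : ∀ m i, MemLp (X m i) 2 P) :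
    q ≤ T := by
  refine card_le_of_orthonormal_of_mem
    (S := {g : Lp ℂ 2 P | ∃ m ≤ (-1 : ℤ), ∃ i, g = (hX m i).toLp})
    (fun i => (hX 0 i).toLp) (innovLp h 0) ?_ (fun j => ?_) fun j u hu => ?_
  · rw [orthonormal_iff_ite]
    intro i j
    simp [inner_innovLp]
  · have h1 : innovLp h 0 j ∈ past P X 0 := by
      rw [h.past_eq, past_eq_closure_span h.memLp]
      exact Submodule.le_topologicalClosure _ (Submodule.subset_span ⟨0, le_rfl, j, rfl⟩)
    rw [past_eq_closure_span hX] at h1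
    refine Submodule.topologicalClosure_mono (Submodule.span_mono ?_) h1
    rintro _ ⟨m, hm, i, rfl⟩
    rcases hm.eq_or_lt with rfl | hm
    · exact Or.inr ⟨i, rfl⟩
    · exact Or.inl ⟨m, by omega, i, rfl⟩
  · have h1 : u ∈ past P X (-1) := by
      rw [past_eq_closure_span hX]
      exact Submodule.le_topologicalClosure _ (Submodule.subset_span hu)
    rw [h.past_eq, past_eq_closure_span h.memLp] at h1
    refine (Submodule.mem_orthogonal _ _).1 (mem_orthogonal_closure_span_iff.2 ?_) u h1
    rintro _ ⟨m, hm, i, rfl⟩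
    have := inner_innovLp h m 0 i j
    rw [if_neg (by omega)] at this
    exact this

/-- An element of the past at time `N` orthogonal to the past at time `-1` is a combination of the
innovations at times `0, …, N`. -/
theorem IsCanonicalMA.eq_sum_innovLp (h : IsCanonicalMA P X φ ε) {N : ℕ} {D : Lp ℂ 2 P}
    (h1 : D ∈ past P X N) (h2 : D ∈ (past P X (-1))ᗮ) :
    D = ∑ k ∈ Finset.range (N + 1), ∑ j, inner ℂ (innovLp h (k : ℤ) j) D • innovLp h (k : ℤ) j := by
  set D' := ∑ k ∈ Finset.range (N + 1), ∑ j,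
    inner ℂ (innovLp h (k : ℤ) j) D • innovLp h (k : ℤ) j with hD'
  have hinn : ∀ u : ℤ, u ≤ N → ∀ j, innovLp h u j ∈ past P X N := by
    intro u hu j
    rw [h.past_eq, past_eq_closure_span h.memLp]
    exact Submodule.le_topologicalClosure _ (Submodule.subset_span ⟨u, hu, j, rfl⟩)
  have hmem : D - D' ∈ past P X N := by
    refine Submodule.sub_mem _ h1 (Submodule.sum_mem _ fun k hk => Submodule.sum_mem _ fun j _ =>
      Submodule.smul_mem _ _ (hinn _ ?_ j))
    have := Finset.mem_range.1 hk
    omega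
  have horth : D - D' ∈ (past P X N)ᗮ := by
    rw [h.past_eq, past_eq_closure_span h.memLp, mem_orthogonal_closure_span_iff]
    rintro _ ⟨u, hu, i, rfl⟩
    change inner ℂ (innovLp h u i) _ = 0
    rw [inner_sub_right, sub_eq_zero, hD']
    simp only [inner_sum, inner_smul_right, inner_innovLp]
    rcases lt_or_ge u 0 with hu0 | hu0
    · rw [h.past_eq, past_eq_closure_span h.memLp, mem_orthogonal_closure_span_iff] at h2
      rw [Finset.sum_eq_zero]
      · exact h2 _ ⟨u, by omega, i, rfl⟩
      · intro k _
        refine Finset.sum_eq_zero fun j _ => ?_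
        rw [if_neg (by omega), mul_zero]
    · obtain ⟨n, rfl⟩ := Int.eq_ofNat_of_zero_le hu0
      rw [Finset.sum_eq_single n, Finset.sum_eq_single i]
      · simp
      · intro j _ hj
        rw [if_neg (by rintro ⟨rfl, -⟩; exact hj rfl), mul_zero]
      · simp
      · intro k _ hk
        refine Finset.sum_eq_zero fun j _ => ?_
        rw [if_neg (by omega), mul_zero]
      · intro hn
        exact absurd (Finset.mem_range.2 (by omega)) hn
  exact sub_eq_zero.1 (inner_self_eq_zero.1 ((Submodule.mem_orthogonal _ _).1 horth _ hmem))

/-- `r(k)` in terms of `b_N`. -/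
theorem rCoeff_eq (T : ℕ) (s d μ : Fin r → ℕ) (a : ℕ → ℂ) (M : ℕ) (hT : 0 < T)
    (φ : ℕ → Matrix (Fin T) (Fin q) ℂ) (k : ℕ) (j : Fin q) :
    rCoeff T s d μ a M φ k j = ∑ i ∈ Finset.Icc k (M / T), ∑ p,
      bCoeff T s d μ a M i p * φ (i - k) p j := by
  set N := M / T with hN
  have hv : ∀ m, N < m → ∀ p, vecCoeff T a M m p = 0 := by
    intro m hm p
    rw [vecCoeff, if_neg]
    intro hle
    have h1 : m ≤ M / T := (Nat.le_div_iff_mul_le hT).2 (by omega)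
    omega
  have h1 : ∀ (m l : ℕ), N < m + l →
      (φ m).transpose.mulVec (vecCoeff T a M (m + l)) j * dCoeff s d μ (l - k) = 0 := by
    intro m l hml
    have : vecCoeff T a M (m + l) = 0 := funext fun p => hv _ hml p
    rw [this, Matrix.mulVec_zero, Pi.zero_apply, zero_mul]
  -- the pairs `(m, l)` correspond to `(i, n) = (m + k, m + l)`
  have h2 : ∀ i, ∑ p, bCoeff T s d μ a M i p * φ (i - k) p j = ∑ n ∈ Finset.Icc i N,
      (φ (i - k)).transpose.mulVec (vecCoeff T a M n) j * dCoeff s d μ (n - i) := by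
    intro i
    simp only [bCoeff, Finset.sum_mul, Matrix.mulVec, dotProduct, Matrix.transpose_apply]
    rw [Finset.sum_comm]
    exact Finset.sum_congr rfl fun n _ => Finset.sum_congr rfl fun p _ => by ring
  simp only [h2]
  rw [rCoeff, Finset.sum_sigma', Finset.sum_sigma', ← Finset.sum_filter_of_ne
    (p := fun x : (_ : ℕ) × ℕ => x.1 + x.2 ≤ N)]
  · refine Finset.sum_bij' (fun x _ => ⟨x.1 + k, x.1 + x.2⟩) (fun x _ => ⟨x.1 - k, x.2 + k - x.1⟩)
      ?_ ?_ ?_ ?_ ?_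
    · rintro ⟨m, l⟩ hx
      simp only [Finset.mem_sigma, Finset.mem_Icc, Finset.mem_range, Finset.mem_filter] at hx ⊢
      omega
    · rintro ⟨m, l⟩ hx
      simp only [Finset.mem_sigma, Finset.mem_Icc, Finset.mem_range, Finset.mem_filter] at hx ⊢
      omega
    · rintro ⟨m, l⟩ hx
      simp only [Finset.mem_sigma, Finset.mem_Icc, Finset.mem_range, Finset.mem_filter] at hx
      simp only [Sigma.mk.injEq, heq_eq_eq]
      omega
    · rintro ⟨m, l⟩ hx
      simp only [Finset.mem_sigma, Finset.mem_Icc] at hx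
      simp only [Sigma.mk.injEq, heq_eq_eq]
      omega
    · rintro ⟨m, l⟩ hx
      simp only [Finset.mem_sigma, Finset.mem_Icc, Finset.mem_range, Finset.mem_filter] at hx
      simp only
      rw [Nat.add_sub_cancel, show m + l - (m + k) = l - k by omega]
  · rintro ⟨m, l⟩ - hne
    by_contra hlt
    exact hne (h1 m l (not_le.1 hlt))

theorem map_mem_past (hs : ∀ i, 0 < s i) (hμ : ∀ i, 0 < μ i)
    (hζ : IsPeriodicallyStationary P T s d ζ) (hA : IsDensityFactor f A) (hmin : IsMinimal s d μ f)
    (hU : ∀ (ν : Fin r → ℤ) (hν : IsStep ν) k p, U (incGen hA d hs ν k p) = incLp hζ hν k p)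
    {n : ℤ} {V : VecL2 T} (hV : V ∈ specPast (hA.isMinimalFactor hs hμ hmin) n) :
    U V ∈ past P (vecIncrement s d (zstep μ) (blocks T ζ)) n := by
  have hle : specPast (hA.isMinimalFactor hs hμ hmin) n ≤
      (past P (vecIncrement s d (zstep μ) (blocks T ζ)) n).comap (U : VecL2 T →ₗ[ℂ] Lp ℂ 2 P) := by
    refine Submodule.topologicalClosure_minimal _ (Submodule.span_le.2 ?_)
      ((Submodule.isClosed_topologicalClosure _).preimage U.continuous)
    rintro _ ⟨k, hk, l, rfl⟩
    change U (gen _ k l) ∈ past P (vecIncrement s d (zstep μ) (blocks T ζ)) n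
    rw [past_eq_closure_span fun m i => memLp_vecIncrement hζ (isStep_zstep hμ) m i]
    exact Submodule.le_topologicalClosure _ (Submodule.subset_span
      ⟨k, hk, l, hU _ (isStep_zstep hμ) k l⟩)
  exact hle hV

/-- The error of the optimal estimate is `∑_{k ≤ N} r(k)ᵀ ε(k)`: it lies in the past at time `N` and
is orthogonal to the past at time `-1`, and its inner products with the innovations in between are
those of `B_N χ ξ`. -/
theorem map_optResidual (hT : 0 < T) (hs : ∀ i, 0 < s i) (hμ : ∀ i, 0 < μ i)
    (hζ : IsPeriodicallyStationary P T s d ζ) (hA : IsDensityFactor f A) (hmin : IsMinimal s d μ f)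
    (hU : ∀ (ν : Fin r → ℤ) (hν : IsStep ν) k p, U (incGen hA d hs ν k p) = incLp hζ hν k p)
    (hU2 : ∀ V W, inner ℂ (U V) (U W) = ((1 / (2 * Real.pi) : ℝ) : ℂ) * inner ℂ V W)
    (h : IsCanonicalMA P (vecIncrement s d (zstep μ) (blocks T ζ)) φ ε) (a : ℕ → ℂ) (M : ℕ) :
    U (optResidual hs hμ hA hmin a M) = ∑ k ∈ Finset.range (M / T + 1), ∑ j,
      rCoeff T s d μ a M φ k j • innovLp h (k : ℤ) j := by
  set hA' := hA.isMinimalFactor hs hμ hmin with hA'_def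
  have hX := fun m (i : Fin T) => memLp_vecIncrement hζ (isStep_zstep hμ) m i
  have hg : ∀ k p, U (gen hA' k p) = (hX k p).toLp := hU _ (isStep_zstep hμ)
  set B := trigPoly hA' (M / T) (bCoeff T s d μ a M) with hB
  set Q := (specPast hA' (-1)).starProjection B with hQ
  have hR : optResidual hs hμ hA hmin a M = B - Q := rfl
  have h1 := map_mem_past hs hμ hζ hA hmin hU
    (residual_mem_specPast hA' (M / T) (bCoeff T s d μ a M))
  have h2 : U (optResidual hs hμ hA hmin a M) ∈
      (past P (vecIncrement s d (zstep μ) (blocks T ζ)) (-1))ᗮ := by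
    rw [past_eq_closure_span hX, mem_orthogonal_closure_span_iff]
    rintro _ ⟨m, hm, i, rfl⟩
    rw [← hg, hU2, (mem_orthogonal_specPast hA').1 (residual_mem_orthogonal hA' _ _) m hm i,
      mul_zero]
  rw [h.eq_sum_innovLp h1 h2]
  refine Finset.sum_congr rfl fun k hk => Finset.sum_congr rfl fun j _ => ?_
  congr 1
  have hk' := Finset.mem_range.1 hk
  have h3 : inner ℂ (innovLp h (k : ℤ) j) (U Q) = 0 := by
    have h4 := map_mem_past hs hμ hζ hA hmin hU (n := -1) (V := Q)
      (Submodule.starProjection_apply_mem _ _)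
    rw [h.past_eq, past_eq_closure_span h.memLp] at h4
    refine (Submodule.mem_orthogonal' _ _).1 (mem_orthogonal_closure_span_iff.2 ?_) _ h4
    rintro _ ⟨m, hm, i, rfl⟩
    have := inner_innovLp h m k i j
    rw [if_neg (by omega)] at this
    exact this
  change inner ℂ _ (U (optResidual hs hμ hA hmin a M)) = _
  rw [hR, map_sub, inner_sub_right, h3, sub_zero, hB, trigPoly]
  simp only [map_sum, map_smul, hg, inner_sum, inner_smul_right, inner_innovLp_toLp]
  rw [rCoeff_eq T s d μ a M hT]
  have h5 : Finset.Icc k (M / T) = (Finset.range (M / T + 1)).filter fun i => k ≤ i := by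
    ext i
    simp only [Finset.mem_Icc, Finset.mem_filter, Finset.mem_range]
    omega
  rw [h5, Finset.sum_filter]
  refine Finset.sum_congr rfl fun i _ => ?_
  by_cases hki : k ≤ i
  · rw [if_pos hki]
    refine Finset.sum_congr rfl fun p _ => ?_
    rw [if_pos (by exact_mod_cast hki), show ((i : ℤ) - (k : ℤ)).toNat = i - k by omega]
  · rw [if_neg hki]
    refine Finset.sum_eq_zero fun p _ => ?_
    rw [if_neg (by exact_mod_cast hki), mul_zero]

/-- The symbol `C = A_wᴴ R` of the solution is `conj(Φ) r`: the Fourier coefficients of `A_wᴴ R` are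
inner products of the increments with the error `∑ r(k)ᵀ ε(k)`. -/
theorem ae_symbol_eq_factor (hT : 0 < T) (hs : ∀ i, 0 < s i) (hμ : ∀ i, 0 < μ i)
    (hζ : IsPeriodicallyStationary P T s d ζ) (hA : IsDensityFactor f A) (hmin : IsMinimal s d μ f)
    (hU : ∀ (ν : Fin r → ℤ) (hν : IsStep ν) k p, U (incGen hA d hs ν k p) = incLp hζ hν k p)
    (hU2 : ∀ V W, inner ℂ (U V) (U W) = ((1 / (2 * Real.pi) : ℝ) : ℂ) * inner ℂ V W)
    {Φ : ℝ → Matrix (Fin T) (Fin q) ℂ}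
    (h : IsCanonicalFactorization P s d μ (blocks T ζ) f φ Φ) (a : ℕ → ℂ) (M : ℕ)
    {c : ℕ → Fin T → ℂ}
    (hc : FApply s d μ f c (bCoeff T s d μ a M)) {C : ℝ → Fin T → ℂ} (hC : IsSymbol c C) :
    ∀ᵐ θ ∂circ, C θ = Matrix.vecMul (rFun T s d μ a M φ θ) (Φ θ).conjTranspose := by
  obtain ⟨ε, hε⟩ := h.movingAverage
  set hA' := hA.isMinimalFactor hs hμ hmin with hA'_def
  have hX := fun m (i : Fin T) => memLp_vecIncrement hζ (isStep_zstep hμ) m i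
  have hg : ∀ k p, U (gen hA' k p) = (hX k p).toLp := hU _ (isStep_zstep hμ)
  have hpi := two_pi_ne_zero
  have hterm : ∀ (p : Fin T) (k : ℕ) (j : Fin q),
      MemLp (fun θ => ex (k : ℤ) θ * star (Φ θ p j)) 2 circ := fun p k j =>
    memLp_ex_mul (h.series p j).1.star k
  have hexp : ∀ p θ, Matrix.vecMul (rFun T s d μ a M φ θ) (Φ θ).conjTranspose p =
      ∑ k ∈ Finset.range (M / T + 1), ∑ j,
        rCoeff T s d μ a M φ k j * (ex (k : ℤ) θ * star (Φ θ p j)) := by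
    intro p θ
    simp only [Matrix.vecMul, dotProduct, rFun, Matrix.conjTranspose_apply, Finset.sum_mul]
    rw [Finset.sum_comm]
    exact Finset.sum_congr rfl fun k _ => Finset.sum_congr rfl fun j _ => by ring
  have hmem : ∀ p, MemLp (fun θ => Matrix.vecMul (rFun T s d μ a M φ θ) (Φ θ).conjTranspose p) 2
      circ := by
    intro p
    simp only [hexp]
    exact memLp_finsetSum _ fun k _ => memLp_finsetSum _ fun j _ => (hterm p k j).const_mul _
  -- the Fourier coefficients of `conj(Φ)` are conjugates of `φ`
  have hcoef : ∀ (p : Fin T) (k : ℕ) (j : Fin q) (n : ℤ),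
      ∫ θ, ex (-n) θ * (ex (k : ℤ) θ * star (Φ θ p j)) ∂circ =
        2 * (Real.pi : ℂ) * star (if (k : ℤ) ≤ n then φ (n - k).toNat p j else 0) := by
    intro p k j n
    have h1 := congrArg star ((h.series p j).2 (k - n))
    have h2 : ∫ θ, ex (-n) θ * (ex (k : ℤ) θ * star (Φ θ p j)) ∂circ =
        star (∫ θ, ex (-(k - n)) θ * Φ θ p j ∂circ) := by
      rw [Complex.star_def, ← integral_conj]
      refine integral_congr_ae (Eventually.of_forall fun θ => ?_)
      simp only [map_mul, ← Complex.star_def, star_ex]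
      rw [← mul_assoc, ex_add]
      congr 2
      ring
    have h3 : (if (k : ℤ) - n ≤ 0 then φ (-((k : ℤ) - n)).toNat p j else 0) =
        if (k : ℤ) ≤ n then φ (n - k).toNat p j else 0 := by
      rw [neg_sub]
      simp only [sub_nonpos]
    dsimp only at h1
    rw [h3] at h1
    rw [h2, ← h1, star_mul']
    simp only [star_div₀, star_one, star_mul', Complex.star_def, Complex.conj_ofReal, map_ofNat]
    field_simp
  have key : ∀ p, ∀ᵐ θ ∂circ, (symbolRatio s d (zstep μ) θ • A θ).conjTranspose.mulVec
      (optResidual hs hμ hA hmin a M θ).ofLp p =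
        Matrix.vecMul (rFun T s d μ a M φ θ) (Φ θ).conjTranspose p := by
    intro p
    refine ae_eq_of_coeff_eq (memLp_conjTranspose_mulVec_residual hA' _ _ p) (hmem p) fun n => ?_
    have h1 := hU2 (gen hA' n p) (optResidual hs hμ hA hmin a M)
    rw [hg, map_optResidual hT hs hμ hζ hA hmin hU hU2 hε] at h1
    rw [← inner_gen hA']
    have h2 : inner ℂ (gen hA' n p) (residual hA' (M / T) (bCoeff T s d μ a M)) =
        2 * (Real.pi : ℂ) * inner ℂ (hX n p).toLp (∑ k ∈ Finset.range (M / T + 1), ∑ j,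
          rCoeff T s d μ a M φ k j • innovLp hε (k : ℤ) j) := by
      rw [h1]
      push_cast
      field_simp
    rw [h2]
    simp only [hexp, Finset.mul_sum]
    rw [integral_finsetSum _ fun k _ => ?_]
    · simp only [inner_sum, inner_smul_right, Finset.mul_sum]
      refine Finset.sum_congr rfl fun k _ => ?_
      rw [integral_finsetSum _ fun j _ => ?_]
      · refine Finset.sum_congr rfl fun j _ => ?_
        have h3 : ∀ θ, ex (-n) θ * (rCoeff T s d μ a M φ k j * (ex (k : ℤ) θ * star (Φ θ p j))) =
            rCoeff T s d μ a M φ k j * (ex (-n) θ * (ex (k : ℤ) θ * star (Φ θ p j))) :=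
          fun θ => by ring
        simp only [h3]
        rw [integral_const_mul, hcoef, ← inner_conj_symm, inner_innovLp_toLp hε hX,
          Complex.star_def]
        ring
      · exact integrable_ex_mul (((hterm p k j).const_mul _).integrable (by norm_num)) _
    · exact integrable_finsetSum _ fun j _ =>
        integrable_ex_mul (((hterm p k j).const_mul _).integrable (by norm_num)) _
  filter_upwards [ae_all_iff.2 key, ae_symbol_eq hs hμ hA hmin a M hc hC] with θ h1 h2
  rw [h2]
  exact funext h1

/-- `Φ Φ^*` is a nonzero multiple of the invertible density. -/
theorem ae_isUnit_factor (hs : ∀ i, 0 < s i) (hμ : ∀ i, 0 < μ i) (hmin : IsMinimal s d μ f)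
    {Φ : ℝ → Matrix (Fin T) (Fin q) ℂ} (h : ∀ᵐ θ ∂circ,
      ((‖chi s d (zstep μ) θ‖ ^ 2 / ‖beta s d θ‖ ^ 2 : ℝ) : ℂ) • f θ =
        Φ θ * (Φ θ).conjTranspose) :
    ∀ᵐ θ ∂circ, IsUnit (Φ θ * (Φ θ).conjTranspose) := by
  filter_upwards [h, hmin.1, ae_symbolRatio_ne_zero s d hs μ hμ] with θ h1 h2 h3
  rw [← h1]
  have h4 : ((‖chi s d (zstep μ) θ‖ ^ 2 / ‖beta s d θ‖ ^ 2 : ℝ) : ℂ) ≠ 0 := by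
    rw [← div_pow, ← norm_div]
    exact_mod_cast pow_ne_zero 2 (norm_ne_zero_iff.2 h3)
  exact h2.smul (Units.mk0 _ h4)

/-- The factor is a square matrix: there are as many innovations as components. -/
theorem IsCanonicalFactorization.card_eq (hs : ∀ i, 0 < s i) (hμ : ∀ i, 0 < μ i)
    (hζ : IsPeriodicallyStationary P T s d ζ) (hmin : IsMinimal s d μ f)
    {Φ : ℝ → Matrix (Fin T) (Fin q) ℂ}
    (h : IsCanonicalFactorization P s d μ (blocks T ζ) f φ Φ) : q = T := by
  obtain ⟨ε, hε⟩ := h.movingAverage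
  refine le_antisymm
    (hε.card_le fun m i => memLp_vecIncrement hζ (isStep_zstep hμ) m i) ?_
  have : NeZero circ := ⟨circ_ne_zero⟩
  obtain ⟨θ, hθ⟩ := (ae_isUnit_factor hs hμ hmin h.factorization).exists
  have h1 := Matrix.rank_of_isUnit _ hθ
  rw [Fintype.card_fin] at h1
  rw [← h1]
  exact (Matrix.rank_mul_le_left _ _).trans (Matrix.rank_le_width _)

/-- With `Cᵀ = rᵀ Φ^*` and `f⁻¹` a multiple of `Ψ^* Ψ`, the factor `Φ^* Ψ^*` in `Cᵀ f⁻¹` cancels. -/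
theorem hFun_eq_hSimple {Φ : Matrix (Fin T) (Fin T) ℂ} {Ψ : ℝ → Matrix (Fin T) (Fin T) ℂ}
    {φ : ℕ → Matrix (Fin T) (Fin T) ℂ} {C : ℝ → Fin T → ℂ} {a : ℕ → ℂ} {M : ℕ} {θ : ℝ}
    (hw : symbolRatio s d (zstep μ) θ ≠ 0) (hΨ : Ψ θ * Φ = 1)
    (hΦ : ((‖chi s d (zstep μ) θ‖ ^ 2 / ‖beta s d θ‖ ^ 2 : ℝ) : ℂ) • f θ = Φ * Φ.conjTranspose)
    (hC : C θ = Matrix.vecMul (rFun T s d μ a M φ θ) Φ.conjTranspose) :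
    hFun T s d μ f a M C θ = hSimple T s d μ a M φ Ψ θ := by
  set w := symbolRatio s d (zstep μ) θ with hwdef
  have hn : ((‖chi s d (zstep μ) θ‖ ^ 2 / ‖beta s d θ‖ ^ 2 : ℝ) : ℂ) = w * star w := by
    rw [← div_pow, ← norm_div, Complex.star_def, Complex.mul_conj, Complex.normSq_eq_norm_sq]
    rfl
  have hw' : star w ≠ 0 := star_ne_zero.2 hw
  rw [hn] at hΦ
  have hΨ' : Φ * Ψ θ = 1 := mul_eq_one_comm.1 hΨ
  have hΨh : Φ.conjTranspose * (Ψ θ).conjTranspose = 1 := by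
    rw [← Matrix.conjTranspose_mul, hΨ, Matrix.conjTranspose_one]
  have hinv : (f θ)⁻¹ = (w * star w) • ((Ψ θ).conjTranspose * Ψ θ) := by
    refine Matrix.inv_eq_right_inv ?_
    rw [Matrix.mul_smul, ← Matrix.smul_mul, hΦ, mul_assoc, ← mul_assoc Φ.conjTranspose, hΨh,
      one_mul, hΨ']
  have h1 : Matrix.vecMul (C θ) (f θ)⁻¹ =
      (w * star w) • (Ψ θ).transpose.mulVec (rFun T s d μ a M φ θ) := by
    rw [hC, hinv, Matrix.vecMul_smul, Matrix.vecMul_vecMul, ← mul_assoc, hΨh, one_mul,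
      Matrix.mulVec_transpose]
  ext p
  rw [hFun, hSimple, star_beta_div_chi_neg, h1, ← hwdef]
  change _ = w * _
  rw [Pi.smul_apply, smul_eq_mul, star_inv₀]
  change BFun T s d μ a M θ p * w - _ = _
  field_simp

/-- The norm of a combination of innovations. -/
theorem norm_sq_sum_innovLp (h : IsCanonicalMA P X φ ε) (N : ℕ) (ρ : ℕ → Fin q → ℂ) :
    ‖∑ k ∈ Finset.range N, ∑ j, ρ k j • innovLp h (k : ℤ) j‖ ^ 2 =
      ∑ k ∈ Finset.range N, ∑ j, ‖ρ k j‖ ^ 2 := by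
  have hon : Orthonormal ℂ fun x : ℕ × Fin q => innovLp h (x.1 : ℤ) x.2 := by
    rw [orthonormal_iff_ite]
    rintro ⟨k, i⟩ ⟨l, j⟩
    rw [inner_innovLp]
    simp only [Prod.mk.injEq, Nat.cast_inj, and_comm]
  have h1 := hon.inner_sum (fun x => ρ x.1 x.2) (fun x => ρ x.1 x.2)
    (Finset.range N ×ˢ Finset.univ)
  rw [Finset.sum_product, Finset.sum_product, inner_self_eq_norm_sq_to_K] at h1
  have h2 : ∀ z : ℂ, (starRingEnd ℂ) z * z = ((‖z‖ ^ 2 : ℝ) : ℂ) := fun z => by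
    rw [mul_comm, Complex.mul_conj, Complex.normSq_eq_norm_sq]
  simp only [h2, ← Complex.ofReal_sum] at h1
  exact Complex.ofReal_injective ((Complex.ofReal_pow _ _).trans h1)

/-- Parseval's identity for trigonometric polynomials. -/
theorem integral_sum_norm_sq_trig (N : ℕ) (ρ : ℕ → Fin q → ℂ) :
    1 / (2 * Real.pi) *
      ∫ θ, ∑ j, ‖∑ k ∈ Finset.range N, ρ k j * ex (k : ℤ) θ‖ ^ 2 ∂circ =
      ∑ k ∈ Finset.range N, ∑ j, ‖ρ k j‖ ^ 2 := by
  have hi : ∀ n, Integrable (ex n) circ := fun n => (memLp_ex n).integrable (by norm_num)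
  have h2 : ∀ z : ℂ, ((‖z‖ ^ 2 : ℝ) : ℂ) = z * star z := fun z => by
    rw [Complex.star_def, Complex.mul_conj, Complex.normSq_eq_norm_sq]
  refine Complex.ofReal_injective ?_
  rw [Complex.ofReal_mul, ← integral_complex_ofReal, Finset.sum_comm]
  have h3 : ∀ θ, ((∑ j, ‖∑ k ∈ Finset.range N, ρ k j * ex (k : ℤ) θ‖ ^ 2 : ℝ) : ℂ) =
      ∑ j, ∑ k ∈ Finset.range N, ∑ l ∈ Finset.range N,
        ρ k j * star (ρ l j) * ex ((k : ℤ) - l) θ := by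
    intro θ
    rw [Complex.ofReal_sum]
    refine Finset.sum_congr rfl fun j _ => ?_
    rw [h2, star_sum, Finset.sum_mul_sum]
    refine Finset.sum_congr rfl fun k _ => Finset.sum_congr rfl fun l _ => ?_
    rw [star_mul', star_ex, sub_eq_add_neg, ← ex_add]
    ring
  simp only [h3]
  rw [integral_finsetSum _ fun j _ => integrable_finsetSum _ fun k _ => integrable_finsetSum _
    fun l _ => (hi _).const_mul _, Finset.mul_sum, Complex.ofReal_sum]
  refine Finset.sum_congr rfl fun j _ => ?_
  rw [integral_finsetSum _ fun k _ => integrable_finsetSum _ fun l _ => (hi _).const_mul _,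
    Finset.mul_sum, Complex.ofReal_sum]
  refine Finset.sum_congr rfl fun k hk => ?_
  rw [integral_finsetSum _ fun l _ => (hi _).const_mul _, h2]
  simp only [integral_const_mul, integral_ex, sub_eq_zero, Nat.cast_inj, mul_ite, mul_zero]
  rw [Finset.sum_ite_eq, if_pos hk]
  have := two_pi_ne_zero
  push_cast
  field_simp

end

end GMForecast

end

theorem mainTheorem5 {Ω : Type*} [MeasurableSpace Ω] (P : Measure Ω) [IsProbabilityMeasure P]
    {r : ℕ} (T : ℕ) (hT : 0 < T) (s d μ : Fin r → ℕ)
    (hs : ∀ i, 0 < s i) (hd : ∀ i, 0 < d i) (hμ : ∀ i, 0 < μ i)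
    (ζ : ℤ → Ω → ℂ) (hζ : GMForecast.IsPeriodicallyStationary P T s d ζ)
    (hmean : ∀ m p, ∫ ω, GMForecast.vecIncrement s d (GMForecast.zstep μ)
      (GMForecast.blocks T ζ) m p ω ∂P = 0)
    (f : ℝ → Matrix (Fin T) (Fin T) ℂ)
    (hf : GMForecast.IsSpectralDensity P s d (GMForecast.blocks T ζ) f)
    (hmin : GMForecast.IsMinimal s d μ f)
    (a : ℕ → ℂ) (M : ℕ) :
    -- `A_M ζ = A_N ξ` with `N = [M/T]`
    (∀ ω, GMForecast.functional a M ζ ω =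
      ∑ k ∈ Finset.range (M / T + 1), ∑ p : Fin T,
        GMForecast.vecCoeff T a M k p * GMForecast.blocks T ζ (k : ℤ) p ω) ∧
    -- the spectral process, the solution `c = F_μ⁻¹ D_N a_N` and the optimal estimate exist
    (∃ Z, GMForecast.IsSpectralProcess P s d (GMForecast.blocks T ζ) f Z) ∧
    (∃! c, GMForecast.FApply s d μ f c (GMForecast.bCoeff T s d μ a M)) ∧
    (∃ Y, GMForecast.IsOptimalEstimate P T s d μ ζ a M Y) ∧
    ∀ c, GMForecast.FApply s d μ f c (GMForecast.bCoeff T s d μ a M) →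
    ∀ C, GMForecast.IsSymbol c C →
      -- the spectral characteristic
      GMForecast.IsSpectralCharacteristic T s d μ f a M (GMForecast.hFun T s d μ f a M C) ∧
      -- the optimal estimate is `∫ hᵀ dZ - V_N ξ`
      (∀ Z, GMForecast.IsSpectralProcess P s d (GMForecast.blocks T ζ) f Z →
        ∀ Y : Ω → ℂ, GMForecast.IsOptimalEstimate P T s d μ ζ a M Y ↔
          GMForecast.HasSpectralIntegral P f Z (GMForecast.hFun T s d μ f a M C)
            (fun ω => Y ω + GMForecast.initialPart T s d μ ζ a M ω)) ∧
      -- the mean square error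
      (∀ Y, GMForecast.IsOptimalEstimate P T s d μ ζ a M Y →
        Integrable (fun θ => star (GMForecast.beta s d θ) /
            GMForecast.chi s d (GMForecast.zstep μ) (-θ) *
            (C θ ⬝ᵥ ((f θ)⁻¹).mulVec (star (C θ))) *
            (GMForecast.beta s d θ / GMForecast.chi s d (GMForecast.zstep μ) θ))
          GMForecast.circ ∧
        (GMForecast.mse P ζ a M Y : ℂ) = 1 / (2 * (Real.pi : ℂ)) *
          ∫ θ, star (GMForecast.beta s d θ) /
            GMForecast.chi s d (GMForecast.zstep μ) (-θ) *
            (C θ ⬝ᵥ ((f θ)⁻¹).mulVec (star (C θ))) *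
            (GMForecast.beta s d θ / GMForecast.chi s d (GMForecast.zstep μ) θ)
            ∂GMForecast.circ ∧
        (GMForecast.mse P ζ a M Y : ℂ) =
          ∑ k ∈ Finset.range (M / T + 1),
            GMForecast.bCoeff T s d μ a M k ⬝ᵥ star (c k)) ∧
      -- the case of a canonical factorization
      (∀ (q : ℕ) (φ : ℕ → Matrix (Fin T) (Fin q) ℂ) (Φ : ℝ → Matrix (Fin T) (Fin q) ℂ),
        GMForecast.IsCanonicalFactorization P s d μ (GMForecast.blocks T ζ) f φ Φ →
        (∃ Ψ : ℝ → Matrix (Fin q) (Fin T) ℂ, ∀ᵐ θ ∂GMForecast.circ, Ψ θ * Φ θ = 1) ∧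
        ∀ Ψ : ℝ → Matrix (Fin q) (Fin T) ℂ, (∀ᵐ θ ∂GMForecast.circ, Ψ θ * Φ θ = 1) →
          (∀ᵐ θ ∂GMForecast.circ, GMForecast.hFun T s d μ f a M C θ =
            GMForecast.hSimple T s d μ a M φ Ψ θ) ∧
          ∀ Y, GMForecast.IsOptimalEstimate P T s d μ ζ a M Y →
            GMForecast.mse P ζ a M Y = 1 / (2 * Real.pi) *
              ∫ θ, ∑ j, ‖GMForecast.rFun T s d μ a M φ θ j‖ ^ 2 ∂GMForecast.circ ∧
            GMForecast.mse P ζ a M Y =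
              ∑ k ∈ Finset.range (M / T + 1), ∑ j,
                ‖GMForecast.rCoeff T s d μ a M φ k j‖ ^ 2) := by
  obtain ⟨A, hA⟩ := GMForecast.exists_isDensityFactor hf.integrable hf.posSemidef hmin.1
  obtain ⟨U, hU, hU2⟩ := GMForecast.exists_spectral_isometry hζ hf hA hs hμ hmin
  have hopt := GMForecast.isOptimalEstimate_iff hT hs hμ hζ hA hmin hU hU2 a M
  refine ⟨fun ω => GMForecast.sum_eq_sum_vecCoeff hT a M fun j => ζ j ω,
    ⟨_, GMForecast.isSpectralProcess_of_isometry hζ hA hs hμ hmin hmean hU hU2⟩,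
    GMForecast.existsUnique_fApply hs hμ hA hmin a M,
    ⟨fun ω => GMForecast.functional a M ζ ω - U (GMForecast.optResidual hs hμ hA hmin a M) ω,
      (hopt _).2 (Eventually.of_forall fun ω => sub_sub_cancel _ _)⟩, fun c hc C hC => ?_⟩
  have hmse : ∀ Y, GMForecast.IsOptimalEstimate P T s d μ ζ a M Y →
      GMForecast.mse P ζ a M Y =
        1 / (2 * Real.pi) * ‖GMForecast.optResidual hs hμ hA hmin a M‖ ^ 2 :=
    fun Y hY => GMForecast.mse_eq_norm_sq hU2 ((hopt Y).1 hY)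
  refine ⟨GMForecast.isSpectralCharacteristic_hFun hs hμ hA hmin a M hc hC,
    fun Z hZ Y => GMForecast.isOptimalEstimate_iff_hasSpectralIntegral hT hs hμ hζ hA hmin hU hU2
      a M hc hC hZ Y, fun Y hY => ⟨?_, ?_, ?_⟩, fun q φ Φ hΦ => ?_⟩
  · exact (GMForecast.integrable_inner_ofLp _ _).congr
      (GMForecast.ae_error_density hs hμ hA hmin a M hc hC)
  · rw [← integral_congr_ae (GMForecast.ae_error_density hs hμ hA hmin a M hc hC),
      ← GMForecast.inner_eq_integral, inner_self_eq_norm_sq_to_K, hmse Y hY]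
    push_cast
    rfl
  · have hcr := (GMForecast.existsUnique_fApply hs hμ hA hmin a M).unique hc
      ((GMForecast.fApply_iff hs hμ hA _ _).2
        ⟨_, GMForecast.isSymbol_residualCoeff (hA.isMinimalFactor hs hμ hmin) _ _,
          GMForecast.solvesToeplitz_residual _ _ _
            (GMForecast.bCoeff_eq_zero_of_lt T s d μ a M)⟩)
    rw [hmse Y hY, hcr]
    exact GMForecast.norm_sq_residual _ _ _
  · obtain rfl := hΦ.card_eq hs hμ hζ hmin
    refine ⟨⟨fun θ => (Φ θ)⁻¹, ?_⟩, fun Ψ hΨ => ⟨?_, fun Y hY => ?_⟩⟩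
    · filter_upwards [GMForecast.ae_isUnit_factor hs hμ hmin hΦ.factorization] with θ h
      rw [Matrix.isUnit_iff_isUnit_det, Matrix.det_mul] at h
      exact Matrix.nonsing_inv_mul _ (isUnit_of_mul_isUnit_left h)
    · filter_upwards [GMForecast.ae_symbolRatio_ne_zero s d hs μ hμ, hΨ, hΦ.factorization,
        GMForecast.ae_symbol_eq_factor hT hs hμ hζ hA hmin hU hU2 hΦ a M hc hC] with θ h1 h2 h3 h4
      exact GMForecast.hFun_eq_hSimple h1 h2 h3 h4
    · obtain ⟨ε, hε⟩ := hΦ.movingAverage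
      have hr : GMForecast.mse P ζ a M Y = ∑ k ∈ Finset.range (M / q + 1), ∑ j,
          ‖GMForecast.rCoeff q s d μ a M φ k j‖ ^ 2 := by
        rw [hmse Y hY, ← GMForecast.norm_sq_isometry hU2,
          GMForecast.map_optResidual hT hs hμ hζ hA hmin hU hU2 hε,
          GMForecast.norm_sq_sum_innovLp]
      exact ⟨hr.trans (GMForecast.integral_sum_norm_sq_trig _ _).symm, hr⟩
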